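/- **Setting.** Let $d\ge 2$, let $\Omega\subset\mathbb R^d$ be a bounded open set (e.g. a bounded Lipschitz domain), and let $A\in L^\infty(\Omega;\mathbb R^{d\times d}_{\rm sym})$, $\boldsymbol b\in L^\infty(\Omega;\mathbb R^d)$, $c\in L^\infty(\Omega)$, with $A$ uniformly positive definite, such that $a(u,v)=\int_\Omega A\nabla u\cdot\nabla v+\int_\Omega \boldsymbol b\cdot\nabla u\,v+\int_\Omega cuv$ is elliptic on $H^1_0(\Omega)$. Put $|\!|\!|v|\!|\!|^2=\int_\Omega A\nabla v\cdot\nabla v$. Let $\mathcal K:H^1_0(\Omega)\to H^{-1}(\Omega)$ be linear, bounded and **compact**, and $b(v,w)=\langle\mathcal Kv,w\rangle$. Given $f\in L^2(\Omega)$, $\boldsymbol f\in L^2(\Omega)^d$, let $u\in H^1_0(\Omega)$ solve $a(u,v)=\int_\Omega fv-\int_\Omega\boldsymbol f\cdot\nabla v$ for all $v\in H^1_0(\Omega)$ and, for $w\in H^1_0(\Omega)$, let $z[w]\in H^1_0(\Omega)$ solve $a(v,z[w])=b(v,w)+b(w,v)$ for all $v\in H^1_0(\Omega)$. For a conforming simplicial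 triangulation $\mathcal T_H$ of $\Omega$ and fixed $p\ge1$ let $\mathcal X_H\subset H^1_0(\Omega)$ be the functions that are polynomials of degree $\le p$ on each element, and let $u_H,z_H[w]\in\mathcal X_H$ be the Galerkin approximations of $u$, $z[w]$. **Meshes.** Let $\mathcal T_0$ be an initial conforming triangulation and $(\mathcal T,\mathcal M)\mapsto{\tt refine}(\mathcal T,\mathcal M)$ a refinement strategy; $\mathbb T(\mathcal T_H)$ is the set of all meshes obtained from $\mathcal T_H$ by finitely many refinement steps, $\mathbb T=\mathbb T(\mathcal T_0)$. Assume that all $\mathcal T\in\mathbb T$ are conforming triangulations of $\Omega$, that elements of a refined mesh are contained in elements of the old one, that $\mathcal M\subseteq\mathcal T\setminus{\tt refine}(\mathcal T,\mathcal M)$, that $\#(\mathcal T_H\setminus\mathcal T_h)+\#\mathcal T_H\le\#\mathcal T_h$ for $\mathcal T_h\in\mathbb T(\mathcal T_H)$, that $\#\mathcal T_\ell-\#\mathcal T_0\le C_{\rm mesh}\sum_{j<\ell}\#\mathcal M_j$ whenever $\mathcal T_{j+1}={\tt refine}(\mathcal T_j,\mathcal M_j)$ with $\mathcal M_j\subseteq\mathcal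 T_j$, and that any two meshes $\mathcal T_H,\mathcal T_h\in\mathbb T$ have a common refinement in $\mathbb T(\mathcal T_H)\cap\mathbb T(\mathcal T_h)$ with at most $\#\mathcal T_H+\#\mathcal T_h-\#\mathcal T_0$ elements. **Estimators.** Let $\eta_H(T,v)\ge0$ and $\zeta_H[w](T,v)\ge0$ be refinement indicators for $T\in\mathcal T_H\in\mathbb T$, $v\in\mathcal X_H$, $w\in H^1_0(\Omega)$ (the primal problem, and the dual problem with linearization point $w$). Put $\eta_H(\mathcal U,v)^2=\sum_{T\in\mathcal U}\eta_H(T,v)^2$, $\eta_H(v)=\eta_H(\mathcal T_H,v)$, similarly for $\zeta_H[w]$, and $\zeta_H(\mathcal U,z_H[w]):=\zeta_H[w](\mathcal U,z_H[w])$. Assume, with constants $C_{\rm stab},C_{\rm rel},C_{\rm drel}>0$, $C_{\rm lip}\ge0$, $0<q_{\rm red}<1$, for all $\mathcal T_H\in\mathbb T$, $\mathcal T_h\in\mathbb T(\mathcal T_H)$ and all $w,w'\in H^1_0(\Omega)$: * (A1) $|\eta_h(\mathcal U,v_h)-\eta_H(\mathcal U,v_H)|+|\zeta_h[w](\mathcal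 U,v_h)-\zeta_H[w'](\mathcal U,v_H)|\le C_{\rm stab}|\!|\!|v_h-v_H|\!|\!|+C_{\rm lip}|\!|\!|w-w'|\!|\!|$ for all $\mathcal U\subseteq\mathcal T_h\cap\mathcal T_H$, $v_h\in\mathcal X_h$, $v_H\in\mathcal X_H$; * (A2) $\eta_h(\mathcal T_h\setminus\mathcal T_H,v_H)\le q_{\rm red}\,\eta_H(\mathcal T_H\setminus\mathcal T_h,v_H)$ for all $v_H\in\mathcal X_H$, and the same for $\zeta[w]$; * (A3) $|\!|\!|u-u_H|\!|\!|\le C_{\rm rel}\,\eta_H(u_H)$ and $|\!|\!|z[w]-z_H[w]|\!|\!|\le C_{\rm rel}\,\zeta_H(z_H[w])$; * (A4) $|\!|\!|u_h-u_H|\!|\!|\le C_{\rm drel}\,\eta_H(\mathcal T_H\setminus\mathcal T_h,u_H)$ and $|\!|\!|z_h[w]-z_H[w]|\!|\!|\le C_{\rm drel}\,\zeta_H(\mathcal T_H\setminus\mathcal T_h,z_H[w])$. ($C_{\rm lip}=0$ is the case of indicators $\zeta_H(T,v)$ that do not depend on $w$.) Write $E_H(\mathcal U)=\eta_H(\mathcal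 U,u_H)^2+\zeta_H(\mathcal U,z_H[u_H])^2$ and $E_H=E_H(\mathcal T_H)=\eta_H(u_H)^2+\zeta_H(z_H[u_H])^2$. **Algorithm B.** With parameters $0<\theta\le1$, $C_{\rm mark}\ge1$, for $\ell=0,1,2,\dots$: choose $\mathcal M_\ell\subseteq\mathcal T_\ell$ with $\theta E_\ell\le E_\ell(\mathcal M_\ell)$ whose cardinality is minimal up to the factor $C_{\rm mark}$ among all such sets, and set $\mathcal T_{\ell+1}={\tt refine}(\mathcal T_\ell,\mathcal M_\ell)$. **Approximation classes.** With $\mathbb T_N=\{\mathcal T\in\mathbb T:\#\mathcal T-\#\mathcal T_0\le N\}$ and $s,t>0$, let $\|u\|_{\mathbb A_s}=\sup_N(N+1)^s\min_{\mathcal T_H\in\mathbb T_N}\eta_H(u_H)$ and $\|z[u]\|_{\mathbb A_t}=\sup_N(N+1)^t\min_{\mathcal T_H\in\mathbb T_N}\zeta_H(z_H[u])$ in $[0,\infty]$. **Theorem.** (i) For all $0<\theta\le1$ there are $\ell_0\in\mathbb N_0$, $C_{\rm lin}>0$, $0<q_{\rm lin}<1$, depending only on $\theta$, $q_{\rm red}$,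 $C_{\rm stab}$, $C_{\rm lip}$, $C_{\rm rel}$, $a(\cdot,\cdot)$ and $\mathcal K$, such that Algorithm B guarantees, for every $C_{\rm mark}\ge1$ and all $n\ge\ell\ge\ell_0$, $$\eta_n(u_n)^2+\zeta_n(z_n[u_n])^2\le C_{\rm lin}\,q_{\rm lin}^{\,n-\ell}\,\big[\eta_\ell(u_\ell)^2+\zeta_\ell(z_\ell[u_\ell])^2\big].$$ (ii) There are constants $\widehat C_{\rm stab},\widehat C_{\rm drel}>0$, depending only on the constants in (A1)–(A4), $a(\cdot,\cdot)$ and $\mathcal K$, with which the combined estimator is stable and discretely reliable, i.e. for all $\mathcal T_H\in\mathbb T$, $\mathcal T_h\in\mathbb T(\mathcal T_H)$, $\mathcal U\subseteq\mathcal T_h\cap\mathcal T_H$, $v_h,w_h\in\mathcal X_h$, $v_H,w_H\in\mathcal X_H$, $$\Big|\big[\eta_h(\mathcal U,v_h)^2+\zeta_h[v_h](\mathcal U,w_h)^2\big]^{1/2}-\big[\eta_H(\mathcal U,v_H)^2+\zeta_H[v_H](\mathcal U,w_H)^2\big]^{1/2}\Big|\le\widehat C_{\rm stab}\big[|\!|\!|v_h-v_H|\!|\!|+|\!|\!|w_h-w_H|\!|\!|\big],$$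 $$|\!|\!|u_h-u_H|\!|\!|+|\!|\!|z_h[u_h]-z_H[u_H]|\!|\!|\le\widehat C_{\rm drel}\,E_H(\mathcal T_H\setminus\mathcal T_h)^{1/2}.$$ For any such constants, all $0<\theta<\theta_{\rm opt}:=(1+\widehat C_{\rm stab}^2\widehat C_{\rm drel}^2)^{-1}$ and all $s,t>0$, there is $C_{\rm opt}>0$, depending only on $\theta$, $C_{\rm mesh}$, $C_{\rm mark}$, $s$, $t$, the constants of (A1)–(A4), $\widehat C_{\rm stab}$, $\widehat C_{\rm drel}$, $a(\cdot,\cdot)$ and $\mathcal K$, such that, if $\|u\|_{\mathbb A_s}+\|z[u]\|_{\mathbb A_t}<\infty$, Algorithm B guarantees, with the same $\ell_0$ as in (i), for all $\ell\ge\ell_0$, $$\eta_\ell(u_\ell)^2+\zeta_\ell(z_\ell[u_\ell])^2\le C_{\rm opt}\,\big(\|u\|_{\mathbb A_s}^2+\|z[u]\|_{\mathbb A_t}^2\big)\,(\#\mathcal T_\ell-\#\mathcal T_0)^{-\beta},\qquad\beta:=\min\{2s,2t\},\tag{1}$$ where $0^{-\beta}:=\infty$. (ii′) If $0<\theta<(1+(C_{\rm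 stab}+C_{\rm lip})^2C_{\rm drel}^2)^{-1}$ (for $C_{\rm lip}=0$ this is $(1+C_{\rm stab}^2C_{\rm drel}^2)^{-1}$ with the constants of (A1) and (A4)), then for every run of Algorithm B there is $\ell_0\in\mathbb N_0$ such that, for all $s,t>0$ with $\|u\|_{\mathbb A_s}+\|z[u]\|_{\mathbb A_t}<\infty$ and all $\ell\ge\ell_0$, (1) holds with $C_{\rm opt}=C\,(\#\mathcal T_{\ell_0}-\#\mathcal T_0+1)^{\beta}$, where $C>0$ depends only on $\theta$, $C_{\rm mesh}$, $C_{\rm mark}$, $s$, $t$, the constants of (A1)–(A4), $a(\cdot,\cdot)$ and $\mathcal K$. -/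

import Mathlib

open MeasureTheory
open scoped ENNReal ContDiff Matrix

noncomputable section

namespace GOAFEM

/-! ### The Sobolev space `H¹₀(Ω)` -/

/-- Points of `ℝᵈ` with the Euclidean norm. -/
abbrev Pt (d : ℕ) : Type := EuclideanSpace ℝ (Fin d)

/-- The Hilbert space `L²(Ω) × L²(Ω; ℝᵈ)` with norm `(‖v‖² + ‖g‖²)^{1/2}`. -/
abbrev L2Pair {d : ℕ} (Ω : Set (Pt d)) : Type :=
  WithLp 2 (Lp ℝ 2 (volume.restrict Ω) × Lp (Pt d) 2 (volume.restrict Ω))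

/-- The pairs `(φ, ∇φ)` for smooth `φ` with compact support in `Ω`. -/
def testPairs {d : ℕ} (Ω : Set (Pt d)) : Submodule ℝ (L2Pair Ω) where
  carrier := {q | ∃ φ : Pt d → ℝ, ContDiff ℝ ∞ φ ∧ HasCompactSupport φ ∧ tsupport φ ⊆ Ω ∧
    q.fst =ᵐ[volume.restrict Ω] φ ∧ q.snd =ᵐ[volume.restrict Ω] gradient φ}
  zero_mem' := by
    refine ⟨0, contDiff_const, HasCompactSupport.zero, by simp [tsupport], ?_, ?_⟩
    · exact Lp.coeFn_zero _ _ _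
    · refine (Lp.coeFn_zero _ _ _).trans (Filter.Eventually.of_forall fun x => ?_)
      simp [gradient]
  add_mem' := by
    rintro q r ⟨φ, hφ, hφc, hφs, h1, h2⟩ ⟨ψ, hψ, hψc, hψs, h3, h4⟩
    refine ⟨φ + ψ, hφ.add hψ, hφc.add hψc,
      (tsupport_add φ ψ).trans (Set.union_subset hφs hψs), ?_, ?_⟩
    · exact (Lp.coeFn_add _ _).trans (h1.add h3)
    · refine ((Lp.coeFn_add _ _).trans (h2.add h4)).trans
        (Filter.Eventually.of_forall fun x => ?_)
      have e : fderiv ℝ (φ + ψ) x = fderiv ℝ φ x + fderiv ℝ ψ x :=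
        fderiv_add (hφ.differentiable (by simp) x) (hψ.differentiable (by simp) x)
      simp [gradient, e]
  smul_mem' := by
    rintro c q ⟨φ, hφ, hφc, hφs, h1, h2⟩
    refine ⟨c • φ, contDiff_const.smul hφ, hφc.smul_left (f := fun _ => c),
      (closure_mono (Function.support_const_smul_subset c φ)).trans hφs, ?_, ?_⟩
    · exact (Lp.coeFn_smul _ _).trans (h1.const_smul c)
    · refine ((Lp.coeFn_smul _ _).trans (h2.const_smul c)).trans
        (Filter.Eventually.of_forall fun x => ?_)
      have e : fderiv ℝ (c • φ) x = c • fderiv ℝ φ x :=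
        fderiv_const_smul (hφ.differentiable (by simp) x) c
      simp [gradient, e]

/-- `H¹₀(Ω)`: the closure of the smooth functions with compact support in `Ω` with respect to the
`H¹`-norm. An element is the pair `(v, ∇v)` of a function and its weak gradient. -/
def H10 {d : ℕ} (Ω : Set (Pt d)) : Submodule ℝ (L2Pair Ω) :=
  (testPairs Ω).topologicalClosure

/-- The function itself. -/
def fn {d : ℕ} {Ω : Set (Pt d)} (v : H10 Ω) : Lp ℝ 2 (volume.restrict Ω) := v.1.fst

/-- Its weak gradient. -/
def grad {d : ℕ} {Ω : Set (Pt d)} (v : H10 Ω) : Lp (Pt d) 2 (volume.restrict Ω) := v.1.snd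

/-! ### The elliptic problem -/

/-- The coefficients of `-div A∇u + b·∇u + c u`. -/
structure Coeff (d : ℕ) where
  A : Pt d → Matrix (Fin d) (Fin d) ℝ
  b : Pt d → Pt d
  c : Pt d → ℝ

/-- `∫_Ω A∇u · ∇v`. -/
def principal {d : ℕ} (κ : Coeff d) (Ω : Set (Pt d)) (u v : H10 Ω) : ℝ :=
  ∫ x in Ω, (κ.A x *ᵥ (grad u x).ofLp) ⬝ᵥ (grad v x).ofLp

/-- `a(u,v) = ∫_Ω A∇u · ∇v + ∫_Ω (b·∇u) v + ∫_Ω c u v`. -/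
def form {d : ℕ} (κ : Coeff d) (Ω : Set (Pt d)) (u v : H10 Ω) : ℝ :=
  principal κ Ω u v
    + (∫ x in Ω, inner ℝ (κ.b x) (grad u x) * fn v x)
    + ∫ x in Ω, κ.c x * fn u x * fn v x

/-- The energy norm `(∫_Ω A∇v · ∇v)^{1/2}`. -/
def energyNorm {d : ℕ} (κ : Coeff d) {Ω : Set (Pt d)} (v : H10 Ω) : ℝ :=
  √(principal κ Ω v v)

/-- Assumptions on the coefficients: bounded, `A` symmetric and uniformly positive definite, and
`a(·,·)` elliptic on `H¹₀(Ω)`. -/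
structure Coeff.Admissible {d : ℕ} (κ : Coeff d) (Ω : Set (Pt d)) : Prop where
  bounded_A : ∀ i j, MemLp (fun x => κ.A x i j) ∞ (volume.restrict Ω)
  bounded_b : MemLp κ.b ∞ (volume.restrict Ω)
  bounded_c : MemLp κ.c ∞ (volume.restrict Ω)
  symm : ∀ᵐ x ∂(volume.restrict Ω), (κ.A x).IsSymm
  posDef : ∃ α : ℝ, 0 < α ∧ ∀ᵐ x ∂(volume.restrict Ω), ∀ y : Pt d,
    α * ‖y‖ ^ 2 ≤ y.ofLp ⬝ᵥ (κ.A x *ᵥ y.ofLp)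
  elliptic : ∃ Cell : ℝ, 0 < Cell ∧ ∀ v : H10 Ω, Cell * ‖v‖ ^ 2 ≤ form κ Ω v v

/-- Bounded operators `𝒦 : H¹₀(Ω) → H⁻¹(Ω) = H¹₀(Ω)'`; `b(v,w) = ⟨𝒦 v, w⟩` is `K v w`. -/
abbrev GoalOp {d : ℕ} (Ω : Set (Pt d)) : Type := H10 Ω →L[ℝ] StrongDual ℝ (H10 Ω)

/-! ### Triangulations and finite element spaces -/

/-- A simplex, given by its set of vertices. -/
abbrev Element (d : ℕ) : Type := Finset (Pt d)

/-- A finite set of simplices. -/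
abbrev Mesh (d : ℕ) : Type := Finset (Element d)

/-- The compact simplex spanned by the vertices. -/
def Element.hull {d : ℕ} (T : Element d) : Set (Pt d) := convexHull ℝ (T : Set (Pt d))

/-- Conforming triangulations of `Ω` into compact nondegenerate simplices: two elements meet in the
convex hull of their common vertices. -/
structure IsTriangulation {d : ℕ} (Ω : Set (Pt d)) (𝒯 : Mesh d) : Prop where
  card_vertices : ∀ T ∈ 𝒯, T.card = d + 1
  nondegenerate : ∀ T ∈ 𝒯, AffineIndependent ℝ (fun x : T => (x : Pt d))
  conforming : ∀ T ∈ 𝒯, ∀ T' ∈ 𝒯,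
    T.hull ∩ T'.hull = convexHull ℝ ((T : Set (Pt d)) ∩ (T' : Set (Pt d)))
  cover : ⋃ T ∈ 𝒯, Element.hull T = closure Ω

/-- The functions `v ∈ H¹₀(Ω)` such that `v|_T` is a polynomial of degree at most `p` for all
`T ∈ 𝒯`. -/
def feSpace {d : ℕ} (Ω : Set (Pt d)) (p : ℕ) (𝒯 : Mesh d) : Submodule ℝ (H10 Ω) where
  carrier := {v | ∀ T ∈ 𝒯, ∃ P : MvPolynomial (Fin d) ℝ, P.totalDegree ≤ p ∧
    ∀ᵐ x ∂(volume.restrict Ω), x ∈ Element.hull T → fn v x = MvPolynomial.eval x.ofLp P}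
  zero_mem' := fun T _ => by
    refine ⟨0, by simp, ?_⟩
    have h : (fn (0 : H10 Ω) : Pt d → ℝ) =ᵐ[volume.restrict Ω] 0 := Lp.coeFn_zero _ _ _
    filter_upwards [h] with x hx _
    simp [hx]
  add_mem' := by
    intro v w hv hw T hT
    obtain ⟨P, hP, h1⟩ := hv T hT
    obtain ⟨Q, hQ, h2⟩ := hw T hT
    refine ⟨P + Q, (MvPolynomial.totalDegree_add P Q).trans (max_le hP hQ), ?_⟩
    have h : (fn (v + w) : Pt d → ℝ) =ᵐ[volume.restrict Ω] fn v + fn w :=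
      Lp.coeFn_add _ _
    filter_upwards [h, h1, h2] with x hx h1 h2 hxT
    simp [hx, h1 hxT, h2 hxT]
  smul_mem' := by
    intro c v hv T hT
    obtain ⟨P, hP, h1⟩ := hv T hT
    refine ⟨c • P, (MvPolynomial.totalDegree_smul_le c P).trans hP, ?_⟩
    have h : (fn (c • v) : Pt d → ℝ) =ᵐ[volume.restrict Ω] c • (fn v : Pt d → ℝ) :=
      Lp.coeFn_smul _ _
    filter_upwards [h, h1] with x hx h1 hxT
    simp [hx, h1 hxT]

/-! ### The data of the adaptive algorithm -/

/-- The polynomial degree `p`, the right-hand side `f + div 𝐟`, the initial mesh `𝒯₀`, the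
refinement strategy `(𝒯, ℳ) ↦ refine(𝒯, ℳ)`, the primal refinement indicators
`η_H(T, v) = eta 𝒯_H T v`, and the dual ones. The latter belong to a dual problem
whose right-hand side `v ↦ b(v,w) + b(w,v)` depends on `w`, and so do residual indicators:
`ζ_H[w](T, v) = zeta 𝒯_H w T v`. -/
structure Data {d : ℕ} (Ω : Set (Pt d)) where
  p : ℕ
  f : Lp ℝ 2 (volume.restrict Ω)
  fvec : Lp (Pt d) 2 (volume.restrict Ω)
  mesh₀ : Mesh d
  refineMesh : Mesh d → Finset (Element d) → Mesh d
  eta : Mesh d → Element d → H10 Ω → ℝ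
  zeta : Mesh d → H10 Ω → Element d → H10 Ω → ℝ

namespace Data

variable {d : ℕ} {Ω : Set (Pt d)}

/-- `𝒯' ∈ 𝕋(𝒯)`: the mesh `𝒯'` is obtained from `𝒯` by finitely many steps of refinement. -/
def Refinement (D : Data Ω) : Mesh d → Mesh d → Prop :=
  Relation.ReflTransGen fun 𝒯 𝒯' => ∃ ℳ ⊆ 𝒯, 𝒯' = D.refineMesh 𝒯 ℳ

/-- `𝒯 ∈ 𝕋 = 𝕋(𝒯₀)`. -/
def IsMesh (D : Data Ω) (𝒯 : Mesh d) : Prop := D.Refinement D.mesh₀ 𝒯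

/-- The finite element space `𝒳_H` of the mesh `𝒯_H`. -/
def space (D : Data Ω) (𝒯 : Mesh d) : Submodule ℝ (H10 Ω) := feSpace Ω D.p 𝒯

open Classical in
/-- The assumptions on the polynomial degree and on the mesh refinement. -/
structure MeshAssumptions (D : Data Ω) (Cmesh : ℝ) : Prop where
  degree : 1 ≤ D.p
  triangulation : ∀ 𝒯, D.IsMesh 𝒯 → IsTriangulation Ω 𝒯
  /-- marked elements are refined -/
  marked : ∀ 𝒯, D.IsMesh 𝒯 → ∀ ℳ ⊆ 𝒯, ℳ ⊆ 𝒯 \ D.refineMesh 𝒯 ℳ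
  /-- a refined mesh consists of elements of the old mesh and of parts of them -/
  subdivision : ∀ 𝒯, D.IsMesh 𝒯 → ∀ ℳ ⊆ 𝒯, ∀ T' ∈ D.refineMesh 𝒯 ℳ,
    ∃ T ∈ 𝒯, Element.hull T' ⊆ Element.hull T
  /-- each refined element has at least two sons -/
  sons : ∀ 𝒯 𝒯', D.IsMesh 𝒯 → D.Refinement 𝒯 𝒯' →
    (𝒯 \ 𝒯').card + 𝒯.card ≤ 𝒯'.card
  /-- mesh-closure estimate -/
  closure : ∀ (𝒯 : ℕ → Mesh d) (ℳ : ℕ → Finset (Element d)), 𝒯 0 = D.mesh₀ →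
    (∀ j, ℳ j ⊆ 𝒯 j ∧ 𝒯 (j + 1) = D.refineMesh (𝒯 j) (ℳ j)) →
    ∀ ℓ, ((𝒯 ℓ).card : ℝ) - D.mesh₀.card ≤ Cmesh * ∑ j ∈ Finset.range ℓ, ((ℳ j).card : ℝ)
  /-- overlay estimate -/
  overlay : ∀ 𝒯 𝒯', D.IsMesh 𝒯 → D.IsMesh 𝒯' →
    ∃ 𝒯'', D.Refinement 𝒯 𝒯'' ∧ D.Refinement 𝒯' 𝒯'' ∧
      𝒯''.card + D.mesh₀.card ≤ 𝒯.card + 𝒯'.card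

/-! #### Exact and discrete solutions -/

/-- The right-hand side `F(v) = ∫_Ω f v - ∫_Ω 𝐟 · ∇v`. -/
def rhs (D : Data Ω) (v : H10 Ω) : ℝ :=
  (∫ x in Ω, D.f x * fn v x) - ∫ x in Ω, inner ℝ (D.fvec x) (grad v x)

/-- The solution `u_X ∈ X` of `a(u_X, v) = F(v)` for all `v ∈ X`. For closed `X` it exists and is
unique by the Lax-Milgram lemma. -/
def primalIn (D : Data Ω) (κ : Coeff d) (X : Submodule ℝ (H10 Ω)) : H10 Ω :=
  Classical.epsilon fun u => u ∈ X ∧ ∀ v ∈ X, form κ Ω u v = D.rhs v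

/-- The solution `z_X[w] ∈ X` of `a(v, z_X[w]) = b(v,w) + b(w,v)` for all `v ∈ X`. -/
def _root_.GOAFEM.dualIn (κ : Coeff d) (K : GoalOp Ω) (X : Submodule ℝ (H10 Ω)) (w : H10 Ω) :
    H10 Ω :=
  Classical.epsilon fun z => z ∈ X ∧ ∀ v ∈ X, form κ Ω v z = K v w + K w v

/-- The exact primal solution `u`. -/
def sol (D : Data Ω) (κ : Coeff d) : H10 Ω := D.primalIn κ ⊤

/-- The exact dual solution `z[w]`. -/
def _root_.GOAFEM.dualSol (κ : Coeff d) (K : GoalOp Ω) (w : H10 Ω) : H10 Ω := dualIn κ K ⊤ w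

/-- The discrete primal solution `u_H`. -/
def solH (D : Data Ω) (κ : Coeff d) (𝒯 : Mesh d) : H10 Ω := D.primalIn κ (D.space 𝒯)

/-- The discrete dual solution `z_H[w]`. -/
def dualH (D : Data Ω) (κ : Coeff d) (K : GoalOp Ω) (𝒯 : Mesh d) (w : H10 Ω) : H10 Ω :=
  dualIn κ K (D.space 𝒯) w

/-! #### Error estimators -/

/-- `η_H(𝒰, v) = (∑_{T ∈ 𝒰} η_H(T, v)²)^{1/2}`. -/
def etaOn (D : Data Ω) (𝒯 : Mesh d) (𝒰 : Finset (Element d)) (v : H10 Ω) : ℝ :=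
  √(∑ T ∈ 𝒰, D.eta 𝒯 T v ^ 2)

/-- `ζ_H[w](𝒰, v) = (∑_{T ∈ 𝒰} ζ_H[w](T, v)²)^{1/2}`. -/
def zetaOn (D : Data Ω) (𝒯 : Mesh d) (w : H10 Ω) (𝒰 : Finset (Element d)) (v : H10 Ω) : ℝ :=
  √(∑ T ∈ 𝒰, D.zeta 𝒯 w T v ^ 2)

open Classical in
/-- The axioms of adaptivity. `Clip` controls the dependence of `ζ_H[w]` on `w`; `Clip = 0` is the
case of indicators `ζ_H(T, v)` that do not depend on `w`. -/
structure Axioms (D : Data Ω) (κ : Coeff d) (K : GoalOp Ω)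
    (Cstab Clip qred Crel Cdrel : ℝ) : Prop where
  eta_nonneg : ∀ 𝒯, D.IsMesh 𝒯 → ∀ T ∈ 𝒯, ∀ v ∈ D.space 𝒯, 0 ≤ D.eta 𝒯 T v
  zeta_nonneg : ∀ 𝒯, D.IsMesh 𝒯 → ∀ w, ∀ T ∈ 𝒯, ∀ v ∈ D.space 𝒯, 0 ≤ D.zeta 𝒯 w T v
  stability : ∀ 𝒯H 𝒯h, D.IsMesh 𝒯H → D.Refinement 𝒯H 𝒯h →
    ∀ vh ∈ D.space 𝒯h, ∀ vH ∈ D.space 𝒯H, ∀ wh wH : H10 Ω, ∀ 𝒰 ⊆ 𝒯h ∩ 𝒯H,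
      |D.etaOn 𝒯h 𝒰 vh - D.etaOn 𝒯H 𝒰 vH| + |D.zetaOn 𝒯h wh 𝒰 vh - D.zetaOn 𝒯H wH 𝒰 vH|
        ≤ Cstab * energyNorm κ (vh - vH) + Clip * energyNorm κ (wh - wH)
  reduction_eta : ∀ 𝒯H 𝒯h, D.IsMesh 𝒯H → D.Refinement 𝒯H 𝒯h → ∀ v ∈ D.space 𝒯H,
    D.etaOn 𝒯h (𝒯h \ 𝒯H) v ≤ qred * D.etaOn 𝒯H (𝒯H \ 𝒯h) v
  reduction_zeta : ∀ 𝒯H 𝒯h, D.IsMesh 𝒯H → D.Refinement 𝒯H 𝒯h → ∀ v ∈ D.space 𝒯H,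
    ∀ w : H10 Ω, D.zetaOn 𝒯h w (𝒯h \ 𝒯H) v ≤ qred * D.zetaOn 𝒯H w (𝒯H \ 𝒯h) v
  reliability_eta : ∀ 𝒯H, D.IsMesh 𝒯H →
    energyNorm κ (D.sol κ - D.solH κ 𝒯H) ≤ Crel * D.etaOn 𝒯H 𝒯H (D.solH κ 𝒯H)
  reliability_zeta : ∀ 𝒯H, D.IsMesh 𝒯H → ∀ w : H10 Ω,
    energyNorm κ (dualSol κ K w - D.dualH κ K 𝒯H w)
      ≤ Crel * D.zetaOn 𝒯H w 𝒯H (D.dualH κ K 𝒯H w)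
  discrete_reliability_eta : ∀ 𝒯H 𝒯h, D.IsMesh 𝒯H → D.Refinement 𝒯H 𝒯h →
    energyNorm κ (D.solH κ 𝒯h - D.solH κ 𝒯H) ≤ Cdrel * D.etaOn 𝒯H (𝒯H \ 𝒯h) (D.solH κ 𝒯H)
  discrete_reliability_zeta : ∀ 𝒯H 𝒯h, D.IsMesh 𝒯H → D.Refinement 𝒯H 𝒯h → ∀ w : H10 Ω,
    energyNorm κ (D.dualH κ K 𝒯h w - D.dualH κ K 𝒯H w)
      ≤ Cdrel * D.zetaOn 𝒯H w (𝒯H \ 𝒯h) (D.dualH κ K 𝒯H w)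

/-- The discrete dual solution `z_H[u_H]`, linearized around `u_H`. -/
def dualLinH (D : Data Ω) (κ : Coeff d) (K : GoalOp Ω) (𝒯 : Mesh d) : H10 Ω :=
  D.dualH κ K 𝒯 (D.solH κ 𝒯)

/-- The square `η_H(𝒰, v)² + ζ_H[v](𝒰, w)²` of the combined estimator. -/
def combSq (D : Data Ω) (𝒯 : Mesh d) (𝒰 : Finset (Element d)) (v w : H10 Ω) : ℝ :=
  D.etaOn 𝒯 𝒰 v ^ 2 + D.zetaOn 𝒯 v 𝒰 w ^ 2

/-- `η_H(𝒰, u_H)² + ζ_H(𝒰, z_H[u_H])²`. -/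
def estOn (D : Data Ω) (κ : Coeff d) (K : GoalOp Ω) (𝒯 : Mesh d) (𝒰 : Finset (Element d)) : ℝ :=
  D.combSq 𝒯 𝒰 (D.solH κ 𝒯) (D.dualLinH κ K 𝒯)

/-- `η_H(u_H)² + ζ_H(z_H[u_H])²`. -/
def est (D : Data Ω) (κ : Coeff d) (K : GoalOp Ω) (𝒯 : Mesh d) : ℝ := D.estOn κ K 𝒯 𝒯

open Classical in
/-- Stability and discrete reliability of the combined estimator with constants `Cs` and `Cd`. -/
structure CombinedAxioms (D : Data Ω) (κ : Coeff d) (K : GoalOp Ω) (Cs Cd : ℝ) : Prop where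
  stability : ∀ 𝒯H 𝒯h, D.IsMesh 𝒯H → D.Refinement 𝒯H 𝒯h →
    ∀ vh ∈ D.space 𝒯h, ∀ wh ∈ D.space 𝒯h, ∀ vH ∈ D.space 𝒯H, ∀ wH ∈ D.space 𝒯H,
    ∀ 𝒰 ⊆ 𝒯h ∩ 𝒯H,
      |√(D.combSq 𝒯h 𝒰 vh wh) - √(D.combSq 𝒯H 𝒰 vH wH)|
        ≤ Cs * (energyNorm κ (vh - vH) + energyNorm κ (wh - wH))
  discrete_reliability : ∀ 𝒯H 𝒯h, D.IsMesh 𝒯H → D.Refinement 𝒯H 𝒯h →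
    energyNorm κ (D.solH κ 𝒯h - D.solH κ 𝒯H) + energyNorm κ (D.dualLinH κ K 𝒯h - D.dualLinH κ K 𝒯H)
      ≤ Cd * √(D.estOn κ K 𝒯H (𝒯H \ 𝒯h))

/-! #### The algorithm -/

/-- `(𝒯_ℓ)` and `(ℳ_ℓ)` are the meshes and the sets of marked elements of a run of the algorithm
that marks for the combined estimator, with parameters `θ` and `Cmark`. -/
structure IsRun (D : Data Ω) (κ : Coeff d) (K : GoalOp Ω) (θ Cmark : ℝ)
    (𝒯 : ℕ → Mesh d) (ℳ : ℕ → Finset (Element d)) : Prop where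
  init : 𝒯 0 = D.mesh₀
  subset : ∀ ℓ, ℳ ℓ ⊆ 𝒯 ℓ
  doerfler : ∀ ℓ, θ * D.est κ K (𝒯 ℓ) ≤ D.estOn κ K (𝒯 ℓ) (ℳ ℓ)
  minimal : ∀ ℓ, ∀ ℳ' ⊆ 𝒯 ℓ, θ * D.est κ K (𝒯 ℓ) ≤ D.estOn κ K (𝒯 ℓ) ℳ' →
    ((ℳ ℓ).card : ℝ) ≤ Cmark * (ℳ'.card : ℝ)
  step : ∀ ℓ, 𝒯 (ℓ + 1) = D.refineMesh (𝒯 ℓ) (ℳ ℓ)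

/-! #### Approximation classes -/

/-- `𝕋_N`: the meshes in `𝕋` with at most `N` elements more than `𝒯₀`. -/
def meshesUpTo (D : Data Ω) (N : ℕ) : Set (Mesh d) :=
  {𝒯 | D.IsMesh 𝒯 ∧ 𝒯.card ≤ D.mesh₀.card + N}

/-- `‖u‖_{𝔸_s} = sup_N (N+1)^s min_{𝒯_H ∈ 𝕋_N} η_H(u_H)`. -/
def approxPrimal (D : Data Ω) (κ : Coeff d) (s : ℝ) : ℝ≥0∞ :=
  ⨆ N : ℕ, ((N : ℝ≥0∞) + 1) ^ s *
    ⨅ 𝒯 ∈ D.meshesUpTo N, ENNReal.ofReal (D.etaOn 𝒯 𝒯 (D.solH κ 𝒯))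

/-- `‖z[u]‖_{𝔸_t} = sup_N (N+1)^t min_{𝒯_H ∈ 𝕋_N} ζ_H(z_H[u])`. -/
def approxDual (D : Data Ω) (κ : Coeff d) (K : GoalOp Ω) (t : ℝ) : ℝ≥0∞ :=
  ⨆ N : ℕ, ((N : ℝ≥0∞) + 1) ^ t *
    ⨅ 𝒯 ∈ D.meshesUpTo N,
      ENNReal.ofReal (D.zetaOn 𝒯 (D.sol κ) 𝒯 (D.dualH κ K 𝒯 (D.sol κ)))

/-- The estimate
`η_H(u_H)² + ζ_H(z_H[u_H])² ≤ C (‖u‖²_{𝔸_s} + ‖z[u]‖²_{𝔸_t}) (#𝒯_H - #𝒯₀)^{-β}` with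
`β = min{2s, 2t}`, where `0^{-β} = ∞`. -/
def RateBound (D : Data Ω) (κ : Coeff d) (K : GoalOp Ω) (s t C : ℝ) (𝒯 : Mesh d) : Prop :=
  ENNReal.ofReal (D.est κ K 𝒯)
    ≤ ENNReal.ofReal C * (D.approxPrimal κ s ^ 2 + D.approxDual κ K t ^ 2)
      * ((𝒯.card - D.mesh₀.card : ℕ) : ℝ≥0∞) ^ (-min (2 * s) (2 * t))

end Data

/-- `θ_opt = (1 + C_stab² C_drel²)⁻¹`. -/
def thetaOpt (Cstab Cdrel : ℝ) : ℝ := (1 + Cstab ^ 2 * Cdrel ^ 2)⁻¹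

end GOAFEM

end

/-!
The pair `(u, z[u])` solves a single elliptic problem on `H¹₀(Ω) × H¹₀(Ω)`, the primal equation
being weighted so heavily that it absorbs the coupling, and `(u_H, z_H[u_H])` is its Galerkin
approximation in `X_H × X_H`. For every elliptic form, symmetric or not, vectors `y`, `z` with
`B(y, z) = 0` satisfy a Cauchy–Schwarz inequality with a factor `c < 1`. Hence the squares of `2^m`
successive Galerkin increments sum to at most a constant times `(1 + c)^m` times the squared error,
which is less than proportional to the number of summands. With estimator reduction, reliability
and quasi-monotonicity this forces the combined estimator to be halved over blocks of fixed
length, starting from the initial mesh.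

For the rates, stability and discrete reliability show that a refinement which reduces the
combined estimator by a small factor refines a set satisfying the marking criterion. The
approximation classes and the overlay estimate provide such a refinement with few elements, which
bounds the number of marked elements; linear convergence and the closure estimate sum these bounds.

For the sharper threshold of (ii′) it must be shown that the change of the linearization point
costs nothing. The Galerkin errors `u - u_ℓ`, divided by their norms, converge weakly to zero and
a compact `K` maps them to a null sequence, so this perturbation of the dual problem is eventually
an arbitrarily small multiple of the estimator.
-/

noncomputable section

namespace GOAFEM

/-! ### Galerkin approximations for elliptic forms -/

section Galerkin

variable {V : Type*} [NormedAddCommGroup V] [InnerProductSpace ℝ V]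
variable {B : V →L[ℝ] V →L[ℝ] ℝ} {α M : ℝ}

theorem exists_abs_apply_le (B : V →L[ℝ] V →L[ℝ] ℝ) :
    ∃ M, 0 < M ∧ ∀ u v, |B u v| ≤ M * ‖u‖ * ‖v‖ := by
  refine ⟨‖B‖ + 1, by positivity, fun u v => (B.le_opNorm₂ u v).trans ?_⟩
  gcongr
  exact le_add_of_nonneg_right zero_le_one

/-- Coercive bounded bilinear forms, the hypothesis of the Lax–Milgram lemma with explicit
constants. The bound `M` is not taken to be `‖B‖`, which vanishes on the trivial space. -/
structure IsElliptic (B : V →L[ℝ] V →L[ℝ] ℝ) (α M : ℝ) : Prop where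
  coercivity_pos : 0 < α
  bound_pos : 0 < M
  coercive : ∀ v, α * ‖v‖ ^ 2 ≤ B v v
  bound : ∀ u v, |B u v| ≤ M * ‖u‖ * ‖v‖

/-- `y` is the Galerkin approximation of `x` in the subspace `X` with respect to the form `B`. -/
structure IsGalerkin (B : V →L[ℝ] V →L[ℝ] ℝ) (X : Submodule ℝ V) (x y : V) : Prop where
  mem : y ∈ X
  orthogonal : ∀ v ∈ X, B (x - y) v = 0

theorem IsGalerkin.of_le {X Y : Submodule ℝ V} {x y z : V} (hy : IsGalerkin B X x y)
    (hz : IsGalerkin B Y x z) (hXY : X ≤ Y) : IsGalerkin B X z y where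
  mem := hy.mem
  orthogonal v hv := by
    rw [← sub_sub_sub_cancel_left y z x, map_sub, sub_apply, hy.orthogonal v hv,
      hz.orthogonal v (hXY hv), sub_zero]

namespace IsElliptic

theorem exists_of_coercive (hα : 0 < α) (hco : ∀ v, α * ‖v‖ ^ 2 ≤ B v v) :
    ∃ M, IsElliptic B α M := by
  obtain ⟨M, hM, hBM⟩ := exists_abs_apply_le B
  exact ⟨M, hα, hM, hco, hBM⟩

theorem flip (hB : IsElliptic B α M) : IsElliptic B.flip α M :=
  ⟨hB.coercivity_pos, hB.bound_pos, hB.coercive, fun u v => (hB.bound v u).trans_eq (by ring)⟩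

theorem norm_le (hB : IsElliptic B α M) {v : V} {C : ℝ} (hC : 0 ≤ C) (h : B v v ≤ C * ‖v‖) :
    ‖v‖ ≤ C / α := by
  have hα := hB.coercivity_pos
  rcases (norm_nonneg v).eq_or_lt with h0 | h0
  · rw [← h0]
    positivity
  · rw [le_div_iff₀ hα]
    exact le_of_mul_le_mul_right (by linarith [hB.coercive v]) h0

theorem exists_mem_forall_eq [CompleteSpace V] (hB : IsElliptic B α M) {X : Submodule ℝ V}
    (hX : IsClosed (X : Set V)) (φ : StrongDual ℝ V) : ∃ u ∈ X, ∀ v ∈ X, B u v = φ v := by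
  have : CompleteSpace X := hX.completeSpace_coe
  have hBX : IsCoercive (B.bilinearComp X.subtypeL X.subtypeL) :=
    ⟨α, hB.coercivity_pos, fun v => by simpa [mul_assoc, sq] using hB.coercive v⟩
  let f := (InnerProductSpace.toDual ℝ X).symm (φ.comp X.subtypeL)
  refine ⟨hBX.continuousLinearEquivOfBilin.symm f, Submodule.coe_mem _, fun v hv => ?_⟩
  have h := hBX.continuousLinearEquivOfBilin_apply (hBX.continuousLinearEquivOfBilin.symm f) ⟨v, hv⟩
  rw [ContinuousLinearEquiv.apply_symm_apply, InnerProductSpace.toDual_symm_apply] at h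
  exact h.symm

theorem norm_sub_le_of_isGalerkin (hB : IsElliptic B α M) {X : Submodule ℝ V} {x y z : V}
    (hy : IsGalerkin B X x y) (hz : z ∈ X) : ‖y - z‖ ≤ M / α * ‖x - z‖ := by
  have hM := hB.bound_pos
  have h : B (y - z) (y - z) = B (x - z) (y - z) := by
    rw [← sub_add_sub_cancel x y z, map_add, add_apply, hy.orthogonal _ (X.sub_mem hy.mem hz),
      zero_add]
  have := hB.norm_le (by positivity) (h.trans_le ((le_abs_self _).trans (hB.bound _ _)))
  rwa [mul_div_right_comm] at this

end IsElliptic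

/-! ### Quasi-orthogonality of Galerkin increments -/

/-- The cosine of the angle in the strengthened Cauchy–Schwarz inequality for vectors `y`, `z` with
`B y z = 0`. -/
def angleConst (α M : ℝ) : ℝ := √(1 - (α / M) ^ 2)

theorem angleConst_nonneg : 0 ≤ angleConst α M := Real.sqrt_nonneg _

namespace IsElliptic

theorem angleConst_lt_one (hB : IsElliptic B α M) : angleConst α M < 1 := by
  rw [angleConst, Real.sqrt_lt' one_pos]
  have : 0 < (α / M) ^ 2 := by
    have := hB.coercivity_pos
    have := hB.bound_pos
    positivity
  linarith

theorem mul_norm_le_norm_add_smul (hB : IsElliptic B α M) {y z : V} (hyz : B y z = 0) (s : ℝ) :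
    α / M * ‖y‖ ≤ ‖y + s • z‖ := by
  have h : α * ‖y‖ ^ 2 ≤ M * ‖y‖ * ‖y + s • z‖ := by
    refine (hB.coercive y).trans (le_trans (le_of_eq ?_)
      ((le_abs_self _).trans (hB.bound y (y + s • z))))
    simp [hyz]
  rcases (norm_nonneg y).eq_or_lt with h0 | h0
  · simp [← h0]
  · rw [div_mul_eq_mul_div, div_le_iff₀ hB.bound_pos]
    exact le_of_mul_le_mul_right (by linarith) h0

/-- The vector `y + s • z` is tested with the `s` that minimizes its norm. -/
theorem abs_inner_le_angleConst_mul (hB : IsElliptic B α M) {y z : V} (hyz : B y z = 0) :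
    |inner ℝ y z| ≤ angleConst α M * (‖y‖ * ‖z‖) := by
  rcases eq_or_ne z 0 with rfl | hz
  · simp
  have hα := hB.coercivity_pos
  have hM := hB.bound_pos
  have : 0 < ‖z‖ := norm_pos_iff.mpr hz
  set s : ℝ := -(inner ℝ y z / ‖z‖ ^ 2) with hs
  have hmin : ‖y + s • z‖ ^ 2 = ‖y‖ ^ 2 - inner ℝ y z ^ 2 / ‖z‖ ^ 2 := by
    rw [norm_add_sq_real, inner_smul_right, norm_smul, mul_pow, Real.norm_eq_abs, sq_abs, hs]
    field
  have hlow : (α / M * ‖y‖) ^ 2 ≤ ‖y‖ ^ 2 - inner ℝ y z ^ 2 / ‖z‖ ^ 2 :=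
    hmin ▸ pow_le_pow_left₀ (by positivity) (hB.mul_norm_le_norm_add_smul hyz s) 2
  have hsq : inner ℝ y z ^ 2 ≤ (1 - (α / M) ^ 2) * (‖y‖ * ‖z‖) ^ 2 := by
    have h : inner ℝ y z ^ 2 / ‖z‖ ^ 2 ≤ (1 - (α / M) ^ 2) * ‖y‖ ^ 2 := by linarith
    rw [div_le_iff₀ (by positivity)] at h
    linarith
  calc |inner ℝ y z| ≤ √((1 - (α / M) ^ 2) * (‖y‖ * ‖z‖) ^ 2) := Real.abs_le_sqrt hsq
    _ = angleConst α M * (‖y‖ * ‖z‖) := by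
      rw [Real.sqrt_mul' _ (sq_nonneg _), Real.sqrt_sq (by positivity), angleConst]

end IsElliptic

theorem norm_add_sq_le_of_abs_inner_le {c : ℝ} (hc : 0 ≤ c) {y z : V}
    (h : |inner ℝ y z| ≤ c * (‖y‖ * ‖z‖)) :
    ‖y + z‖ ^ 2 ≤ (1 + c) * (‖y‖ ^ 2 + ‖z‖ ^ 2) := by
  rw [norm_add_sq_real]
  nlinarith [le_abs_self (inner ℝ y z), mul_nonneg hc (sq_nonneg (‖y‖ - ‖z‖))]

/-- Halving the block `m` times costs a factor `1 + c` each time, which gives the power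
`(2 ^ m) ^ log₂ (1 + c)` of the block length. -/
theorem norm_sum_Ico_sq_le {c : ℝ} (hc : 0 ≤ c) (w : ℕ → V)
    (h : ∀ i j k, |inner ℝ (∑ n ∈ Finset.Ico i j, w n) (∑ n ∈ Finset.Ico j k, w n)|
      ≤ c * (‖∑ n ∈ Finset.Ico i j, w n‖ * ‖∑ n ∈ Finset.Ico j k, w n‖)) (m ℓ : ℕ) :
    ‖∑ i ∈ Finset.Ico ℓ (ℓ + 2 ^ m), w i‖ ^ 2
      ≤ (1 + c) ^ m * ∑ i ∈ Finset.Ico ℓ (ℓ + 2 ^ m), ‖w i‖ ^ 2 := by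
  induction m generalizing ℓ with
  | zero => simp
  | succ m ih =>
    have hsplit : ℓ + 2 ^ (m + 1) = ℓ + 2 ^ m + 2 ^ m := by ring
    have hleft : ℓ ≤ ℓ + 2 ^ m := Nat.le_add_right _ _
    have hright : ℓ + 2 ^ m ≤ ℓ + 2 ^ m + 2 ^ m := Nat.le_add_right _ _
    rw [hsplit, ← Finset.sum_Ico_consecutive w hleft hright,
      ← Finset.sum_Ico_consecutive (fun i => ‖w i‖ ^ 2) hleft hright]
    refine (norm_add_sq_le_of_abs_inner_le hc (h _ _ _)).trans ?_
    rw [pow_succ' (1 + c), mul_assoc, mul_add ((1 + c) ^ m)]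
    gcongr
    exacts [ih _, ih _]

theorem le_sq_mul_of_le_mul {S b W k : ℝ} (hS : 0 ≤ S) (hk : 0 ≤ k) (h : S ≤ b * W)
    (hW : W ^ 2 ≤ k * S) : S ≤ b ^ 2 * k := by
  rcases hS.eq_or_lt with h0 | h0
  · rw [← h0]
    positivity
  · refine le_of_mul_le_mul_right ?_ h0
    calc S * S ≤ (b * W) ^ 2 := by nlinarith
      _ = b ^ 2 * W ^ 2 := mul_pow b W 2
      _ ≤ b ^ 2 * k * S := by nlinarith [sq_nonneg b]

namespace IsElliptic

theorem exists_dual_increment [CompleteSpace V] (hB : IsElliptic B α M) {X Y : Submodule ℝ V}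
    (hXY : X ≤ Y) (hX : IsClosed (X : Set V)) (hY : IsClosed (Y : Set V)) {δ : V} (hδ : δ ∈ Y)
    (hδX : ∀ v ∈ X, B δ v = 0) :
    ∃ w ∈ Y, (∀ v ∈ X, B v w = 0) ∧ B δ w = ‖δ‖ ^ 2 ∧ ‖w‖ ≤ (1 + M / α) / α * ‖δ‖ := by
  have hα := hB.coercivity_pos
  have hM := hB.bound_pos
  obtain ⟨w, hw, hwY⟩ := hB.flip.exists_mem_forall_eq hY (innerSL ℝ δ)
  obtain ⟨w', hw', hwX⟩ := hB.flip.exists_mem_forall_eq hX (B.flip w)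
  simp only [ContinuousLinearMap.flip_apply, innerSL_apply_apply] at hwY hwX
  have hwn : ‖w‖ ≤ ‖δ‖ / α :=
    hB.norm_le (norm_nonneg δ) ((hwY w hw).trans_le (real_inner_le_norm δ w))
  have hwn' : ‖w'‖ ≤ M * ‖w‖ / α := by
    refine hB.norm_le (by positivity) ((hwX w' hw').trans_le ((le_abs_self _).trans ?_))
    exact (hB.bound w' w).trans_eq (by ring)
  refine ⟨w - w', Y.sub_mem hw (hXY hw'), fun v hv => by rw [map_sub, hwX v hv, sub_self], ?_, ?_⟩
  · rw [map_sub, hδX w' hw', sub_zero, hwY δ hδ, real_inner_self_eq_norm_sq]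
  · calc ‖w - w'‖ ≤ ‖w‖ + M * ‖w‖ / α := (norm_sub_le _ _).trans (by gcongr)
      _ = (1 + M / α) * ‖w‖ := by ring
      _ ≤ (1 + M / α) * (‖δ‖ / α) := by gcongr
      _ = (1 + M / α) / α * ‖δ‖ := by ring

theorem norm_sum_Ico_sq_le_of_biorthogonal (hB : IsElliptic B α M) {Y : ℕ → Submodule ℝ V}
    (hmono : Monotone Y) {w : ℕ → V} (hw : ∀ k, w k ∈ Y (k + 1))
    (hwY : ∀ k, ∀ v ∈ Y k, B v (w k) = 0) (ℓ m : ℕ) :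
    ‖∑ i ∈ Finset.Ico ℓ (ℓ + 2 ^ m), w i‖ ^ 2
      ≤ (1 + angleConst α M) ^ m * ∑ i ∈ Finset.Ico ℓ (ℓ + 2 ^ m), ‖w i‖ ^ 2 := by
  refine norm_sum_Ico_sq_le angleConst_nonneg w
    (fun i j k => hB.abs_inner_le_angleConst_mul ?_) m ℓ
  have hmem : ∑ n ∈ Finset.Ico i j, w n ∈ Y j :=
    Submodule.sum_mem _ fun n hn => hmono (Finset.mem_Ico.mp hn).2 (hw n)
  rw [map_sum]
  exact Finset.sum_eq_zero fun n hn => hwY n _ (hmono (Finset.mem_Ico.mp hn).1 hmem)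

/-- The dual increments turn the sum of squares into one evaluation `B (x - xs ℓ) (∑ w k)`, and the
angle condition bounds the norm of `∑ w k` by less than the triangle inequality would. -/
theorem sum_sq_increment_le [CompleteSpace V] (hB : IsElliptic B α M) {Y : ℕ → Submodule ℝ V}
    (hmono : Monotone Y) (hcl : ∀ k, IsClosed (Y k : Set V)) {x : V} {xs : ℕ → V}
    (hxs : ∀ k, IsGalerkin B (Y k) x (xs k)) (ℓ m : ℕ) :
    ∑ k ∈ Finset.Ico ℓ (ℓ + 2 ^ m), ‖xs (k + 1) - xs k‖ ^ 2
      ≤ (M * ‖x - xs ℓ‖) ^ 2 * ((1 + angleConst α M) ^ m * ((1 + M / α) / α) ^ 2) := by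
  have hstep : ∀ k, Y k ≤ Y (k + 1) := fun k => hmono k.le_succ
  choose w hwY hwo hwd hwn using fun k => hB.exists_dual_increment (hstep k) (hcl k) (hcl (k + 1))
    ((Y (k + 1)).sub_mem (hxs (k + 1)).mem (hstep k (hxs k).mem))
    ((hxs k).of_le (hxs (k + 1)) (hstep k)).orthogonal
  have hc : 0 ≤ angleConst α M := angleConst_nonneg
  set I := Finset.Ico ℓ (ℓ + 2 ^ m)
  refine le_sq_mul_of_le_mul (W := ‖∑ k ∈ I, w k‖)
    (Finset.sum_nonneg fun _ _ => sq_nonneg _) (by positivity) ?_ ?_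
  · have htest : ∀ k ∈ I, ‖xs (k + 1) - xs k‖ ^ 2 = B (x - xs ℓ) (w k) := by
      intro k hk
      have hmem : xs k - xs ℓ ∈ Y k :=
        (Y k).sub_mem (hxs k).mem (hmono (Finset.mem_Ico.mp hk).1 (hxs ℓ).mem)
      rw [← sub_add_sub_cancel x (xs k) (xs ℓ), ← sub_add_sub_cancel x (xs (k + 1)) (xs k), map_add,
        map_add, add_apply, add_apply, (hxs (k + 1)).orthogonal _ (hwY k), hwd, hwo k _ hmem,
        zero_add, add_zero]
    rw [Finset.sum_congr rfl htest, ← map_sum]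
    exact (le_abs_self _).trans (hB.bound _ _)
  · refine (hB.norm_sum_Ico_sq_le_of_biorthogonal hmono hwY hwo ℓ m).trans ?_
    rw [mul_assoc, Finset.mul_sum _ _ (((1 + M / α) / α) ^ 2)]
    gcongr with k
    rw [← mul_pow]
    gcongr
    exact hwn k

end IsElliptic

end Galerkin

/-! ### Linear convergence of sequences -/

section LinearConvergence

variable {e r : ℕ → ℝ} {q Cr Co c Cm : ℝ}

theorem add_sq_le_of_lt_one (hq0 : 0 ≤ q) (hq : q < 1) (x y : ℝ) :
    (q * x + y) ^ 2 ≤ q * x ^ 2 + y ^ 2 / (1 - q) := by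
  have : 0 < 1 - q := by linarith
  have h : q * x ^ 2 + y ^ 2 / (1 - q) - (q * x + y) ^ 2 = q / (1 - q) * ((1 - q) * x - y) ^ 2 := by
    field
  have : 0 ≤ q / (1 - q) * ((1 - q) * x - y) ^ 2 := by positivity
  linarith

theorem sum_Ico_succ_le_of_le_mul_add (hq0 : 0 ≤ q) (hq : q < 1) (he : ∀ k, 0 ≤ e k)
    (hred : ∀ k, e (k + 1) ≤ q * e k + r k) {ℓ n : ℕ} (hn : ℓ ≤ n) :
    ∑ k ∈ Finset.Ico ℓ n, e (k + 1) ≤ (e ℓ + ∑ k ∈ Finset.Ico ℓ n, r k) / (1 - q) := by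
  have hshift : ∑ k ∈ Finset.Ico ℓ n, e k ≤ ∑ k ∈ Finset.Ico ℓ n, e (k + 1) + e ℓ := by
    have h := Finset.sum_Ico_sub e hn
    rw [Finset.sum_sub_distrib] at h
    linarith [he n]
  have hsum : ∑ k ∈ Finset.Ico ℓ n, e (k + 1)
      ≤ q * ∑ k ∈ Finset.Ico ℓ n, e k + ∑ k ∈ Finset.Ico ℓ n, r k := by
    rw [Finset.mul_sum, ← Finset.sum_add_distrib]
    exact Finset.sum_le_sum fun k _ => hred k
  rw [le_div_iff₀ (by linarith)]
  nlinarith [he ℓ]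

theorem le_geometric_of_halving (hCm : 0 ≤ Cm) {N : ℕ} (hN : 0 < N) (he : ∀ k, 0 ≤ e k)
    (hmono : ∀ ℓ n, ℓ ≤ n → e n ≤ Cm * e ℓ) (hhalf : ∀ ℓ, e (ℓ + N) ≤ 1 / 2 * e ℓ) {ℓ n : ℕ}
    (hn : ℓ ≤ n) : e n ≤ 2 * Cm * ((1 / 2 : ℝ) ^ ((N : ℝ)⁻¹)) ^ (n - ℓ) * e ℓ := by
  set ρ : ℝ := (1 / 2 : ℝ) ^ ((N : ℝ)⁻¹)
  have hρ0 : 0 < ρ := by positivity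
  have hρ1 : ρ ≤ 1 := Real.rpow_le_one (by norm_num) (by norm_num) (by positivity)
  have hρN : ρ ^ N = 1 / 2 := Real.rpow_inv_natCast_pow (by norm_num) hN.ne'
  have hiter : ∀ k, e (ℓ + N * k) ≤ (1 / 2) ^ k * e ℓ := by
    intro k
    induction k with
    | zero => simp
    | succ k ih =>
      rw [Nat.mul_succ, ← add_assoc, pow_succ]
      linarith [hhalf (ℓ + N * k)]
  set k := (n - ℓ) / N
  have hdiv : N * k + (n - ℓ) % N = n - ℓ := Nat.div_add_mod _ _
  have hrem : 1 / 2 ≤ ρ ^ ((n - ℓ) % N) :=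
    hρN ▸ pow_le_pow_of_le_one hρ0.le hρ1 (Nat.mod_lt _ hN).le
  have hpow : (1 / 2 : ℝ) ^ k ≤ 2 * ρ ^ (n - ℓ) := by
    rw [← hdiv, pow_add, pow_mul, hρN]
    nlinarith [show (0 : ℝ) < (1 / 2) ^ k by positivity]
  have hℓ := he ℓ
  calc e n ≤ Cm * e (ℓ + N * k) := hmono _ _ (by omega)
    _ ≤ Cm * ((1 / 2) ^ k * e ℓ) := by gcongr; exact hiter k
    _ ≤ Cm * (2 * ρ ^ (n - ℓ) * e ℓ) := by gcongr
    _ = 2 * Cm * ρ ^ (n - ℓ) * e ℓ := by ring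

theorem le_of_quasi_orthogonal (hq0 : 0 ≤ q) (hq : q < 1) (hCr : 0 ≤ Cr) (hc0 : 0 ≤ c)
    (hCm : 0 ≤ Cm) (he : ∀ k, 0 ≤ e k) (hred : ∀ k, e (k + 1) ≤ q * e k + Cr * r k)
    (hmono : ∀ ℓ n, ℓ ≤ n → e n ≤ Cm * e ℓ)
    (horth : ∀ ℓ m, ∑ k ∈ Finset.Ico ℓ (ℓ + 2 ^ m), r k ≤ Co * (1 + c) ^ m * e ℓ) (ℓ m : ℕ) :
    e (ℓ + 2 ^ m) ≤ Cm * ((1 + Cr * Co) / (1 - q)) * ((1 + c) / 2) ^ m * e ℓ := by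
  set I := Finset.Ico ℓ (ℓ + 2 ^ m) with hI
  have hsum : ∑ k ∈ I, e (k + 1) ≤ (1 + Cr * Co) * (1 + c) ^ m * e ℓ / (1 - q) := by
    refine (sum_Ico_succ_le_of_le_mul_add hq0 hq he hred (Nat.le_add_right _ _)).trans ?_
    have h1 : e ℓ ≤ (1 + c) ^ m * e ℓ := le_mul_of_one_le_left (he ℓ) (one_le_pow₀ (by linarith))
    have h2 := mul_le_mul_of_nonneg_left (horth ℓ m) hCr
    rw [← Finset.mul_sum]
    gcongr
    linarith
  have hlow : (2 : ℝ) ^ m * e (ℓ + 2 ^ m) ≤ Cm * ∑ k ∈ I, e (k + 1) := by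
    have h := Finset.card_nsmul_le_sum I (fun k => Cm * e (k + 1)) (e (ℓ + 2 ^ m))
      fun k hk => hmono _ _ (Finset.mem_Ico.mp hk).2
    simpa [hI, Finset.mul_sum] using h
  refine le_of_mul_le_mul_left (hlow.trans ((mul_le_mul_of_nonneg_left hsum hCm).trans_eq ?_))
    (by positivity : (0 : ℝ) < 2 ^ m)
  rw [div_pow]
  field

/-- As `1 + c < 2`, the quasi-orthogonality constant `(1 + c) ^ m` grows slower than the number
`2 ^ m` of summands, so the average, and by quasi-monotonicity the last term, becomes small. -/
theorem exists_linear_convergence (hq0 : 0 ≤ q) (hq : q < 1) (hCr : 0 ≤ Cr) (hCo : 0 ≤ Co)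
    (hc0 : 0 ≤ c) (hc : c < 1) (hCm : 0 < Cm) :
    ∃ C ρ : ℝ, 0 < C ∧ 0 < ρ ∧ ρ < 1 ∧ ∀ e r : ℕ → ℝ, (∀ k, 0 ≤ e k) →
      (∀ k, e (k + 1) ≤ q * e k + Cr * r k) → (∀ ℓ n, ℓ ≤ n → e n ≤ Cm * e ℓ) →
      (∀ ℓ m, ∑ k ∈ Finset.Ico ℓ (ℓ + 2 ^ m), r k ≤ Co * (1 + c) ^ m * e ℓ) →
      ∀ ℓ n, ℓ ≤ n → e n ≤ C * ρ ^ (n - ℓ) * e ℓ := by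
  set G : ℝ := Cm * ((1 + Cr * Co) / (1 - q))
  have hG : 0 < G := by
    have : 0 < 1 - q := by linarith
    positivity
  obtain ⟨m, hm⟩ := exists_pow_lt_of_lt_one (x := 1 / 2 / G) (y := (1 + c) / 2) (by positivity)
    (by linarith)
  have hhalf : G * ((1 + c) / 2) ^ m ≤ 1 / 2 := by
    rw [lt_div_iff₀ hG] at hm
    linarith
  refine ⟨2 * Cm, (1 / 2 : ℝ) ^ (((2 ^ m : ℕ) : ℝ)⁻¹), by positivity, by positivity,
    Real.rpow_lt_one (by norm_num) (by norm_num) (by positivity), ?_⟩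
  intro e r he hred hmono horth ℓ n hn
  exact le_geometric_of_halving hCm.le (by positivity) he hmono (fun ℓ =>
    (le_of_quasi_orthogonal hq0 hq hCr hc0 hCm.le he hred hmono horth ℓ m).trans
      (mul_le_mul_of_nonneg_right hhalf (he ℓ))) hn

end LinearConvergence

/-! ### Compact perturbations of Galerkin errors -/

section Compactness

open Filter Topology

variable {H : Type*} [NormedAddCommGroup H] [InnerProductSpace ℝ H]

theorem IsElliptic.tendsto_apply_of_orthogonal [CompleteSpace H] {a : H →L[ℝ] H →L[ℝ] ℝ} {α M : ℝ}
    (ha : IsElliptic a α M) {X : ℕ → Submodule ℝ H} (hX : Monotone X) {w : ℕ → H}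
    (hw1 : ∀ ℓ, ‖w ℓ‖ ≤ 1) (hw : ∀ ℓ, w ℓ ∈ (⨆ k, X k).topologicalClosure)
    (horth : ∀ ℓ, ∀ x ∈ X ℓ, a (w ℓ) x = 0) (φ : StrongDual ℝ H) :
    Tendsto (fun ℓ => φ (w ℓ)) atTop (𝓝 0) := by
  have hM := ha.bound_pos
  obtain ⟨y, hy, hφ⟩ := ha.flip.exists_mem_forall_eq
    (Submodule.isClosed_topologicalClosure (⨆ k, X k)) φ
  rw [Metric.tendsto_atTop]
  intro ε hε
  obtain ⟨x, hx, hxy⟩ := Metric.mem_closure_iff.mp hy (ε / M) (by positivity)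
  obtain ⟨k, hk⟩ := (Submodule.mem_iSup_of_directed X hX.directed_le).mp hx
  refine ⟨k, fun ℓ hℓ => ?_⟩
  have hφw : φ (w ℓ) = a (w ℓ) (y - x) := by
    rw [map_sub, horth ℓ x (hX hℓ hk), sub_zero, ← hφ _ (hw ℓ), ContinuousLinearMap.flip_apply]
  rw [dist_zero_right, hφw, Real.norm_eq_abs]
  calc |a (w ℓ) (y - x)| ≤ M * ‖w ℓ‖ * ‖y - x‖ := ha.bound _ _
    _ ≤ M * 1 * ‖y - x‖ := by gcongr; exact hw1 ℓ
    _ < ε := by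
      rw [dist_eq_norm, lt_div_iff₀ hM] at hxy
      linarith

theorem tendsto_apply_of_weakly_null {K : H →L[ℝ] StrongDual ℝ H} (hK : IsCompactOperator K)
    {w : ℕ → H} (hw1 : ∀ ℓ, ‖w ℓ‖ ≤ 1)
    (hw : ∀ φ : StrongDual ℝ H, Tendsto (fun ℓ => φ (w ℓ)) atTop (𝓝 0)) :
    Tendsto (fun ℓ => K (w ℓ)) atTop (𝓝 0) := by
  refine (hK.isCompact_closure_image_closedBall (1 : ℝ)).tendsto_nhds_of_unique_mapClusterPt
    (Eventually.of_forall fun ℓ => subset_closure ⟨w ℓ, by simpa using hw1 ℓ, rfl⟩)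
    fun ψ _ hψ => ?_
  ext v
  have hcluster : MapClusterPt (ψ v) atTop (fun ℓ => K (w ℓ) v) :=
    hψ.continuousAt_comp (f := fun ψ : StrongDual ℝ H => ψ v)
      (ContinuousLinearMap.apply ℝ ℝ v).continuous.continuousAt
  have hlim : Tendsto (fun ℓ => K (w ℓ) v) atTop (𝓝 0) := hw (K.flip v)
  have : (𝓝 (ψ v) ⊓ 𝓝 0).NeBot := NeBot.mono hcluster (inf_le_inf_left _ hlim)
  exact eq_of_nhds_neBot this

theorem tendsto_flip_apply_of_weakly_null {K : H →L[ℝ] StrongDual ℝ H} (hK : IsCompactOperator K)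
    {w : ℕ → H} (hw1 : ∀ ℓ, ‖w ℓ‖ ≤ 1)
    (hw : ∀ φ : StrongDual ℝ H, Tendsto (fun ℓ => φ (w ℓ)) atTop (𝓝 0)) :
    Tendsto (fun ℓ => K.flip (w ℓ)) atTop (𝓝 0) := by
  rw [Metric.tendsto_nhds]
  intro ε hε
  obtain ⟨t, ht, hcover⟩ := Metric.totallyBounded_iff.mp
    (hK.isCompact_closure_image_closedBall (1 : ℝ)).totallyBounded (ε / 4) (by positivity)
  have hsmall : ∀ᶠ ℓ in atTop, ∀ φ ∈ t, |φ (w ℓ)| < ε / 4 := by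
    rw [eventually_all_finite ht]
    intro φ _
    simpa using (hw φ).eventually (Metric.ball_mem_nhds 0 (by positivity : 0 < ε / 4))
  filter_upwards [hsmall] with ℓ hℓ
  rw [dist_zero_right]
  refine (ContinuousLinearMap.opNorm_le_of_unit_norm (half_pos hε).le fun v hv => ?_).trans_lt
    (half_lt_self hε)
  obtain ⟨φ, hφ, hφv⟩ := Set.mem_iUnion₂.mp
    (hcover (subset_closure ⟨v, by simpa using hv.le, rfl⟩ :
      K v ∈ closure (K '' Metric.closedBall 0 1)))
  rw [Metric.mem_ball, dist_eq_norm] at hφv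
  calc |K v (w ℓ)| = |(K v - φ) (w ℓ) + φ (w ℓ)| := by simp
    _ ≤ |(K v - φ) (w ℓ)| + |φ (w ℓ)| := abs_add_le _ _
    _ ≤ ε / 4 * 1 + ε / 4 := by
      gcongr
      · exact ((K v - φ).le_opNorm (w ℓ)).trans (by gcongr; exact hw1 ℓ)
      · exact (hℓ φ hφ).le
    _ = ε / 2 := by ring

/-- The normalized Galerkin errors are weakly null, so a compact operator maps them to a null
sequence. -/
theorem IsElliptic.eventually_add_flip_le [CompleteSpace H] {a : H →L[ℝ] H →L[ℝ] ℝ} {α M : ℝ}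
    (ha : IsElliptic a α M) {K : H →L[ℝ] StrongDual ℝ H} (hK : IsCompactOperator K)
    {X : ℕ → Submodule ℝ H} (hX : Monotone X) {u : H} {us : ℕ → H}
    (hus : ∀ ℓ, IsGalerkin a (X ℓ) u (us ℓ)) (hlim : Tendsto us atTop (𝓝 u)) {ε : ℝ}
    (hε : 0 < ε) :
    ∀ᶠ ℓ in atTop, ∀ v, |(K + K.flip) (u - us ℓ) v| ≤ ε * ‖u - us ℓ‖ * ‖v‖ := by
  set w : ℕ → H := fun ℓ => ‖u - us ℓ‖⁻¹ • (u - us ℓ) with hw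
  have hmem : ∀ ℓ, us ℓ ∈ (⨆ k, X k).topologicalClosure := fun ℓ =>
    Submodule.le_topologicalClosure _ (le_iSup X ℓ (hus ℓ).mem)
  have hu : u ∈ (⨆ k, X k).topologicalClosure :=
    (Submodule.isClosed_topologicalClosure _).mem_of_tendsto hlim (Eventually.of_forall hmem)
  have hw1 : ∀ ℓ, ‖w ℓ‖ ≤ 1 := fun ℓ => by
    rw [hw, norm_smul, norm_inv, norm_norm]
    exact inv_mul_le_one
  have hws : ∀ ℓ, u - us ℓ = ‖u - us ℓ‖ • w ℓ := fun ℓ => by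
    rcases eq_or_ne (u - us ℓ) 0 with h | h
    · simp [h]
    · rw [hw, smul_smul, mul_inv_cancel₀ (norm_ne_zero_iff.mpr h), one_smul]
  have hweak := ha.tendsto_apply_of_orthogonal hX hw1
    (fun ℓ => Submodule.smul_mem _ _ (Submodule.sub_mem _ hu (hmem ℓ)))
    (fun ℓ x hx => by rw [hw, map_smul, smul_apply, (hus ℓ).orthogonal x hx, smul_zero])
  have hnull : Tendsto (fun ℓ => (K + K.flip) (w ℓ)) atTop (𝓝 0) := by
    simpa using (tendsto_apply_of_weakly_null hK hw1 hweak).add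
      (tendsto_flip_apply_of_weakly_null hK hw1 hweak)
  filter_upwards [hnull.eventually (Metric.ball_mem_nhds 0 hε)] with ℓ hℓ v
  rw [dist_zero_right] at hℓ
  calc |(K + K.flip) (u - us ℓ) v| = ‖u - us ℓ‖ * |(K + K.flip) (w ℓ) v| := by
        conv_lhs => rw [hws ℓ]
        rw [map_smul, smul_apply, smul_eq_mul, abs_mul, abs_norm]
    _ ≤ ‖u - us ℓ‖ * (ε * ‖v‖) := by
      gcongr
      exact ((K + K.flip) (w ℓ)).le_of_opNorm_le hℓ.le v
    _ = _ := by ring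

end Compactness

/-! ### Bilinear integral forms on `L²` -/

section BilinearIntegral

variable {X : Type*} [MeasurableSpace X] {μ : Measure X}
variable {E F : Type*} [NormedAddCommGroup E] [NormedAddCommGroup F]

theorem integral_norm_mul_norm_le (f : Lp E 2 μ) (g : Lp F 2 μ) :
    ∫ x, ‖f x‖ * ‖g x‖ ∂μ ≤ ‖f‖ * ‖g‖ := by
  have hf := (Lp.memLp f).norm
  have hg := (Lp.memLp g).norm
  have h := real_inner_le_norm (hf.toLp _) (hg.toLp _)
  rw [L2.inner_def, Lp.norm_toLp, Lp.norm_toLp, eLpNorm_norm, eLpNorm_norm, ← Lp.norm_def,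
    ← Lp.norm_def] at h
  refine (integral_congr_ae ?_).trans_le h
  filter_upwards [hf.coeFn_toLp, hg.coeFn_toLp] with x hfx hgx
  simp [hfx, hgx, mul_comm]

variable {W : Type*} [NormedAddCommGroup W] [NormedSpace ℝ W] [NormedSpace ℝ E] [NormedSpace ℝ F]
variable (Φ : W →L[ℝ] E →L[ℝ] F →L[ℝ] ℝ) {a : X → W}

/-- The form `(f, g) ↦ ∫ Φ(a(x))(f(x), g(x))` on `L² × L²` for an essentially bounded
coefficient `a`. -/
def bilinIntegral (ha : MemLp a ∞ μ) : Lp E 2 μ →L[ℝ] Lp F 2 μ →L[ℝ] ℝ :=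
  (ContinuousLinearMap.id ℝ (F →L[ℝ] ℝ)).lpPairing μ 2 2 ∘L Φ.holderL μ ∞ 2 2 (ha.toLp a)

theorem bilinIntegral_apply (ha : MemLp a ∞ μ) (f : Lp E 2 μ) (g : Lp F 2 μ) :
    bilinIntegral Φ ha f g = ∫ x, Φ (a x) (f x) (g x) ∂μ := by
  rw [bilinIntegral, ContinuousLinearMap.comp_apply, ContinuousLinearMap.lpPairing_eq_integral]
  refine integral_congr_ae ?_
  filter_upwards [Φ.coeFn_holder (r := 2) (ha.toLp a) f, ha.coeFn_toLp] with x hx hax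
  simp [hx, hax]

theorem integrable_bilin (ha : MemLp a ∞ μ) (f : Lp E 2 μ) (g : Lp F 2 μ) :
    Integrable (fun x => Φ (a x) (f x) (g x)) μ :=
  memLp_one_iff_integrable.mp <| (ContinuousLinearMap.id ℝ (F →L[ℝ] ℝ)).memLp_of_bilin 1
    (Φ.memLp_of_bilin 2 ha (Lp.memLp f)) (Lp.memLp g)

end BilinearIntegral

/-! ### The forms of the elliptic problem on `H¹₀(Ω)` -/

section Forms

variable {d : ℕ} {Ω : Set (Pt d)} {κ : Coeff d}

instance : CompleteSpace (H10 Ω) :=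
  (Submodule.isClosed_topologicalClosure (testPairs Ω)).completeSpace_coe

/-- The embedding `H¹₀(Ω) → L²(Ω)`. -/
def fnL (Ω : Set (Pt d)) : H10 Ω →L[ℝ] Lp ℝ 2 (volume.restrict Ω) :=
  (WithLp.fstL 2 ℝ _ _).comp (H10 Ω).subtypeL

/-- The weak gradient `H¹₀(Ω) → L²(Ω; ℝᵈ)`. -/
def gradL (Ω : Set (Pt d)) : H10 Ω →L[ℝ] Lp (Pt d) 2 (volume.restrict Ω) :=
  (WithLp.sndL 2 ℝ _ _).comp (H10 Ω).subtypeL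

theorem fnL_apply (v : H10 Ω) : fnL Ω v = fn v := rfl

theorem gradL_apply (v : H10 Ω) : gradL Ω v = grad v := rfl

theorem norm_sq_H10 (v : H10 Ω) : ‖v‖ ^ 2 = ‖fn v‖ ^ 2 + ‖grad v‖ ^ 2 :=
  WithLp.prod_norm_sq_eq_of_L2 v.1

theorem norm_grad_le (v : H10 Ω) : ‖grad v‖ ≤ ‖v‖ :=
  le_of_sq_le_sq (by rw [norm_sq_H10]; exact le_add_of_nonneg_left (sq_nonneg _)) (norm_nonneg v)

set_option maxSynthPendingDepth 3 in
/-- The map `A ↦ ((y, z) ↦ Ay · z)` that sends a matrix to its bilinear form. -/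
def matrixForm (d : ℕ) : (Fin d → Fin d → ℝ) →L[ℝ] Pt d →L[ℝ] Pt d →L[ℝ] ℝ :=
  ∑ i, ∑ j, ((ContinuousLinearMap.proj (R := ℝ) (φ := fun _ => ℝ) j).comp
    (ContinuousLinearMap.proj (φ := fun _ => Fin d → ℝ) i)).smulRight
      ((EuclideanSpace.proj j).smulRight (EuclideanSpace.proj i : Pt d →L[ℝ] ℝ))

theorem matrixForm_apply (A : Fin d → Fin d → ℝ) (y z : Pt d) :
    matrixForm d A y z = (Matrix.of A *ᵥ y.ofLp) ⬝ᵥ z.ofLp := by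
  simp [matrixForm, dotProduct, Matrix.mulVec, Finset.sum_mul, mul_assoc]

theorem Coeff.Admissible.memLp_A (hκ : κ.Admissible Ω) :
    MemLp (fun x i j => κ.A x i j) ∞ (volume.restrict Ω) :=
  .of_eval fun i => .of_eval fun j => hκ.bounded_A i j

theorem principal_eq_bilinIntegral (hκ : κ.Admissible Ω) (u v : H10 Ω) :
    principal κ Ω u v = bilinIntegral (matrixForm d) hκ.memLp_A (grad u) (grad v) := by
  rw [bilinIntegral_apply]
  exact integral_congr_ae (.of_forall fun x => (matrixForm_apply _ _ _).symm)

theorem exists_formL (hκ : κ.Admissible Ω) :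
    ∃ a : H10 Ω →L[ℝ] H10 Ω →L[ℝ] ℝ, ∀ u v, a u v = form κ Ω u v := by
  let mul := ContinuousLinearMap.mul ℝ ℝ
  let convection : Pt d →L[ℝ] Pt d →L[ℝ] ℝ →L[ℝ] ℝ :=
    (ContinuousLinearMap.compL ℝ (Pt d) ℝ (ℝ →L[ℝ] ℝ) mul).comp (innerSL ℝ)
  let reaction : ℝ →L[ℝ] ℝ →L[ℝ] ℝ →L[ℝ] ℝ :=
    (ContinuousLinearMap.compL ℝ ℝ ℝ (ℝ →L[ℝ] ℝ) mul).comp mul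
  refine ⟨(bilinIntegral (matrixForm d) hκ.memLp_A).bilinearComp (gradL Ω) (gradL Ω)
    + (bilinIntegral convection hκ.bounded_b).bilinearComp (gradL Ω) (fnL Ω)
    + (bilinIntegral reaction hκ.bounded_c).bilinearComp (fnL Ω) (fnL Ω), fun u v => ?_⟩
  simp only [add_apply, ContinuousLinearMap.bilinearComp_apply, gradL_apply, fnL_apply, form,
    principal_eq_bilinIntegral hκ]
  simp only [bilinIntegral_apply convection, bilinIntegral_apply reaction]
  rfl

theorem Data.exists_rhsL (D : Data Ω) : ∃ F : StrongDual ℝ (H10 Ω), ∀ v, F v = D.rhs v := by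
  refine ⟨(innerSL ℝ D.f).comp (fnL Ω) - (innerSL ℝ D.fvec).comp (gradL Ω), fun v => ?_⟩
  simp [L2.inner_def, gradL_apply, fnL_apply, Data.rhs, mul_comm]

end Forms

/-! ### Friedrichs inequality and the energy norm -/

section Friedrichs

section

variable {E : Type*} [NormedAddCommGroup E] [InnerProductSpace ℝ E] [FiniteDimensional ℝ E]
variable [MeasurableSpace E] [BorelSpace E] (μ : Measure E) [μ.IsAddHaarMeasure] {φ : E → ℝ}

-- Integrate `φ² = φ² ∂ₑ⟨e, x⟩` by parts.
theorem integral_sq_eq_neg_integral_fderiv_mul_inner (hφ : ContDiff ℝ 1 φ)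
    (hc : HasCompactSupport φ) {e : E} (he : ‖e‖ = 1) :
    ∫ x, φ x ^ 2 ∂μ = -∫ x, 2 * φ x * fderiv ℝ φ x e * inner ℝ e x ∂μ := by
  have : Continuous (fderiv ℝ φ) := hφ.continuous_fderiv one_ne_zero
  have hsq (x : E) : fderiv ℝ (fun y => φ y ^ 2) x e = 2 * φ x * fderiv ℝ φ x e := by
    simp [fderiv_fun_pow 2 (hφ.differentiable one_ne_zero x)]
  have hcoord (x : E) : fderiv ℝ (innerSL ℝ e) x e = 1 := by
    rw [ContinuousLinearMap.fderiv, innerSL_apply_apply, real_inner_self_eq_norm_sq, he, one_pow]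
  have integrable_mul {g : E → ℝ} (hg : Continuous g) : Integrable (fun x => φ x * g x) μ :=
    (hφ.continuous.mul hg).integrable_of_hasCompactSupport hc.mul_right
  have h := integral_mul_fderiv_eq_neg_fderiv_mul_of_integrable (μ := μ) (v := e)
    (f := fun x => φ x ^ 2) (g := innerSL ℝ e) ?_ ?_ ?_
    (fun x _ => (hφ.pow 2).differentiable one_ne_zero x)
    (fun x _ => (innerSL ℝ e).differentiableAt)
  · simpa only [hcoord, mul_one, hsq, innerSL_apply_apply] using h
  · simp only [hsq]
    exact (integrable_mul (g := fun x => 2 * fderiv ℝ φ x e * inner ℝ e x) (by fun_prop)).congr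
      (.of_forall fun x => by simp; ring)
  · simp only [hcoord, mul_one, sq]
    exact integrable_mul hφ.continuous
  · simp only [sq, mul_assoc]
    exact integrable_mul (g := fun x => φ x * inner ℝ e x) (by fun_prop)

theorem integral_sq_le_integral_mul_norm_fderiv [Nontrivial E] {R : ℝ} (hφ : ContDiff ℝ 1 φ)
    (hc : HasCompactSupport φ) (hR : tsupport φ ⊆ Metric.closedBall 0 R) :
    ∫ x, φ x ^ 2 ∂μ ≤ 2 * R * ∫ x, ‖φ x‖ * ‖fderiv ℝ φ x‖ ∂μ := by
  obtain ⟨e, he⟩ := exists_norm_eq E zero_le_one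
  rw [integral_sq_eq_neg_integral_fderiv_mul_inner μ hφ hc he, ← integral_const_mul]
  refine (neg_le_abs _).trans <| (Real.norm_eq_abs _).symm.trans_le <|
    norm_integral_le_of_norm_le ?_ (.of_forall fun x => ?_)
  · have hφ' := hφ.continuous_fderiv one_ne_zero
    exact ((hφ.continuous.norm.mul hφ'.norm).integrable_of_hasCompactSupport
      hc.norm.mul_right).const_mul _
  · by_cases hx : x ∈ tsupport φ
    · have hxR : ‖x‖ ≤ R := mem_closedBall_zero_iff.mp (hR hx)
      have hin : ‖inner ℝ e x‖ ≤ R := (norm_inner_le_norm e x).trans (by rwa [he, one_mul])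
      have hde : ‖fderiv ℝ φ x e‖ ≤ ‖fderiv ℝ φ x‖ := by
        simpa [he] using (fderiv ℝ φ x).le_opNorm e
      calc ‖2 * φ x * fderiv ℝ φ x e * inner ℝ e x‖
          = 2 * (‖φ x‖ * ‖fderiv ℝ φ x e‖) * ‖inner ℝ e x‖ := by
            simp only [norm_mul, Real.norm_ofNat]
            ring
        _ ≤ 2 * (‖φ x‖ * ‖fderiv ℝ φ x‖) * R := by gcongr
        _ = 2 * R * (‖φ x‖ * ‖fderiv ℝ φ x‖) := by ring
    · simp [image_eq_zero_of_notMem_tsupport hx]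

end

variable {d : ℕ} {Ω : Set (Pt d)} {κ : Coeff d}

theorem norm_gradient (φ : Pt d → ℝ) (x : Pt d) : ‖gradient φ x‖ = ‖fderiv ℝ φ x‖ := by
  simp [gradient]

theorem norm_fst_le_of_mem_testPairs {R : ℝ} (hd : 0 < d) (hR0 : 0 ≤ R)
    (hΩR : Ω ⊆ Metric.closedBall 0 R) {q : L2Pair Ω} (hq : q ∈ testPairs Ω) :
    ‖q.fst‖ ≤ 2 * R * ‖q.snd‖ := by
  obtain ⟨φ, hφ, hφc, hφΩ, hfst, hsnd⟩ := hq
  have : Nonempty (Fin d) := ⟨⟨0, hd⟩⟩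
  have hzero (x : Pt d) (hx : x ∉ Ω) : φ x = 0 :=
    image_eq_zero_of_notMem_tsupport fun h => hx (hφΩ h)
  have hsq : ‖q.fst‖ ^ 2 = ∫ x, φ x ^ 2 := by
    rw [← real_inner_self_eq_norm_sq, L2.inner_def]
    refine Eq.trans ?_ (setIntegral_eq_integral_of_forall_compl_eq_zero
      (s := Ω) fun x hx => by simp [hzero x hx])
    refine integral_congr_ae ?_
    filter_upwards [hfst] with x hx
    simp [hx, sq]
  have hmul : ∫ x in Ω, ‖q.fst x‖ * ‖q.snd x‖ = ∫ x, ‖φ x‖ * ‖fderiv ℝ φ x‖ := by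
    refine Eq.trans ?_ (setIntegral_eq_integral_of_forall_compl_eq_zero
      (s := Ω) fun x hx => by simp [hzero x hx])
    refine integral_congr_ae ?_
    filter_upwards [hfst, hsnd] with x hx hx'
    rw [hx, hx', norm_gradient]
  have hle : ‖q.fst‖ ^ 2 ≤ 2 * R * (‖q.fst‖ * ‖q.snd‖) := by
    rw [hsq]
    refine (integral_sq_le_integral_mul_norm_fderiv volume
      (hφ.of_le (by exact_mod_cast le_top)) hφc (hφΩ.trans hΩR)).trans ?_
    rw [← hmul]
    gcongr
    exact integral_norm_mul_norm_le q.fst q.snd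
  rcases (norm_nonneg q.fst).eq_or_lt with h0 | hpos
  · rw [← h0]
    positivity
  · refine le_of_mul_le_mul_left ?_ hpos
    linarith

theorem exists_friedrichs (hd : 0 < d) (hΩb : Bornology.IsBounded Ω) :
    ∃ C : ℝ, 0 ≤ C ∧ ∀ v : H10 Ω, ‖fn v‖ ≤ C * ‖grad v‖ := by
  obtain ⟨R, hR0, hΩR⟩ := hΩb.subset_closedBall_lt 0 0
  refine ⟨2 * R, by positivity, fun v => ?_⟩
  have hclosed : IsClosed {q : L2Pair Ω | ‖q.fst‖ ≤ 2 * R * ‖q.snd‖} :=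
    isClosed_le (WithLp.fstL 2 ℝ _ _).continuous.norm
      (continuous_const.mul (WithLp.sndL 2 ℝ _ _).continuous.norm)
  exact closure_minimal (fun q hq => norm_fst_le_of_mem_testPairs hd hR0.le hΩR hq) hclosed v.2

theorem energyNorm_nonneg (κ : Coeff d) (v : H10 Ω) : 0 ≤ energyNorm κ v := Real.sqrt_nonneg _

theorem mul_norm_grad_sq_le_principal (hκ : κ.Admissible Ω) {α : ℝ} (hα : 0 ≤ α)
    (hpos : ∀ᵐ x ∂(volume.restrict Ω), ∀ y : Pt d, α * ‖y‖ ^ 2 ≤ y.ofLp ⬝ᵥ (κ.A x *ᵥ y.ofLp))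
    (v : H10 Ω) : α * ‖grad v‖ ^ 2 ≤ principal κ Ω v v := by
  have hnorm : ‖grad v‖ ^ 2 = ∫ x in Ω, ‖grad v x‖ ^ 2 := by
    rw [← real_inner_self_eq_norm_sq, L2.inner_def]
    simp only [real_inner_self_eq_norm_sq]
  rw [hnorm, ← integral_const_mul, principal]
  refine integral_mono_of_nonneg (.of_forall fun x => by positivity) ?_ ?_
  · exact (integrable_bilin (matrixForm d) hκ.memLp_A (grad v) (grad v)).congr
      (.of_forall fun x => matrixForm_apply _ _ _)
  · filter_upwards [hpos] with x hx
    rw [dotProduct_comm]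
    exact hx _

theorem exists_energyNorm_le_norm (hκ : κ.Admissible Ω) :
    ∃ C : ℝ, 0 ≤ C ∧ ∀ v : H10 Ω, energyNorm κ v ≤ C * ‖v‖ := by
  set B := bilinIntegral (matrixForm d) hκ.memLp_A
  refine ⟨√‖B‖, Real.sqrt_nonneg _, fun v => Real.sqrt_le_iff.mpr ⟨by positivity, ?_⟩⟩
  calc principal κ Ω v v = B (grad v) (grad v) := principal_eq_bilinIntegral hκ v v
    _ ≤ ‖B‖ * ‖grad v‖ * ‖grad v‖ := (le_abs_self _).trans (B.le_opNorm₂ _ _)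
    _ ≤ ‖B‖ * ‖v‖ * ‖v‖ := by gcongr <;> exact norm_grad_le v
    _ = (√‖B‖ * ‖v‖) ^ 2 := by rw [mul_pow, Real.sq_sqrt (norm_nonneg B)]; ring

theorem exists_norm_le_energyNorm (hd : 0 < d) (hΩb : Bornology.IsBounded Ω)
    (hκ : κ.Admissible Ω) : ∃ C : ℝ, 0 ≤ C ∧ ∀ v : H10 Ω, ‖v‖ ≤ C * energyNorm κ v := by
  obtain ⟨CF, -, hCF⟩ := exists_friedrichs hd hΩb
  obtain ⟨α, hα, hpos⟩ := hκ.posDef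
  refine ⟨√((CF ^ 2 + 1) / α), Real.sqrt_nonneg _, fun v => ?_⟩
  rw [energyNorm, ← Real.sqrt_mul (by positivity)]
  refine Real.le_sqrt_of_sq_le ?_
  calc ‖v‖ ^ 2 ≤ (CF * ‖grad v‖) ^ 2 + ‖grad v‖ ^ 2 := by
        rw [norm_sq_H10]
        gcongr
        exact hCF v
    _ = (CF ^ 2 + 1) / α * (α * ‖grad v‖ ^ 2) := by field
    _ ≤ (CF ^ 2 + 1) / α * principal κ Ω v v := by
        gcongr
        exact mul_norm_grad_sq_le_principal hκ hα.le hpos v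

theorem exists_energyNorm_equiv (hd : 0 < d) (hΩb : Bornology.IsBounded Ω)
    (hκ : κ.Admissible Ω) : ∃ C : ℝ, 0 < C ∧ ∀ v : H10 Ω,
      energyNorm κ v ≤ C * ‖v‖ ∧ ‖v‖ ≤ C * energyNorm κ v := by
  obtain ⟨C₁, h₁, hle₁⟩ := exists_energyNorm_le_norm hκ
  obtain ⟨C₂, h₂, hle₂⟩ := exists_norm_le_energyNorm hd hΩb hκ
  refine ⟨C₁ + C₂ + 1, by positivity, fun v => ⟨(hle₁ v).trans ?_, (hle₂ v).trans ?_⟩⟩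
  · gcongr
    linarith
  · have := energyNorm_nonneg κ v
    gcongr
    linarith

end Friedrichs

/-! ### Finite element spaces -/

section FiniteElements

variable {d : ℕ} {Ω : Set (Pt d)}

theorem measurableSet_hull (T : Element d) : MeasurableSet T.hull :=
  (T.finite_toSet.isCompact_convexHull ℝ).measurableSet

theorem memLp_eval (hΩb : Bornology.IsBounded Ω) (q : ℝ≥0∞) (P : MvPolynomial (Fin d) ℝ) :
    MemLp (fun x : Pt d => MvPolynomial.eval x.ofLp P) q (volume.restrict Ω) := by
  have hcont : Continuous fun x : Pt d => MvPolynomial.eval x.ofLp P :=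
    (MvPolynomial.continuous_eval P).comp (PiLp.continuous_ofLp 2 _)
  have hcompact : IsCompact (closure Ω) := hΩb.isCompact_closure
  obtain ⟨C, hC⟩ := hcompact.exists_bound_of_continuousOn hcont.continuousOn
  have : IsFiniteMeasure (volume.restrict (closure Ω)) :=
    isFiniteMeasure_restrict.mpr hcompact.measure_lt_top.ne
  refine MemLp.mono_measure (Measure.restrict_mono subset_closure le_rfl) ?_
  exact .of_bound hcont.aestronglyMeasurable C
    ((ae_restrict_mem isClosed_closure.measurableSet).mono hC)

/-- Polynomials of degree at most `p`, restricted to `Ω`, as elements of `L²(Ω)`. -/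
def polyToLp (hΩb : Bornology.IsBounded Ω) (p : ℕ) :
    MvPolynomial.restrictTotalDegree (Fin d) ℝ p →ₗ[ℝ] Lp ℝ 2 (volume.restrict Ω) where
  toFun P := (memLp_eval hΩb 2 P.1).toLp _
  map_add' P Q := by
    rw [← MemLp.toLp_add]
    exact MemLp.toLp_congr _ _ (.of_forall fun x => by simp)
  map_smul' c P := by
    rw [RingHom.id_apply, ← MemLp.toLp_const_smul]
    exact MemLp.toLp_congr _ _ (.of_forall fun x => by simp)

theorem LpToLpRestrictCLM_eq_iff {X : Type*} [MeasurableSpace X] {μ : Measure X} {s : Set X}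
    (hs : MeasurableSet s) {f g : Lp ℝ 2 μ} :
    LpToLpRestrictCLM X ℝ ℝ μ 2 s f = LpToLpRestrictCLM X ℝ ℝ μ 2 s g
      ↔ ∀ᵐ x ∂μ, x ∈ s → f x = g x := by
  rw [← ae_restrict_iff' hs, Lp.ext_iff]
  have hf := LpToLpRestrictCLM_coeFn ℝ s f
  have hg := LpToLpRestrictCLM_coeFn ℝ s g
  exact ⟨fun h => hf.symm.trans (h.trans hg),
    fun h => hf.trans (Filter.EventuallyEq.trans h hg.symm)⟩

theorem mem_feSpace_iff_restrict_mem (hΩb : Bornology.IsBounded Ω) {p : ℕ} {𝒯 : Mesh d}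
    {v : H10 Ω} : v ∈ feSpace Ω p 𝒯 ↔ ∀ T ∈ 𝒯,
      LpToLpRestrictCLM (Pt d) ℝ ℝ (volume.restrict Ω) 2 T.hull (fn v) ∈
        (LinearMap.range (polyToLp hΩb p)).map
          (LpToLpRestrictCLM (Pt d) ℝ ℝ (volume.restrict Ω) 2 T.hull).toLinearMap := by
  refine forall₂_congr fun T _ => ⟨?_, ?_⟩
  · rintro ⟨P, hP, h⟩
    refine ⟨_, ⟨⟨P, (MvPolynomial.mem_restrictTotalDegree _ _ _).mpr hP⟩, rfl⟩, ?_⟩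
    refine (LpToLpRestrictCLM_eq_iff (measurableSet_hull T)).mpr ?_
    filter_upwards [h, (memLp_eval hΩb 2 P).coeFn_toLp] with x hx hPx hxT
    exact hPx.trans (hx hxT).symm
  · rintro ⟨_, ⟨P, rfl⟩, h⟩
    refine ⟨P.1, (MvPolynomial.mem_restrictTotalDegree _ _ _).mp P.2, ?_⟩
    filter_upwards [(LpToLpRestrictCLM_eq_iff (measurableSet_hull T)).mp h,
      (memLp_eval hΩb 2 P.1).coeFn_toLp] with x hx hPx hxT
    exact (hx hxT).symm.trans hPx

theorem isClosed_feSpace (hΩb : Bornology.IsBounded Ω) (p : ℕ) (𝒯 : Mesh d) :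
    IsClosed (feSpace Ω p 𝒯 : Set (H10 Ω)) := by
  let restrict (T : Element d) := LpToLpRestrictCLM (Pt d) ℝ ℝ (volume.restrict Ω) 2 T.hull
  have heq : (feSpace Ω p 𝒯 : Set (H10 Ω)) = ⋂ T ∈ 𝒯, ((restrict T).comp (fnL Ω)) ⁻¹'
      ((LinearMap.range (polyToLp hΩb p)).map (restrict T).toLinearMap) := by
    ext v
    simp only [SetLike.mem_coe, mem_feSpace_iff_restrict_mem hΩb, Set.mem_iInter]
    rfl
  rw [heq]
  refine isClosed_biInter fun T _ => (Submodule.closed_of_finiteDimensional _).preimage ?_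
  exact ((restrict T).comp (fnL Ω)).continuous

end FiniteElements

/-! ### The primal and dual problem as one Galerkin scheme -/

section Pairs

variable {H : Type*} [NormedAddCommGroup H] [InnerProductSpace ℝ H]
variable {a G : H →L[ℝ] H →L[ℝ] ℝ} {α M : ℝ}

/-- The form of the coupled system for `(u, z)` with test functions `(v, y)`, namely
`μ a(u, v) + a(y, z) - G(u, y)`. The weight `μ` of the primal equation is the one for which Young's
inequality absorbs the coupling term `G(u, y)` into the diagonal terms. -/
def pairForm (a G : H →L[ℝ] H →L[ℝ] ℝ) (α : ℝ) :
    WithLp 2 (H × H) →L[ℝ] WithLp 2 (H × H) →L[ℝ] ℝ :=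
  (1 / 2 + ‖G‖ ^ 2 / (2 * α ^ 2)) • a.bilinearComp (WithLp.fstL 2 ℝ H H) (WithLp.fstL 2 ℝ H H)
    + a.flip.bilinearComp (WithLp.sndL 2 ℝ H H) (WithLp.sndL 2 ℝ H H)
    - G.bilinearComp (WithLp.fstL 2 ℝ H H) (WithLp.sndL 2 ℝ H H)

theorem pairForm_apply (p q : WithLp 2 (H × H)) : pairForm a G α p q =
    (1 / 2 + ‖G‖ ^ 2 / (2 * α ^ 2)) * a p.fst q.fst + a q.snd p.snd - G p.fst q.snd := rfl

theorem mul_norm_sq_le_pairForm (hα : 0 < α) (hco : ∀ v, α * ‖v‖ ^ 2 ≤ a v v)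
    (p : WithLp 2 (H × H)) : α / 2 * ‖p‖ ^ 2 ≤ pairForm a G α p p := by
  rw [pairForm_apply, WithLp.prod_norm_sq_eq_of_L2]
  have hcoupling : G p.fst p.snd ≤ ‖G‖ * ‖p.fst‖ * ‖p.snd‖ :=
    (le_abs_self _).trans (G.le_opNorm₂ _ _)
  have hprimal : (1 / 2 + ‖G‖ ^ 2 / (2 * α ^ 2)) * (α * ‖p.fst‖ ^ 2)
      ≤ (1 / 2 + ‖G‖ ^ 2 / (2 * α ^ 2)) * a p.fst p.fst := by
    gcongr
    exact hco _
  have hyoung : 0 ≤ α / 2 * ‖p.snd‖ ^ 2 - ‖G‖ * ‖p.fst‖ * ‖p.snd‖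
      + ‖G‖ ^ 2 / (2 * α ^ 2) * (α * ‖p.fst‖ ^ 2) := by
    have : 0 ≤ α / 2 * (‖p.snd‖ - ‖G‖ / α * ‖p.fst‖) ^ 2 := by positivity
    refine this.trans_eq ?_
    field
  linarith [hco p.snd]

theorem IsElliptic.exists_pairForm (ha : IsElliptic a α M) (G : H →L[ℝ] H →L[ℝ] ℝ) :
    ∃ M', IsElliptic (pairForm a G α) (α / 2) M' :=
  exists_of_coercive (half_pos ha.coercivity_pos)
    (mul_norm_sq_le_pairForm ha.coercivity_pos ha.coercive)

/-- The space `X × X` in which the coupled system is solved. -/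
def pairSpace (X : Submodule ℝ H) : Submodule ℝ (WithLp 2 (H × H)) :=
  X.comap (WithLp.fstL 2 ℝ H H).toLinearMap ⊓ X.comap (WithLp.sndL 2 ℝ H H).toLinearMap

theorem isClosed_pairSpace {X : Submodule ℝ H} (hX : IsClosed (X : Set H)) :
    IsClosed (pairSpace X : Set (WithLp 2 (H × H))) :=
  (hX.preimage (WithLp.fstL 2 ℝ H H).continuous).inter
    (hX.preimage (WithLp.sndL 2 ℝ H H).continuous)

theorem pairSpace_mono : Monotone (pairSpace (H := H)) := fun _ _ h _ hp => ⟨h hp.1, h hp.2⟩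

/-- `u` and `z` solve the primal problem with right-hand side `F` and the dual problem linearized
around `u`, with trial and test functions in `X`. -/
structure SolvesOn (a G : H →L[ℝ] H →L[ℝ] ℝ) (F : H → ℝ) (X : Submodule ℝ H) (u z : H) : Prop where
  mem_primal : u ∈ X
  mem_dual : z ∈ X
  primal : ∀ v ∈ X, a u v = F v
  dual : ∀ v ∈ X, a v z = G u v

theorem SolvesOn.isGalerkin {F : H → ℝ} {X : Submodule ℝ H} {u z u' z' : H}
    (h : SolvesOn a G F ⊤ u z) (h' : SolvesOn a G F X u' z') :
    IsGalerkin (pairForm a G α) (pairSpace X) (WithLp.toLp 2 (u, z)) (WithLp.toLp 2 (u', z')) where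
  mem := ⟨h'.mem_primal, h'.mem_dual⟩
  orthogonal q hq := by
    have hq₁ : q.fst ∈ X := hq.1
    have hq₂ : q.snd ∈ X := hq.2
    simp only [pairForm_apply, map_sub, sub_apply, WithLp.toLp_fst, WithLp.toLp_snd]
    rw [h.primal _ trivial, h'.primal _ hq₁, h.dual _ trivial, h'.dual _ hq₂]
    ring

theorem IsElliptic.exists_pair_stability (ha : IsElliptic a α M) (G : H →L[ℝ] H →L[ℝ] ℝ) :
    ∃ C : ℝ, 0 < C ∧ ∀ (F : H → ℝ) (X X' : Submodule ℝ H) (u z u₁ z₁ u₂ z₂ : H), X ≤ X' →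
      SolvesOn a G F ⊤ u z → SolvesOn a G F X u₁ z₁ → SolvesOn a G F X' u₂ z₂ →
      ‖u₂ - u₁‖ ^ 2 + ‖z₂ - z₁‖ ^ 2 ≤ C * (‖u - u₁‖ ^ 2 + ‖z - z₁‖ ^ 2) := by
  obtain ⟨M', hB⟩ := ha.exists_pairForm G
  have hα := hB.coercivity_pos
  have hM' := hB.bound_pos
  refine ⟨(M' / (α / 2)) ^ 2, by positivity, fun F X X' u z u₁ z₁ u₂ z₂ hX h h₁ h₂ => ?_⟩
  have hle := pow_le_pow_left₀ (norm_nonneg _) (hB.norm_sub_le_of_isGalerkin (h.isGalerkin h₂)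
    (pairSpace_mono hX (h.isGalerkin (α := α) h₁).mem)) 2
  rw [mul_pow, WithLp.prod_norm_sq_eq_of_L2, WithLp.prod_norm_sq_eq_of_L2] at hle
  exact hle

theorem IsElliptic.exists_pair_quasi_orthogonality [CompleteSpace H] (ha : IsElliptic a α M)
    (G : H →L[ℝ] H →L[ℝ] ℝ) :
    ∃ Co c : ℝ, 0 ≤ Co ∧ 0 ≤ c ∧ c < 1 ∧
      ∀ (F : H → ℝ) (X : ℕ → Submodule ℝ H) (u z : H) (us zs : ℕ → H), Monotone X →
        (∀ k, IsClosed (X k : Set H)) → SolvesOn a G F ⊤ u z →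
        (∀ k, SolvesOn a G F (X k) (us k) (zs k)) → ∀ ℓ m : ℕ,
        ∑ k ∈ Finset.Ico ℓ (ℓ + 2 ^ m), (‖us (k + 1) - us k‖ ^ 2 + ‖zs (k + 1) - zs k‖ ^ 2)
          ≤ Co * (1 + c) ^ m * (‖u - us ℓ‖ ^ 2 + ‖z - zs ℓ‖ ^ 2) := by
  obtain ⟨M', hB⟩ := ha.exists_pairForm G
  refine ⟨(M' * ((1 + M' / (α / 2)) / (α / 2))) ^ 2, angleConst (α / 2) M', sq_nonneg _,
    angleConst_nonneg, hB.angleConst_lt_one, fun F X u z us zs hmono hcl h hs ℓ m => ?_⟩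
  have hsum := hB.sum_sq_increment_le (fun i j hij => pairSpace_mono (hmono hij))
    (fun k => isClosed_pairSpace (hcl k)) (fun k => h.isGalerkin (hs k)) ℓ m
  simp only [WithLp.prod_norm_sq_eq_of_L2, mul_pow] at hsum
  refine hsum.trans_eq ?_
  change M' ^ 2 * (‖u - us ℓ‖ ^ 2 + ‖z - zs ℓ‖ ^ 2) * _ = _
  ring

theorem IsElliptic.norm_dual_sub_le (ha : IsElliptic a α M) {X : Submodule ℝ H}
    {z z' w w' : H} {C : ℝ} (hz : z ∈ X) (hz' : z' ∈ X) (h : ∀ v ∈ X, a v z = G w v)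
    (h' : ∀ v ∈ X, a v z' = G w' v) (hC0 : 0 ≤ C) (hC : ∀ v, |G (w - w') v| ≤ C * ‖v‖) :
    ‖z - z'‖ ≤ C / α := by
  refine ha.norm_le hC0 ?_
  have hmem := X.sub_mem hz hz'
  rw [map_sub, h _ hmem, h' _ hmem, ← sub_apply, ← map_sub]
  exact (le_abs_self _).trans (hC _)

end Pairs

/-! ### Exact and discrete solutions -/

section DiscreteSolutions

variable {d : ℕ} {Ω : Set (Pt d)} {κ : Coeff d} {K : GoalOp Ω}

/-- The right-hand side `(w, v) ↦ b(v, w) + b(w, v)` of the dual problem. -/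
def goalForm (K : GoalOp Ω) : H10 Ω →L[ℝ] H10 Ω →L[ℝ] ℝ := K + K.flip

theorem goalForm_apply (K : GoalOp Ω) (w v : H10 Ω) : goalForm K w v = K v w + K w v :=
  add_comm _ _

/-- What the functional analysis provides about the discretization: the form `a` as an elliptic
bounded bilinear form on `H¹₀(Ω)`, a bound `MG` of the goal form, the equivalence of the energy norm
and the norm of `H¹₀(Ω)` with constant `CE`, and the closedness of the finite element spaces. -/
structure Setting (κ : Coeff d) (K : GoalOp Ω) where
  a : H10 Ω →L[ℝ] H10 Ω →L[ℝ] ℝ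
  a_apply : ∀ u v, a u v = form κ Ω u v
  α : ℝ
  M : ℝ
  elliptic : IsElliptic a α M
  MG : ℝ
  MG_pos : 0 < MG
  goalForm_le : ∀ w v, |goalForm K w v| ≤ MG * ‖w‖ * ‖v‖
  CE : ℝ
  CE_pos : 0 < CE
  energy_le : ∀ v : H10 Ω, energyNorm κ v ≤ CE * ‖v‖
  le_energy : ∀ v : H10 Ω, ‖v‖ ≤ CE * energyNorm κ v
  closed : ∀ p 𝒯, IsClosed (feSpace Ω p 𝒯 : Set (H10 Ω))

theorem nonempty_setting (hd : 0 < d) (hΩb : Bornology.IsBounded Ω) (hκ : κ.Admissible Ω)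
    (K : GoalOp Ω) : Nonempty (Setting κ K) := by
  obtain ⟨a, ha⟩ := exists_formL hκ
  obtain ⟨α, hα, hco⟩ := hκ.elliptic
  obtain ⟨M, hM⟩ := IsElliptic.exists_of_coercive hα fun v => (ha v v).symm ▸ hco v
  obtain ⟨CE, hCE, hequiv⟩ := exists_energyNorm_equiv hd hΩb hκ
  obtain ⟨MG, hMG, hG⟩ := exists_abs_apply_le (goalForm K)
  exact ⟨⟨a, ha, α, M, hM, MG, hMG, hG, CE, hCE, fun v => (hequiv v).1, fun v => (hequiv v).2,
    isClosed_feSpace hΩb⟩⟩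

namespace Setting

theorem primalIn_spec (S : Setting κ K) (D : Data Ω) {X : Submodule ℝ (H10 Ω)}
    (hX : IsClosed (X : Set (H10 Ω))) :
    D.primalIn κ X ∈ X ∧ ∀ v ∈ X, S.a (D.primalIn κ X) v = D.rhs v := by
  obtain ⟨F, hF⟩ := D.exists_rhsL
  obtain ⟨u, hu, hsol⟩ := S.elliptic.exists_mem_forall_eq hX F
  simp only [S.a_apply, hF] at hsol ⊢
  exact Classical.epsilon_spec (p := fun u => u ∈ X ∧ ∀ v ∈ X, form κ Ω u v = D.rhs v)
    ⟨u, hu, hsol⟩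

theorem dualIn_spec (S : Setting κ K) {X : Submodule ℝ (H10 Ω)} (hX : IsClosed (X : Set (H10 Ω)))
    (w : H10 Ω) : dualIn κ K X w ∈ X ∧ ∀ v ∈ X, S.a v (dualIn κ K X w) = goalForm K w v := by
  obtain ⟨z, hz, hsol⟩ := S.elliptic.flip.exists_mem_forall_eq hX (goalForm K w)
  simp only [ContinuousLinearMap.flip_apply, S.a_apply, goalForm_apply] at hsol ⊢
  exact Classical.epsilon_spec (p := fun z => z ∈ X ∧ ∀ v ∈ X, form κ Ω v z = K v w + K w v)
    ⟨z, hz, hsol⟩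

theorem solH_mem (S : Setting κ K) (D : Data Ω) (𝒯 : Mesh d) : D.solH κ 𝒯 ∈ D.space 𝒯 :=
  (S.primalIn_spec D (S.closed D.p 𝒯)).1

theorem dualH_mem (S : Setting κ K) (D : Data Ω) (𝒯 : Mesh d) (w : H10 Ω) :
    D.dualH κ K 𝒯 w ∈ D.space 𝒯 :=
  (S.dualIn_spec (S.closed D.p 𝒯) w).1

theorem dualLinH_mem (S : Setting κ K) (D : Data Ω) (𝒯 : Mesh d) : D.dualLinH κ K 𝒯 ∈ D.space 𝒯 :=
  S.dualH_mem D 𝒯 _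

theorem solvesOn_sol (S : Setting κ K) (D : Data Ω) :
    SolvesOn S.a (goalForm K) D.rhs ⊤ (D.sol κ) (dualSol κ K (D.sol κ)) :=
  ⟨trivial, trivial, (S.primalIn_spec D (X := ⊤) isClosed_univ).2,
    (S.dualIn_spec (X := ⊤) isClosed_univ _).2⟩

theorem solvesOn_solH (S : Setting κ K) (D : Data Ω) (𝒯 : Mesh d) :
    SolvesOn S.a (goalForm K) D.rhs (D.space 𝒯) (D.solH κ 𝒯) (D.dualLinH κ K 𝒯) :=
  ⟨S.solH_mem D 𝒯, S.dualLinH_mem D 𝒯, (S.primalIn_spec D (S.closed D.p 𝒯)).2,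
    (S.dualIn_spec (S.closed D.p 𝒯) _).2⟩

theorem norm_dualIn_sub_le (S : Setting κ K) {X : Submodule ℝ (H10 Ω)}
    (hX : IsClosed (X : Set (H10 Ω))) {w w' : H10 Ω} {C : ℝ} (hC0 : 0 ≤ C)
    (hC : ∀ v, |goalForm K (w - w') v| ≤ C * ‖v‖) :
    ‖dualIn κ K X w - dualIn κ K X w'‖ ≤ C / S.α := by
  obtain ⟨hz, hzv⟩ := S.dualIn_spec hX w
  obtain ⟨hz', hzv'⟩ := S.dualIn_spec hX w'
  exact S.elliptic.norm_dual_sub_le hz hz' hzv hzv' hC0 hC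

theorem norm_dualIn_sub_le_mul_norm (S : Setting κ K) {X : Submodule ℝ (H10 Ω)}
    (hX : IsClosed (X : Set (H10 Ω))) (w w' : H10 Ω) :
    ‖dualIn κ K X w - dualIn κ K X w'‖ ≤ S.MG / S.α * ‖w - w'‖ := by
  rw [div_mul_eq_mul_div]
  exact S.norm_dualIn_sub_le hX (mul_nonneg S.MG_pos.le (norm_nonneg _)) (S.goalForm_le _)

theorem norm_dualH_sub_le (S : Setting κ K) (D : Data Ω) (𝒯 : Mesh d) (w w' : H10 Ω) :
    ‖D.dualH κ K 𝒯 w - D.dualH κ K 𝒯 w'‖ ≤ S.MG / S.α * ‖w - w'‖ :=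
  S.norm_dualIn_sub_le_mul_norm (S.closed D.p 𝒯) w w'

theorem norm_dualSol_sub_le (S : Setting κ K) (w w' : H10 Ω) :
    ‖dualSol κ K w - dualSol κ K w'‖ ≤ S.MG / S.α * ‖w - w'‖ :=
  S.norm_dualIn_sub_le_mul_norm (X := ⊤) isClosed_univ w w'

theorem energyNorm_zero (S : Setting κ K) : energyNorm κ (0 : H10 Ω) = 0 :=
  le_antisymm (by simpa using S.energy_le 0) (energyNorm_nonneg _ _)

end Setting

/-- The squared error of the discrete solutions `u_H` and `z_H[u_H]`. -/
def Data.errSq (D : Data Ω) (κ : Coeff d) (K : GoalOp Ω) (𝒯 : Mesh d) : ℝ :=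
  ‖D.sol κ - D.solH κ 𝒯‖ ^ 2 + ‖dualSol κ K (D.sol κ) - D.dualLinH κ K 𝒯‖ ^ 2

/-- The squared distance of the discrete solutions on two meshes. -/
def Data.distSq (D : Data Ω) (κ : Coeff d) (K : GoalOp Ω) (𝒯 𝒯' : Mesh d) : ℝ :=
  ‖D.solH κ 𝒯' - D.solH κ 𝒯‖ ^ 2 + ‖D.dualLinH κ K 𝒯' - D.dualLinH κ K 𝒯‖ ^ 2

namespace Setting

theorem exists_distSq_le (S : Setting κ K) :
    ∃ C : ℝ, 0 < C ∧ ∀ (D : Data Ω) (𝒯 𝒯' : Mesh d), D.space 𝒯 ≤ D.space 𝒯' →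
      D.distSq κ K 𝒯 𝒯' ≤ C * D.errSq κ K 𝒯 := by
  obtain ⟨C, hC, h⟩ := S.elliptic.exists_pair_stability (goalForm K)
  exact ⟨C, hC, fun D 𝒯 𝒯' hX => h D.rhs _ _ _ _ _ _ _ _ hX (S.solvesOn_sol D)
    (S.solvesOn_solH D 𝒯) (S.solvesOn_solH D 𝒯')⟩

theorem exists_quasi_orthogonality (S : Setting κ K) :
    ∃ Co c : ℝ, 0 ≤ Co ∧ 0 ≤ c ∧ c < 1 ∧ ∀ (D : Data Ω) (𝒯 : ℕ → Mesh d),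
      Monotone (fun k => D.space (𝒯 k)) → ∀ ℓ m : ℕ,
        ∑ k ∈ Finset.Ico ℓ (ℓ + 2 ^ m), D.distSq κ K (𝒯 k) (𝒯 (k + 1))
          ≤ Co * (1 + c) ^ m * D.errSq κ K (𝒯 ℓ) := by
  obtain ⟨Co, c, hCo, hc0, hc, h⟩ := S.elliptic.exists_pair_quasi_orthogonality (goalForm K)
  exact ⟨Co, c, hCo, hc0, hc, fun D 𝒯 hmono => h D.rhs _ _ _ _ _ hmono
    (fun k => S.closed D.p (𝒯 k)) (S.solvesOn_sol D) (fun k => S.solvesOn_solH D (𝒯 k))⟩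

end Setting

end DiscreteSolutions

/-! ### Meshes and estimators -/

theorem abs_sqrt_sub_sqrt_le (x y x' y' : ℝ) :
    |√(x ^ 2 + y ^ 2) - √(x' ^ 2 + y' ^ 2)| ≤ |x - x'| + |y - y'| := by
  have reverse_triangle := (abs_norm_sub_norm_le (⟨x, y⟩ : ℂ) ⟨x', y'⟩).trans
    (Complex.norm_le_abs_re_add_abs_im _)
  simpa only [Complex.norm_eq_sqrt_sq_add_sq, Complex.sub_re, Complex.sub_im]
    using reverse_triangle

theorem sum_sq_le_of_reduction {ι : Type*} [DecidableEq ι] {s t : Finset ι} {f g : ι → ℝ} {q : ℝ}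
    (hinter : √(∑ i ∈ s ∩ t, f i ^ 2) = √(∑ i ∈ s ∩ t, g i ^ 2))
    (hsdiff : √(∑ i ∈ s \ t, f i ^ 2) ≤ q * √(∑ i ∈ t \ s, g i ^ 2)) :
    ∑ i ∈ s, f i ^ 2 ≤ ∑ i ∈ t, g i ^ 2 - (1 - q ^ 2) * ∑ i ∈ t \ s, g i ^ 2 := by
  have sum_nonneg : ∀ (r : Finset ι) (h : ι → ℝ), 0 ≤ ∑ i ∈ r, h i ^ 2 := fun r h =>
    Finset.sum_nonneg fun _ _ => sq_nonneg _
  have hsdiff_sq := pow_le_pow_left₀ (Real.sqrt_nonneg _) hsdiff 2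
  rw [mul_pow, Real.sq_sqrt (sum_nonneg _ _), Real.sq_sqrt (sum_nonneg _ _)] at hsdiff_sq
  rw [Real.sqrt_inj (sum_nonneg _ _) (sum_nonneg _ _), Finset.inter_comm s t] at hinter
  rw [← Finset.sum_inter_add_sum_sdiff s t, ← Finset.sum_inter_add_sum_sdiff t s,
    Finset.inter_comm s t, hinter]
  linarith

section AxiomsOfAdaptivity

variable {d : ℕ} {Ω : Set (Pt d)} {κ : Coeff d} {K : GoalOp Ω}
variable {Cmesh Cstab Clip qred Crel Cdrel θ Cmark : ℝ}

namespace Data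

variable {D : Data Ω} {𝒯 𝒯' 𝒯'' : Mesh d} {𝒰 𝒰' : Finset (Element d)} {v v' w w' : H10 Ω}

theorem Refinement.refl (𝒯 : Mesh d) : D.Refinement 𝒯 𝒯 := Relation.ReflTransGen.refl

theorem IsMesh.refinement (h : D.IsMesh 𝒯) (h' : D.Refinement 𝒯 𝒯') : D.IsMesh 𝒯' :=
  Relation.ReflTransGen.trans h h'

theorem isMesh_mesh₀ : D.IsMesh D.mesh₀ := Relation.ReflTransGen.refl

theorem MeshAssumptions.space_mono (hM : D.MeshAssumptions Cmesh) (h : D.IsMesh 𝒯)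
    (h' : D.Refinement 𝒯 𝒯') : D.space 𝒯 ≤ D.space 𝒯' := by
  induction h' with
  | refl => exact le_rfl
  | tail h₁ h₂ ih =>
    obtain ⟨ℳ, hℳ, rfl⟩ := h₂
    refine ih.trans fun v hv T' hT' => ?_
    obtain ⟨T, hT, hsub⟩ := hM.subdivision _ (h.refinement h₁) ℳ hℳ T' hT'
    obtain ⟨P, hP, hvP⟩ := hv T hT
    exact ⟨P, hP, hvP.mono fun x hx hxT => hx (hsub hxT)⟩

theorem MeshAssumptions.card_le (hM : D.MeshAssumptions Cmesh) (h : D.IsMesh 𝒯)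
    (h' : D.Refinement 𝒯 𝒯') : 𝒯.card ≤ 𝒯'.card :=
  (Nat.le_add_left _ _).trans (hM.sons 𝒯 𝒯' h h')

namespace IsRun

variable {𝒯 : ℕ → Mesh d} {ℳ : ℕ → Finset (Element d)}

theorem refinement (h : D.IsRun κ K θ Cmark 𝒯 ℳ) {ℓ n : ℕ} (hn : ℓ ≤ n) :
    D.Refinement (𝒯 ℓ) (𝒯 n) := by
  induction n, hn using Nat.le_induction with
  | base => exact Refinement.refl _
  | succ n _ ih => exact ih.tail ⟨ℳ n, h.subset n, h.step n⟩

theorem isMesh (h : D.IsRun κ K θ Cmark 𝒯 ℳ) (ℓ : ℕ) : D.IsMesh (𝒯 ℓ) := by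
  have := h.refinement (Nat.zero_le ℓ)
  rwa [h.init] at this

end IsRun

theorem etaOn_nonneg (𝒯 : Mesh d) (𝒰 : Finset (Element d)) (v : H10 Ω) : 0 ≤ D.etaOn 𝒯 𝒰 v :=
  Real.sqrt_nonneg _

theorem zetaOn_nonneg (𝒯 : Mesh d) (w : H10 Ω) (𝒰 : Finset (Element d)) (v : H10 Ω) :
    0 ≤ D.zetaOn 𝒯 w 𝒰 v :=
  Real.sqrt_nonneg _

theorem etaOn_sq (𝒯 : Mesh d) (𝒰 : Finset (Element d)) (v : H10 Ω) :
    D.etaOn 𝒯 𝒰 v ^ 2 = ∑ T ∈ 𝒰, D.eta 𝒯 T v ^ 2 :=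
  Real.sq_sqrt (Finset.sum_nonneg fun _ _ => sq_nonneg _)

theorem zetaOn_sq (𝒯 : Mesh d) (w : H10 Ω) (𝒰 : Finset (Element d)) (v : H10 Ω) :
    D.zetaOn 𝒯 w 𝒰 v ^ 2 = ∑ T ∈ 𝒰, D.zeta 𝒯 w T v ^ 2 :=
  Real.sq_sqrt (Finset.sum_nonneg fun _ _ => sq_nonneg _)

theorem etaOn_mono (h : 𝒰 ⊆ 𝒰') (𝒯 : Mesh d) (v : H10 Ω) : D.etaOn 𝒯 𝒰 v ≤ D.etaOn 𝒯 𝒰' v :=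
  Real.sqrt_le_sqrt (Finset.sum_le_sum_of_subset_of_nonneg h fun _ _ _ => sq_nonneg _)

theorem zetaOn_mono (h : 𝒰 ⊆ 𝒰') (𝒯 : Mesh d) (w v : H10 Ω) :
    D.zetaOn 𝒯 w 𝒰 v ≤ D.zetaOn 𝒯 w 𝒰' v :=
  Real.sqrt_le_sqrt (Finset.sum_le_sum_of_subset_of_nonneg h fun _ _ _ => sq_nonneg _)

theorem combSq_nonneg (𝒯 : Mesh d) (𝒰 : Finset (Element d)) (v w : H10 Ω) :
    0 ≤ D.combSq 𝒯 𝒰 v w := add_nonneg (sq_nonneg _) (sq_nonneg _)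

theorem combSq_mono (h : 𝒰 ⊆ 𝒰') (𝒯 : Mesh d) (v w : H10 Ω) :
    D.combSq 𝒯 𝒰 v w ≤ D.combSq 𝒯 𝒰' v w :=
  add_le_add (pow_le_pow_left₀ (etaOn_nonneg _ _ _) (etaOn_mono h _ _) 2)
    (pow_le_pow_left₀ (zetaOn_nonneg _ _ _ _) (zetaOn_mono h _ _ _) 2)

theorem combSq_eq_inter_add_sdiff (𝒰 𝒰' : Finset (Element d))
    (𝒯 : Mesh d) (v w : H10 Ω) :
    D.combSq 𝒯 𝒰 v w = D.combSq 𝒯 (𝒰 ∩ 𝒰') v w + D.combSq 𝒯 (𝒰 \ 𝒰') v w := by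
  simp only [combSq, etaOn_sq, zetaOn_sq]
  rw [← Finset.sum_inter_add_sum_sdiff 𝒰 𝒰', ← Finset.sum_inter_add_sum_sdiff 𝒰 𝒰' fun T => _ ^ 2]
  ring

theorem est_nonneg (𝒯 : Mesh d) : 0 ≤ D.est κ K 𝒯 := combSq_nonneg _ _ _ _

theorem etaOn_le_sqrt_estOn (𝒯 : Mesh d) (𝒰 : Finset (Element d)) :
    D.etaOn 𝒯 𝒰 (D.solH κ 𝒯) ≤ √(D.estOn κ K 𝒯 𝒰) :=
  Real.le_sqrt_of_sq_le (le_add_of_nonneg_right (sq_nonneg _))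

theorem zetaOn_le_sqrt_estOn (𝒯 : Mesh d) (𝒰 : Finset (Element d)) :
    D.zetaOn 𝒯 (D.solH κ 𝒯) 𝒰 (D.dualLinH κ K 𝒯) ≤ √(D.estOn κ K 𝒯 𝒰) :=
  Real.le_sqrt_of_sq_le (le_add_of_nonneg_left (sq_nonneg _))

theorem sqrt_combSq_le_add (𝒯 : Mesh d) (𝒰 : Finset (Element d)) (v w : H10 Ω) :
    √(D.combSq 𝒯 𝒰 v w) ≤ D.etaOn 𝒯 𝒰 v + D.zetaOn 𝒯 v 𝒰 w := by
  have hη := D.etaOn_nonneg 𝒯 𝒰 v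
  have hζ := D.zetaOn_nonneg 𝒯 v 𝒰 w
  refine Real.sqrt_le_iff.mpr ⟨by positivity, ?_⟩
  rw [combSq]
  nlinarith

/-! ### Consequences of the axioms of adaptivity -/

namespace Axioms

theorem abs_etaOn_sub_le (hA : D.Axioms κ K Cstab Clip qred Crel Cdrel) (S : Setting κ K)
    (h : D.IsMesh 𝒯) (h' : D.Refinement 𝒯 𝒯') (hv : v ∈ D.space 𝒯) (hv' : v' ∈ D.space 𝒯')
    (h𝒰 : ∀ T ∈ 𝒰, T ∈ 𝒯' ∧ T ∈ 𝒯) :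
    |D.etaOn 𝒯' 𝒰 v' - D.etaOn 𝒯 𝒰 v| ≤ Cstab * energyNorm κ (v' - v) := by
  have hstab := hA.stability 𝒯 𝒯' h h' v' hv' v hv 0 0 𝒰 fun T hT =>
    Finset.mem_inter.mpr (h𝒰 T hT)
  rw [sub_self (0 : H10 Ω), S.energyNorm_zero, mul_zero, add_zero] at hstab
  exact (le_add_of_nonneg_right (abs_nonneg _)).trans hstab

theorem abs_zetaOn_sub_le (hA : D.Axioms κ K Cstab Clip qred Crel Cdrel) (h : D.IsMesh 𝒯)
    (h' : D.Refinement 𝒯 𝒯') (hv : v ∈ D.space 𝒯) (hv' : v' ∈ D.space 𝒯') (w w' : H10 Ω)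
    (h𝒰 : ∀ T ∈ 𝒰, T ∈ 𝒯' ∧ T ∈ 𝒯) :
    |D.zetaOn 𝒯' w' 𝒰 v' - D.zetaOn 𝒯 w 𝒰 v|
      ≤ Cstab * energyNorm κ (v' - v) + Clip * energyNorm κ (w' - w) :=
  (le_add_of_nonneg_left (abs_nonneg _)).trans <|
    hA.stability 𝒯 𝒯' h h' v' hv' v hv w' w 𝒰 fun T hT => Finset.mem_inter.mpr (h𝒰 T hT)

theorem abs_sqrt_combSq_sub_le (hA : D.Axioms κ K Cstab Clip qred Crel Cdrel) (S : Setting κ K)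
    (hl : 0 ≤ Clip) (h : D.IsMesh 𝒯) (h' : D.Refinement 𝒯 𝒯') (hv : v ∈ D.space 𝒯)
    (hw : w ∈ D.space 𝒯) (hv' : v' ∈ D.space 𝒯') (hw' : w' ∈ D.space 𝒯')
    (h𝒰 : ∀ T ∈ 𝒰, T ∈ 𝒯' ∧ T ∈ 𝒯) :
    |√(D.combSq 𝒯' 𝒰 v' w') - √(D.combSq 𝒯 𝒰 v w)|
      ≤ (Cstab + Clip) * (energyNorm κ (v' - v) + energyNorm κ (w' - w)) := by
  have hη := hA.abs_etaOn_sub_le S h h' hv hv' h𝒰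
  have hζ := hA.abs_zetaOn_sub_le h h' hw hw' v v' h𝒰
  have hlip := mul_nonneg hl (energyNorm_nonneg κ (w' - w))
  exact (abs_sqrt_sub_sqrt_le _ _ _ _).trans (by linarith)

theorem etaOn_refined_sq_le (hA : D.Axioms κ K Cstab Clip qred Crel Cdrel) (S : Setting κ K)
    (hM : D.MeshAssumptions Cmesh) (h : D.IsMesh 𝒯) (h' : D.Refinement 𝒯 𝒯')
    (hv : v ∈ D.space 𝒯) :
    D.etaOn 𝒯' 𝒯' v ^ 2 ≤ D.etaOn 𝒯 𝒯 v ^ 2 - (1 - qred ^ 2) * D.etaOn 𝒯 (𝒯 \ 𝒯') v ^ 2 := by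
  have hstab := hA.abs_etaOn_sub_le S h h' hv (hM.space_mono h h' hv) (𝒰 := 𝒯' ∩ 𝒯) (by simp)
  rw [sub_self v, S.energyNorm_zero, mul_zero, abs_nonpos_iff, sub_eq_zero] at hstab
  simp only [etaOn_sq]
  exact sum_sq_le_of_reduction hstab (hA.reduction_eta 𝒯 𝒯' h h' v hv)

theorem zetaOn_refined_sq_le (hA : D.Axioms κ K Cstab Clip qred Crel Cdrel) (S : Setting κ K)
    (hM : D.MeshAssumptions Cmesh) (h : D.IsMesh 𝒯) (h' : D.Refinement 𝒯 𝒯') (w : H10 Ω)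
    (hv : v ∈ D.space 𝒯) :
    D.zetaOn 𝒯' w 𝒯' v ^ 2
      ≤ D.zetaOn 𝒯 w 𝒯 v ^ 2 - (1 - qred ^ 2) * D.zetaOn 𝒯 w (𝒯 \ 𝒯') v ^ 2 := by
  have hstab := hA.abs_zetaOn_sub_le h h' hv (hM.space_mono h h' hv) w w (𝒰 := 𝒯' ∩ 𝒯) (by simp)
  rw [sub_self v, sub_self w, S.energyNorm_zero, mul_zero, mul_zero, add_zero, abs_nonpos_iff,
    sub_eq_zero] at hstab
  simp only [zetaOn_sq]
  exact sum_sq_le_of_reduction hstab (hA.reduction_zeta 𝒯 𝒯' h h' v hv w)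

theorem sqrt_est_refined_le (hA : D.Axioms κ K Cstab Clip qred Crel Cdrel) (S : Setting κ K)
    (hs : 0 ≤ Cstab) (hl : 0 ≤ Clip) (hM : D.MeshAssumptions Cmesh) (h : D.IsMesh 𝒯)
    (h' : D.Refinement 𝒯 𝒯') :
    √(D.est κ K 𝒯') ≤ √(D.est κ K 𝒯 - (1 - qred ^ 2) * D.estOn κ K 𝒯 (𝒯 \ 𝒯'))
      + 2 * (Cstab + Clip) * S.CE * √(D.distSq κ K 𝒯 𝒯') := by
  have hmono := hM.space_mono h h'
  have stability := (abs_le.mp (hA.abs_sqrt_combSq_sub_le S hl (h.refinement h')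
    (Refinement.refl 𝒯') (hmono (S.solH_mem D 𝒯)) (hmono (S.dualLinH_mem D 𝒯)) (S.solH_mem D 𝒯')
    (S.dualLinH_mem D 𝒯') (𝒰 := 𝒯') (by simp))).2
  have reduction : √(D.combSq 𝒯' 𝒯' (D.solH κ 𝒯) (D.dualLinH κ K 𝒯))
      ≤ √(D.est κ K 𝒯 - (1 - qred ^ 2) * D.estOn κ K 𝒯 (𝒯 \ 𝒯')) := by
    have hη := hA.etaOn_refined_sq_le S hM h h' (S.solH_mem D 𝒯)
    have hζ := hA.zetaOn_refined_sq_le S hM h h' (D.solH κ 𝒯) (S.dualLinH_mem D 𝒯)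
    simp only [est, estOn, combSq]
    exact Real.sqrt_le_sqrt (by linarith)
  have energy_le : energyNorm κ (D.solH κ 𝒯' - D.solH κ 𝒯)
      + energyNorm κ (D.dualLinH κ K 𝒯' - D.dualLinH κ K 𝒯)
      ≤ 2 * S.CE * √(D.distSq κ K 𝒯 𝒯') := by
    have hu := (S.energy_le (D.solH κ 𝒯' - D.solH κ 𝒯)).trans
      (mul_le_mul_of_nonneg_left (Real.le_sqrt_of_sq_le (y := D.distSq κ K 𝒯 𝒯')
        (le_add_of_nonneg_right (sq_nonneg _))) S.CE_pos.le)
    have hz := (S.energy_le (D.dualLinH κ K 𝒯' - D.dualLinH κ K 𝒯)).trans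
      (mul_le_mul_of_nonneg_left (Real.le_sqrt_of_sq_le (y := D.distSq κ K 𝒯 𝒯')
        (le_add_of_nonneg_left (sq_nonneg _))) S.CE_pos.le)
    linarith
  have := mul_le_mul_of_nonneg_left energy_le (add_nonneg hs hl)
  rw [est, estOn]
  linarith

theorem etaOn_le_of_refinement (hA : D.Axioms κ K Cstab Clip qred Crel Cdrel) (S : Setting κ K)
    (hs : 0 ≤ Cstab) (hq0 : 0 ≤ qred) (hq : qred < 1) (hdr : 0 ≤ Cdrel)
    (hM : D.MeshAssumptions Cmesh) (h : D.IsMesh 𝒯) (h' : D.Refinement 𝒯 𝒯') :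
    D.etaOn 𝒯' 𝒯' (D.solH κ 𝒯') ≤ (1 + Cstab * Cdrel) * D.etaOn 𝒯 𝒯 (D.solH κ 𝒯) := by
  have stability := (abs_le.mp (hA.abs_etaOn_sub_le S (h.refinement h') (Refinement.refl 𝒯')
    (hM.space_mono h h' (S.solH_mem D 𝒯)) (S.solH_mem D 𝒯') (𝒰 := 𝒯') (by simp))).2
  have reduction : D.etaOn 𝒯' 𝒯' (D.solH κ 𝒯) ≤ D.etaOn 𝒯 𝒯 (D.solH κ 𝒯) := by
    refine le_of_sq_le_sq ((hA.etaOn_refined_sq_le S hM h h' (S.solH_mem D 𝒯)).trans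
      (sub_le_self _ (mul_nonneg (by nlinarith) (sq_nonneg _)))) (etaOn_nonneg _ _ _)
  have reliability := mul_le_mul_of_nonneg_left ((hA.discrete_reliability_eta 𝒯 𝒯' h h').trans
    (mul_le_mul_of_nonneg_left (etaOn_mono Finset.sdiff_subset _ _) hdr)) hs
  linarith

theorem zetaOn_le_of_refinement (hA : D.Axioms κ K Cstab Clip qred Crel Cdrel) (S : Setting κ K)
    (hs : 0 ≤ Cstab) (hq0 : 0 ≤ qred) (hq : qred < 1) (hdr : 0 ≤ Cdrel)
    (hM : D.MeshAssumptions Cmesh) (h : D.IsMesh 𝒯) (h' : D.Refinement 𝒯 𝒯') (w : H10 Ω) :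
    D.zetaOn 𝒯' w 𝒯' (D.dualH κ K 𝒯' w)
      ≤ (1 + Cstab * Cdrel) * D.zetaOn 𝒯 w 𝒯 (D.dualH κ K 𝒯 w) := by
  have stability := (abs_le.mp (hA.abs_zetaOn_sub_le (h.refinement h') (Refinement.refl 𝒯')
    (hM.space_mono h h' (S.dualH_mem D 𝒯 w)) (S.dualH_mem D 𝒯' w) w w (𝒰 := 𝒯') (by simp))).2
  rw [sub_self w, S.energyNorm_zero, mul_zero, add_zero] at stability
  have reduction : D.zetaOn 𝒯' w 𝒯' (D.dualH κ K 𝒯 w) ≤ D.zetaOn 𝒯 w 𝒯 (D.dualH κ K 𝒯 w) := by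
    refine le_of_sq_le_sq ((hA.zetaOn_refined_sq_le S hM h h' w (S.dualH_mem D 𝒯 w)).trans
      (sub_le_self _ (mul_nonneg (by nlinarith) (sq_nonneg _)))) (zetaOn_nonneg _ _ _ _)
  have reliability := mul_le_mul_of_nonneg_left ((hA.discrete_reliability_zeta 𝒯 𝒯' h h' w).trans
    (mul_le_mul_of_nonneg_left (zetaOn_mono Finset.sdiff_subset _ _ _) hdr)) hs
  linarith

theorem zetaOn_dualLinH_le (hA : D.Axioms κ K Cstab Clip qred Crel Cdrel) (S : Setting κ K)
    (hs : 0 ≤ Cstab) (hl : 0 ≤ Clip) (h : D.IsMesh 𝒯) (w : H10 Ω) :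
    D.zetaOn 𝒯 (D.solH κ 𝒯) 𝒯 (D.dualLinH κ K 𝒯) ≤ D.zetaOn 𝒯 w 𝒯 (D.dualH κ K 𝒯 w)
      + (Cstab * (S.CE * (S.MG / S.α)) + Clip * S.CE) * ‖D.solH κ 𝒯 - w‖ := by
  have stability := (abs_le.mp (hA.abs_zetaOn_sub_le h (Refinement.refl 𝒯) (S.dualH_mem D 𝒯 w)
    (S.dualLinH_mem D 𝒯) w (D.solH κ 𝒯) (𝒰 := 𝒯) (by simp))).2
  have hz := mul_le_mul_of_nonneg_left ((S.energy_le (D.dualLinH κ K 𝒯 - D.dualH κ K 𝒯 w)).trans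
    (mul_le_mul_of_nonneg_left (S.norm_dualH_sub_le D 𝒯 _ _) S.CE_pos.le)) hs
  have hw := mul_le_mul_of_nonneg_left (S.energy_le (D.solH κ 𝒯 - w)) hl
  linarith

theorem norm_sol_sub_solH_le (hA : D.Axioms κ K Cstab Clip qred Crel Cdrel) (S : Setting κ K)
    (h : D.IsMesh 𝒯) :
    ‖D.sol κ - D.solH κ 𝒯‖ ≤ S.CE * Crel * D.etaOn 𝒯 𝒯 (D.solH κ 𝒯) := by
  rw [mul_assoc]
  exact (S.le_energy _).trans (mul_le_mul_of_nonneg_left (hA.reliability_eta 𝒯 h) S.CE_pos.le)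

theorem norm_dualSol_sub_dualH_le (hA : D.Axioms κ K Cstab Clip qred Crel Cdrel)
    (S : Setting κ K) (h : D.IsMesh 𝒯) (w : H10 Ω) :
    ‖dualSol κ K w - D.dualH κ K 𝒯 w‖
      ≤ S.CE * Crel * D.zetaOn 𝒯 w 𝒯 (D.dualH κ K 𝒯 w) := by
  rw [mul_assoc]
  exact (S.le_energy _).trans (mul_le_mul_of_nonneg_left (hA.reliability_zeta 𝒯 h w) S.CE_pos.le)

end Axioms

end Data

namespace Setting

theorem exists_reliability (S : Setting κ K) (hr : 0 < Crel) : ∃ C : ℝ, 0 < C ∧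
    ∀ (D : Data Ω) (Cstab Clip qred Cdrel : ℝ), D.Axioms κ K Cstab Clip qred Crel Cdrel →
      ∀ 𝒯, D.IsMesh 𝒯 → D.errSq κ K 𝒯 ≤ C * D.est κ K 𝒯 := by
  have hα := S.elliptic.coercivity_pos
  have hG := S.MG_pos
  have hCE := S.CE_pos
  refine ⟨(S.CE * Crel) ^ 2 * (1 + (S.MG / S.α + 1) ^ 2), by positivity,
    fun D Cstab Clip qred Cdrel hA 𝒯 h => ?_⟩
  set e := √(D.est κ K 𝒯) with he
  have primal : ‖D.sol κ - D.solH κ 𝒯‖ ≤ S.CE * Crel * e :=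
    (hA.norm_sol_sub_solH_le S h).trans (by gcongr; exact Data.etaOn_le_sqrt_estOn 𝒯 𝒯)
  have dual : ‖dualSol κ K (D.sol κ) - D.dualLinH κ K 𝒯‖
      ≤ (S.MG / S.α + 1) * (S.CE * Crel * e) := calc
    _ ≤ ‖dualSol κ K (D.sol κ) - dualSol κ K (D.solH κ 𝒯)‖
        + ‖dualSol κ K (D.solH κ 𝒯) - D.dualLinH κ K 𝒯‖ := norm_sub_le_norm_sub_add_norm_sub ..
    _ ≤ S.MG / S.α * (S.CE * Crel * e) + S.CE * Crel * e := by
      refine add_le_add ((S.norm_dualSol_sub_le _ _).trans (by gcongr)) ?_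
      exact (hA.norm_dualSol_sub_dualH_le S h _).trans
        (by gcongr; exact Data.zetaOn_le_sqrt_estOn 𝒯 𝒯)
    _ = _ := by ring
  calc D.errSq κ K 𝒯 ≤ (S.CE * Crel * e) ^ 2 + ((S.MG / S.α + 1) * (S.CE * Crel * e)) ^ 2 :=
        add_le_add (pow_le_pow_left₀ (norm_nonneg _) primal 2)
          (pow_le_pow_left₀ (norm_nonneg _) dual 2)
    _ = (S.CE * Crel) ^ 2 * (1 + (S.MG / S.α + 1) ^ 2) * e ^ 2 := by ring
    _ = _ := by rw [he, Real.sq_sqrt (Data.est_nonneg _)]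

theorem exists_quasi_monotone (S : Setting κ K) (hs : 0 ≤ Cstab) (hl : 0 ≤ Clip)
    (hq0 : 0 ≤ qred) (hq : qred < 1) (hr : 0 < Crel) : ∃ C : ℝ, 0 < C ∧
    ∀ (D : Data Ω) (Cdrel Cmesh : ℝ), D.Axioms κ K Cstab Clip qred Crel Cdrel →
      D.MeshAssumptions Cmesh → ∀ 𝒯 𝒯', D.IsMesh 𝒯 → D.Refinement 𝒯 𝒯' →
        √(D.est κ K 𝒯') ≤ C * √(D.est κ K 𝒯) := by
  obtain ⟨C₁, hC₁, reliability⟩ := S.exists_reliability hr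
  obtain ⟨C₂, hC₂, distSq_le⟩ := S.exists_distSq_le
  have hCE := S.CE_pos
  refine ⟨1 + 2 * (Cstab + Clip) * S.CE * √(C₂ * C₁), by positivity,
    fun D Cdrel Cmesh hA hM 𝒯 𝒯' h h' => ?_⟩
  have dist_le : √(D.distSq κ K 𝒯 𝒯') ≤ √(C₂ * C₁) * √(D.est κ K 𝒯) := by
    rw [← Real.sqrt_mul (by positivity), mul_assoc]
    exact Real.sqrt_le_sqrt ((distSq_le D 𝒯 𝒯' (hM.space_mono h h')).trans
      (mul_le_mul_of_nonneg_left (reliability D _ _ _ _ hA 𝒯 h) hC₂.le))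
  calc √(D.est κ K 𝒯')
      ≤ √(D.est κ K 𝒯 - (1 - qred ^ 2) * D.estOn κ K 𝒯 (𝒯 \ 𝒯'))
        + 2 * (Cstab + Clip) * S.CE * √(D.distSq κ K 𝒯 𝒯') :=
      hA.sqrt_est_refined_le S hs hl hM h h'
    _ ≤ √(D.est κ K 𝒯) + 2 * (Cstab + Clip) * S.CE * (√(C₂ * C₁) * √(D.est κ K 𝒯)) := by
      gcongr
      exact sub_le_self _ (mul_nonneg (by nlinarith) (Data.combSq_nonneg _ _ _ _))
    _ = _ := by ring

end Setting

theorem Data.Axioms.est_succ_le {D : Data Ω} {𝒯 : ℕ → Mesh d} {ℳ : ℕ → Finset (Element d)}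
    (hA : D.Axioms κ K Cstab Clip qred Crel Cdrel) (S : Setting κ K) (hs : 0 ≤ Cstab)
    (hl : 0 ≤ Clip) (hq0 : 0 ≤ qred) (hq : qred < 1) (hθ : 0 < θ) (hθ1 : θ ≤ 1)
    (hM : D.MeshAssumptions Cmesh) (hrun : D.IsRun κ K θ Cmark 𝒯 ℳ) (k : ℕ) :
    D.est κ K (𝒯 (k + 1)) ≤ √(1 - (1 - qred ^ 2) * θ) * D.est κ K (𝒯 k)
      + (2 * (Cstab + Clip) * S.CE) ^ 2 / (1 - √(1 - (1 - qred ^ 2) * θ))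
        * D.distSq κ K (𝒯 k) (𝒯 (k + 1)) := by
  have hq2 : 0 < 1 - qred ^ 2 := by nlinarith
  have hfac0 : 0 ≤ 1 - (1 - qred ^ 2) * θ := by nlinarith [sq_nonneg qred]
  have hfac1 : √(1 - (1 - qred ^ 2) * θ) < 1 := by
    rw [Real.sqrt_lt' one_pos]
    nlinarith
  have marked_subset : ℳ k ⊆ 𝒯 k \ 𝒯 (k + 1) := by
    rw [hrun.step k]
    exact hM.marked _ (hrun.isMesh k) _ (hrun.subset k)
  have doerfler : θ * D.est κ K (𝒯 k) ≤ D.estOn κ K (𝒯 k) (𝒯 k \ 𝒯 (k + 1)) :=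
    (hrun.doerfler k).trans (Data.combSq_mono marked_subset _ _ _)
  have perturbed : √(D.est κ K (𝒯 (k + 1))) ≤ √(1 - (1 - qred ^ 2) * θ) * √(D.est κ K (𝒯 k))
      + 2 * (Cstab + Clip) * S.CE * √(D.distSq κ K (𝒯 k) (𝒯 (k + 1))) := by
    refine (hA.sqrt_est_refined_le S hs hl hM (hrun.isMesh k)
      (hrun.refinement (Nat.le_succ k))).trans (add_le_add_left ?_ _)
    rw [← Real.sqrt_mul hfac0]
    exact Real.sqrt_le_sqrt (by linarith [mul_le_mul_of_nonneg_left doerfler hq2.le])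
  have squared := (pow_le_pow_left₀ (Real.sqrt_nonneg _) perturbed 2).trans
    (add_sq_le_of_lt_one (Real.sqrt_nonneg _) hfac1 _ _)
  rw [mul_pow, Real.sq_sqrt (Data.est_nonneg _), Real.sq_sqrt (Data.est_nonneg _),
    Real.sq_sqrt (x := D.distSq κ K _ _) (add_nonneg (sq_nonneg _) (sq_nonneg _))] at squared
  rwa [div_mul_eq_mul_div]

namespace Setting

theorem exists_linear_convergence (S : Setting κ K) (hθ : 0 < θ) (hθ1 : θ ≤ 1)
    (hs : 0 ≤ Cstab) (hl : 0 ≤ Clip) (hq0 : 0 ≤ qred) (hq : qred < 1) (hr : 0 < Crel) :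
    ∃ Clin qlin : ℝ, 0 < Clin ∧ 0 < qlin ∧ qlin < 1 ∧
      ∀ (D : Data Ω) (Cmesh Cdrel Cmark : ℝ), D.MeshAssumptions Cmesh →
        D.Axioms κ K Cstab Clip qred Crel Cdrel → ∀ 𝒯 ℳ, D.IsRun κ K θ Cmark 𝒯 ℳ →
          ∀ ℓ n : ℕ, ℓ ≤ n → D.est κ K (𝒯 n) ≤ Clin * qlin ^ (n - ℓ) * D.est κ K (𝒯 ℓ) := by
  obtain ⟨C₁, hC₁, reliability⟩ := S.exists_reliability hr
  obtain ⟨Cm, hCm, quasi_monotone⟩ := S.exists_quasi_monotone hs hl hq0 hq hr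
  obtain ⟨Co, c, hCo, hc0, hc1, quasi_orthogonality⟩ := S.exists_quasi_orthogonality
  have hfac1 : √(1 - (1 - qred ^ 2) * θ) < 1 := by
    have hq2 : 0 < 1 - qred ^ 2 := by nlinarith
    rw [Real.sqrt_lt' one_pos]
    nlinarith
  obtain ⟨C, ρ, hC, hρ0, hρ1, hlin⟩ := GOAFEM.exists_linear_convergence
    (Cr := (2 * (Cstab + Clip) * S.CE) ^ 2 / (1 - √(1 - (1 - qred ^ 2) * θ)))
    (Real.sqrt_nonneg _) hfac1 (div_nonneg (sq_nonneg _) (sub_nonneg.mpr hfac1.le))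
    (mul_nonneg hCo hC₁.le) hc0 hc1 (pow_pos hCm 2)
  refine ⟨C, ρ, hC, hρ0, hρ1, fun D Cmesh Cdrel Cmark hM hA 𝒯 ℳ hrun =>
    hlin (fun k => D.est κ K (𝒯 k)) (fun k => D.distSq κ K (𝒯 k) (𝒯 (k + 1)))
    (fun k => Data.est_nonneg _) (hA.est_succ_le S hs hl hq0 hq hθ hθ1 hM hrun) ?_ ?_⟩
  · intro ℓ n hn
    have := pow_le_pow_left₀ (Real.sqrt_nonneg _)
      (quasi_monotone D _ _ hA hM _ _ (hrun.isMesh ℓ) (hrun.refinement hn)) 2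
    rwa [mul_pow, Real.sq_sqrt (Data.est_nonneg _), Real.sq_sqrt (Data.est_nonneg _)] at this
  · intro ℓ m
    refine (quasi_orthogonality D 𝒯
      (fun i j hij => hM.space_mono (hrun.isMesh i) (hrun.refinement hij)) ℓ m).trans ?_
    have := mul_le_mul_of_nonneg_left (reliability D _ _ _ _ hA _ (hrun.isMesh ℓ))
      (mul_nonneg hCo (pow_nonneg (by linarith : 0 ≤ 1 + c) m))
    linarith

theorem exists_combinedAxioms (S : Setting κ K) (hs : 0 < Cstab) (hl : 0 ≤ Clip)
    (hdr : 0 < Cdrel) : ∃ Cs Cd : ℝ, 0 < Cs ∧ 0 < Cd ∧ ∀ (D : Data Ω) (qred Crel : ℝ),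
      D.Axioms κ K Cstab Clip qred Crel Cdrel → D.CombinedAxioms κ K Cs Cd := by
  have hα := S.elliptic.coercivity_pos
  have hG := S.MG_pos
  have hCE := S.CE_pos
  refine ⟨Cstab + Clip, Cdrel + S.CE * (S.MG / S.α * (S.CE * Cdrel) + S.CE * Cdrel),
    by positivity, by positivity, fun D qred Crel hA => ⟨?_, fun 𝒯 𝒯' h h' => ?_⟩⟩
  · intro 𝒯 𝒯' h h' vh hvh wh hwh vH hvH wH hwH 𝒰 h𝒰
    exact hA.abs_sqrt_combSq_sub_le S hl h h' hvH hwH hvh hwh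
      fun T hT => Finset.mem_inter.mp (h𝒰 hT)
  · set r := √(D.estOn κ K 𝒯 (𝒯 \ 𝒯'))
    have primal : energyNorm κ (D.solH κ 𝒯' - D.solH κ 𝒯) ≤ Cdrel * r :=
      (hA.discrete_reliability_eta 𝒯 𝒯' h h').trans
        (by gcongr; exact Data.etaOn_le_sqrt_estOn _ _)
    have dual : energyNorm κ (D.dualH κ K 𝒯' (D.solH κ 𝒯) - D.dualLinH κ K 𝒯) ≤ Cdrel * r :=
      (hA.discrete_reliability_zeta 𝒯 𝒯' h h' (D.solH κ 𝒯)).trans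
        (by gcongr; exact Data.zetaOn_le_sqrt_estOn _ _)
    have dualLin : ‖D.dualLinH κ K 𝒯' - D.dualLinH κ K 𝒯‖
        ≤ S.MG / S.α * (S.CE * (Cdrel * r)) + S.CE * (Cdrel * r) :=
      (norm_sub_le_norm_sub_add_norm_sub _ (D.dualH κ K 𝒯' (D.solH κ 𝒯)) _).trans <| add_le_add
        ((S.norm_dualH_sub_le D 𝒯' _ _).trans (by gcongr; exact (S.le_energy _).trans (by gcongr)))
        ((S.le_energy _).trans (by gcongr))
    have := (S.energy_le _).trans (mul_le_mul_of_nonneg_left dualLin hCE.le)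
    linarith

theorem exists_comparison (S : Setting κ K) (hs : 0 ≤ Cstab) (hl : 0 ≤ Clip)
    (hq0 : 0 ≤ qred) (hq : qred < 1) (hr : 0 ≤ Crel) (hdr : 0 ≤ Cdrel) : ∃ C : ℝ, 0 < C ∧
    ∀ (D : Data Ω) (Cmesh : ℝ), D.Axioms κ K Cstab Clip qred Crel Cdrel →
      D.MeshAssumptions Cmesh → ∀ 𝒯₁ 𝒯₂ 𝒯, D.IsMesh 𝒯₁ → D.IsMesh 𝒯₂ → D.Refinement 𝒯₁ 𝒯 →
        D.Refinement 𝒯₂ 𝒯 → √(D.est κ K 𝒯) ≤ C * (D.etaOn 𝒯₁ 𝒯₁ (D.solH κ 𝒯₁)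
          + D.zetaOn 𝒯₂ (D.sol κ) 𝒯₂ (D.dualH κ K 𝒯₂ (D.sol κ))) := by
  have hα := S.elliptic.coercivity_pos
  have hG := S.MG_pos
  have hCE := S.CE_pos
  set P := 1 + Cstab * Cdrel
  set Q := (Cstab * (S.CE * (S.MG / S.α)) + Clip * S.CE) * (S.CE * Crel) with hQ
  have hP : 0 < P := by positivity
  have hQ0 : 0 ≤ Q := by positivity
  refine ⟨P * (1 + Q), by positivity, fun D Cmesh hA hM 𝒯₁ 𝒯₂ 𝒯 h₁ h₂ h₁' h₂' => ?_⟩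
  set ζ₂ := D.zetaOn 𝒯₂ (D.sol κ) 𝒯₂ (D.dualH κ K 𝒯₂ (D.sol κ))
  have hζ : D.zetaOn 𝒯 (D.sol κ) 𝒯 (D.dualH κ K 𝒯 (D.sol κ)) ≤ P * ζ₂ :=
    hA.zetaOn_le_of_refinement S hs hq0 hq hdr hM h₂ h₂' (D.sol κ)
  have hη := hA.etaOn_le_of_refinement S hs hq0 hq hdr hM h₁ h₁'
  have herr : ‖D.solH κ 𝒯 - D.sol κ‖ ≤ S.CE * Crel * D.etaOn 𝒯 𝒯 (D.solH κ 𝒯) := by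
    rw [norm_sub_rev]
    exact hA.norm_sol_sub_solH_le S (h₁.refinement h₁')
  calc √(D.est κ K 𝒯)
      ≤ D.etaOn 𝒯 𝒯 (D.solH κ 𝒯) + D.zetaOn 𝒯 (D.solH κ 𝒯) 𝒯 (D.dualLinH κ K 𝒯) :=
      Data.sqrt_combSq_le_add _ _ _ _
    _ ≤ D.etaOn 𝒯 𝒯 (D.solH κ 𝒯) + (P * ζ₂ + (Cstab * (S.CE * (S.MG / S.α)) + Clip * S.CE)
        * (S.CE * Crel * D.etaOn 𝒯 𝒯 (D.solH κ 𝒯))) := by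
      gcongr
      exact (hA.zetaOn_dualLinH_le S hs hl (h₁.refinement h₁') (D.sol κ)).trans (by gcongr)
    _ = (1 + Q) * D.etaOn 𝒯 𝒯 (D.solH κ 𝒯) + P * ζ₂ := by rw [hQ]; ring
    _ ≤ (1 + Q) * (P * D.etaOn 𝒯₁ 𝒯₁ (D.solH κ 𝒯₁)) + (1 + Q) * (P * ζ₂) := by
      refine add_le_add (by gcongr) (le_mul_of_one_le_left ?_ (by linarith))
      exact mul_nonneg hP.le (Data.zetaOn_nonneg _ _ _ _)
    _ = _ := by ring

end Setting

end AxiomsOfAdaptivity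

/-! ### Approximation classes -/

theorem rpow_neg_floor_add_one_mul_le {x r δ : ℝ} (hx : 0 ≤ x) (hr : 0 < r) (hδ : 0 < δ) :
    ((⌊(x / δ) ^ r⁻¹⌋₊ : ℝ) + 1) ^ (-r) * x ≤ δ := by
  have hfloor : x / δ ≤ ((⌊(x / δ) ^ r⁻¹⌋₊ : ℝ) + 1) ^ r := calc
    x / δ = ((x / δ) ^ r⁻¹) ^ r := by
      rw [← Real.rpow_mul (by positivity), inv_mul_cancel₀ hr.ne', Real.rpow_one]
    _ ≤ _ := Real.rpow_le_rpow (by positivity) (Nat.lt_floor_add_one _).le hr.le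
  rw [Real.rpow_neg (by positivity), inv_mul_le_iff₀ (by positivity)]
  exact (div_le_iff₀ hδ).mp hfloor

/-- The quantity `sup_N (N+1)^s inf_{x ∈ F N} f x` measuring the decay of the best values of `f` on
the classes `F N`; `Data.approxPrimal` and `Data.approxDual` are instances by definition. -/
def approxNorm {ι : Type*} (F : ℕ → Set ι) (f : ι → ℝ) (s : ℝ) : ℝ≥0∞ :=
  ⨆ N : ℕ, ((N : ℝ≥0∞) + 1) ^ s * ⨅ x ∈ F N, ENNReal.ofReal (f x)

theorem exists_mem_le_approxNorm {ι : Type*} {F : ℕ → Set ι} {f : ι → ℝ} {r s : ℝ}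
    (hA : approxNorm F f s ≠ ⊤) (hrs : r ≤ s) (N : ℕ) {ε : ℝ} (hε : 0 < ε) :
    ∃ x ∈ F N, f x ≤ ((N : ℝ) + 1) ^ (-r) * (approxNorm F f s).toReal + ε := by
  have hbase : ((N : ℝ≥0∞) + 1) = ENNReal.ofReal ((N : ℝ) + 1) := by
    rw [ENNReal.ofReal_add (by positivity) zero_le_one, ENNReal.ofReal_natCast, ENNReal.ofReal_one]
  have hpos : 0 < ((N : ℝ) + 1) ^ s := by positivity
  have hNth : ENNReal.ofReal (((N : ℝ) + 1) ^ s) * ⨅ x ∈ F N, ENNReal.ofReal (f x)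
      ≤ ENNReal.ofReal (approxNorm F f s).toReal := by
    rw [ENNReal.ofReal_toReal hA, ← ENNReal.ofReal_rpow_of_pos (by positivity), ← hbase]
    exact le_iSup (fun N : ℕ => ((N : ℝ≥0∞) + 1) ^ s * ⨅ x ∈ F N, ENNReal.ofReal (f x)) N
  have hinf : ⨅ x ∈ F N, ENNReal.ofReal (f x)
      ≤ ENNReal.ofReal (((N : ℝ) + 1) ^ (-s) * (approxNorm F f s).toReal) := by
    rw [Real.rpow_neg (by positivity), ENNReal.ofReal_mul (by positivity),
      ENNReal.ofReal_inv_of_pos hpos, mul_comm, ← div_eq_mul_inv,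
      ENNReal.le_div_iff_mul_le (Or.inl (by simpa using hpos)) (Or.inl ENNReal.ofReal_ne_top),
      mul_comm]
    exact hNth
  have hbound : 0 < ((N : ℝ) + 1) ^ (-s) * (approxNorm F f s).toReal + ε := by positivity
  obtain ⟨x, hx⟩ := iInf_lt_iff.mp <| hinf.trans_lt <|
    (ENNReal.ofReal_lt_ofReal_iff hbound).mpr (lt_add_of_pos_right _ hε)
  obtain ⟨hmem, hlt⟩ := iInf_lt_iff.mp hx
  refine ⟨x, hmem, ((ENNReal.ofReal_lt_ofReal_iff hbound).mp hlt).le.trans ?_⟩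
  gcongr
  linarith [(Nat.cast_nonneg N : (0 : ℝ) ≤ N)]

section ApproximationClasses

variable {d : ℕ} {Ω : Set (Pt d)} {κ : Coeff d} {K : GoalOp Ω}
variable {Cmesh Cstab Clip qred Crel Cdrel θ Cmark s t : ℝ}

namespace Data

variable {D : Data Ω} {𝒯 : Mesh d}

/-- The real number `‖u‖_{𝔸_s} + ‖z[u]‖_{𝔸_t}`, with the junk value `0` for infinite summands. -/
def approxSum (D : Data Ω) (κ : Coeff d) (K : GoalOp Ω) (s t : ℝ) : ℝ :=
  (D.approxPrimal κ s).toReal + (D.approxDual κ K t).toReal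

theorem approxSum_nonneg : 0 ≤ D.approxSum κ K s t :=
  add_nonneg ENNReal.toReal_nonneg ENNReal.toReal_nonneg

theorem MeshAssumptions.eq_mesh₀ (hM : D.MeshAssumptions Cmesh) (h : 𝒯 ∈ D.meshesUpTo 0) :
    𝒯 = D.mesh₀ := by
  have hsons := hM.sons _ _ isMesh_mesh₀ h.1
  have hcard := h.2
  have hsub : (D.mesh₀ \ 𝒯).card = 0 := by omega
  rw [Finset.card_eq_zero, Finset.sdiff_eq_empty_iff_subset] at hsub
  exact (Finset.eq_of_subset_of_card_le hsub (by omega)).symm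

theorem MeshAssumptions.le_approxNorm (hM : D.MeshAssumptions Cmesh) {f : Mesh d → ℝ}
    (hA : approxNorm D.meshesUpTo f s ≠ ⊤) :
    f D.mesh₀ ≤ (approxNorm D.meshesUpTo f s).toReal := by
  refine le_of_forall_pos_le_add fun ε hε => ?_
  obtain ⟨𝒯, hmem, hle⟩ := exists_mem_le_approxNorm hA le_rfl 0 hε
  rw [hM.eq_mesh₀ hmem] at hle
  simpa using hle

theorem RateBound.of_est_eq_zero {C : ℝ} (h : D.est κ K 𝒯 = 0) : D.RateBound κ K s t C 𝒯 := by
  rw [RateBound, h, ENNReal.ofReal_zero]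
  exact zero_le

theorem RateBound.of_approxSum {C : ℝ} (hC : 0 < C) (hs : 0 < s) (ht : 0 < t)
    (hfin : D.approxPrimal κ s + D.approxDual κ K t < ⊤) (hpos : 0 < D.approxSum κ K s t)
    (h : 0 < 𝒯.card - D.mesh₀.card → D.est κ K 𝒯 ≤ C * D.approxSum κ K s t ^ 2 *
      ((𝒯.card - D.mesh₀.card : ℕ) : ℝ) ^ (-min (2 * s) (2 * t))) :
    D.RateBound κ K s t (2 * C) 𝒯 := by
  obtain ⟨hu, hz⟩ := ENNReal.add_ne_top.mp hfin.ne
  set Su := (D.approxPrimal κ s).toReal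
  set Sz := (D.approxDual κ K t).toReal
  have hsq : C * D.approxSum κ K s t ^ 2 ≤ 2 * C * (Su ^ 2 + Sz ^ 2) := by
    rw [mul_comm 2 C, mul_assoc]
    exact mul_le_mul_of_nonneg_left add_sq_le hC.le
  have hfactor : ENNReal.ofReal (2 * C) * (D.approxPrimal κ s ^ 2 + D.approxDual κ K t ^ 2)
      = ENNReal.ofReal (2 * C * (Su ^ 2 + Sz ^ 2)) := by
    rw [ENNReal.ofReal_mul (p := 2 * C) (by positivity),
      ENNReal.ofReal_add (by positivity) (by positivity), ENNReal.ofReal_pow ENNReal.toReal_nonneg,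
      ENNReal.ofReal_pow ENNReal.toReal_nonneg, ENNReal.ofReal_toReal hu,
      ENNReal.ofReal_toReal hz]
  rw [RateBound, hfactor]
  rcases Nat.eq_zero_or_pos (𝒯.card - D.mesh₀.card) with h0 | hn
  · have hβ : 0 < min (2 * s) (2 * t) := lt_min (by positivity) (by positivity)
    have hfactor_pos : 0 < 2 * C * (Su ^ 2 + Sz ^ 2) := lt_of_lt_of_le (by positivity) hsq
    rw [h0, Nat.cast_zero, ENNReal.zero_rpow_of_neg (by linarith),
      ENNReal.mul_top (by simpa using hfactor_pos)]
    exact le_top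
  · rw [← ENNReal.ofReal_natCast, ENNReal.ofReal_rpow_of_pos (Nat.cast_pos.mpr hn),
      ← ENNReal.ofReal_mul (by positivity)]
    refine ENNReal.ofReal_le_ofReal ((h hn).trans ?_)
    gcongr

end Data

namespace Setting

theorem exists_sqrt_est_le_approxSum (S : Setting κ K) (hs : 0 ≤ Cstab) (hl : 0 ≤ Clip)
    (hq0 : 0 ≤ qred) (hq : qred < 1) (hr : 0 ≤ Crel) (hdr : 0 ≤ Cdrel) :
    ∃ C : ℝ, 0 < C ∧ ∀ (D : Data Ω) (Cmesh s t : ℝ), D.MeshAssumptions Cmesh →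
      D.Axioms κ K Cstab Clip qred Crel Cdrel → D.approxPrimal κ s + D.approxDual κ K t < ⊤ →
      ∀ 𝒯, D.IsMesh 𝒯 → √(D.est κ K 𝒯) ≤ C * D.approxSum κ K s t := by
  obtain ⟨C, hC, comparison⟩ := S.exists_comparison hs hl hq0 hq hr hdr
  refine ⟨C, hC, fun D Cmesh s t hM hA hfin 𝒯 h => ?_⟩
  obtain ⟨hu, hz⟩ := ENNReal.add_ne_top.mp hfin.ne
  exact (comparison D Cmesh hA hM _ _ 𝒯 Data.isMesh_mesh₀ Data.isMesh_mesh₀ h h).trans <|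
    mul_le_mul_of_nonneg_left (add_le_add (hM.le_approxNorm hu) (hM.le_approxNorm hz)) hC.le

theorem exists_refinement_card_le (S : Setting κ K) (hs : 0 ≤ Cstab) (hl : 0 ≤ Clip)
    (hq0 : 0 ≤ qred) (hq : qred < 1) (hr : 0 ≤ Crel) (hdr : 0 ≤ Cdrel) :
    ∃ C : ℝ, 0 < C ∧ ∀ (D : Data Ω) (Cmesh s t : ℝ), D.MeshAssumptions Cmesh →
      D.Axioms κ K Cstab Clip qred Crel Cdrel → 0 < s → 0 < t →
      D.approxPrimal κ s + D.approxDual κ K t < ⊤ → ∀ 𝒯, D.IsMesh 𝒯 → ∀ δ : ℝ, 0 < δ →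
        ∃ 𝒯', D.Refinement 𝒯 𝒯' ∧ √(D.est κ K 𝒯') ≤ δ ∧
          ((𝒯 \ 𝒯').card : ℝ) ≤ 2 * (C * D.approxSum κ K s t / δ) ^ (min s t)⁻¹ := by
  obtain ⟨C, hC, comparison⟩ := S.exists_comparison hs hl hq0 hq hr hdr
  refine ⟨2 * C, by positivity, fun D Cmesh s t hM hA hs ht hfin 𝒯 hT δ hδ => ?_⟩
  obtain ⟨hu, hz⟩ := ENNReal.add_ne_top.mp hfin.ne
  have hsum : 0 ≤ D.approxSum κ K s t := Data.approxSum_nonneg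
  set N := ⌊(2 * C * D.approxSum κ K s t / δ) ^ (min s t)⁻¹⌋₊
  obtain ⟨𝒯₁, h₁, hη⟩ := exists_mem_le_approxNorm hu (min_le_left s t) N
    (by positivity : 0 < δ / (4 * C))
  obtain ⟨𝒯₂, h₂, hζ⟩ := exists_mem_le_approxNorm hz (min_le_right s t) N
    (by positivity : 0 < δ / (4 * C))
  obtain ⟨𝒯₃, h₁₃, h₂₃, hcard₃⟩ := hM.overlay 𝒯₁ 𝒯₂ h₁.1 h₂.1
  obtain ⟨𝒯', hT', h₃', hcard'⟩ := hM.overlay 𝒯 𝒯₃ hT (h₁.1.refinement h₁₃)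
  refine ⟨𝒯', hT', ?_, ?_⟩
  · have hdecay : ((N : ℝ) + 1) ^ (-min s t) * (2 * C * D.approxSum κ K s t) ≤ δ :=
      rpow_neg_floor_add_one_mul_le (by positivity) (lt_min hs ht) hδ
    calc √(D.est κ K 𝒯')
        ≤ C * (D.etaOn 𝒯₁ 𝒯₁ (D.solH κ 𝒯₁)
          + D.zetaOn 𝒯₂ (D.sol κ) 𝒯₂ (D.dualH κ K 𝒯₂ (D.sol κ))) :=
        comparison D Cmesh hA hM 𝒯₁ 𝒯₂ 𝒯' h₁.1 h₂.1 (h₁₃.trans h₃') (h₂₃.trans h₃')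
      _ ≤ C * ((((N : ℝ) + 1) ^ (-min s t) * (D.approxPrimal κ s).toReal + δ / (4 * C))
          + (((N : ℝ) + 1) ^ (-min s t) * (D.approxDual κ K t).toReal + δ / (4 * C))) :=
        mul_le_mul_of_nonneg_left (add_le_add hη hζ) hC.le
      _ = ((N : ℝ) + 1) ^ (-min s t) * (2 * C * D.approxSum κ K s t) / 2 + δ / 2 := by
        rw [Data.approxSum]
        field
      _ ≤ δ := by linarith
  · have hsons := hM.sons 𝒯 𝒯' hT hT'
    have hcard₁ := h₁.2
    have hcard₂ := h₂.2
    have hle : (𝒯 \ 𝒯').card ≤ 2 * N := by omega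
    calc ((𝒯 \ 𝒯').card : ℝ) ≤ 2 * N := by exact_mod_cast hle
      _ ≤ _ := by
        gcongr
        exact Nat.floor_le (by positivity)

end Setting

end ApproximationClasses

/-! ### Optimal rates -/

theorem sum_Ico_pow_sub_le {ρ : ℝ} (h0 : 0 ≤ ρ) (h1 : ρ < 1) (k ℓ : ℕ) :
    ∑ j ∈ Finset.Ico k ℓ, ρ ^ (ℓ - j) ≤ (1 - ρ)⁻¹ := by
  rw [Finset.sum_Ico_reflect (fun i => ρ ^ i) k (Nat.le_succ ℓ), ← tsum_geometric_of_lt_one h0 h1]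
  exact (summable_geometric_of_lt_one h0 h1).sum_le_tsum _ fun _ _ => pow_nonneg h0 _

theorem sum_Ico_rpow_div_le {E : ℕ → ℝ} {ℓ : ℕ} {x C q σ : ℝ} (hx : 0 ≤ x) (hC : 0 ≤ C)
    (hq0 : 0 ≤ q) (hq1 : q < 1) (hσ : 0 < σ) (hE : ∀ j ≤ ℓ, 0 < E j)
    (hlin : ∀ j ≤ ℓ, E ℓ ≤ C * q ^ (ℓ - j) * E j) (k : ℕ) :
    ∑ j ∈ Finset.Ico k ℓ, (x / E j) ^ σ ≤ C ^ σ * (1 - q ^ σ)⁻¹ * (x / E ℓ) ^ σ := by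
  have hEℓ := hE ℓ le_rfl
  have term_le : ∀ j ∈ Finset.Ico k ℓ,
      (x / E j) ^ σ ≤ C ^ σ * (x / E ℓ) ^ σ * (q ^ σ) ^ (ℓ - j) := fun j hj => by
    have hj := (Finset.mem_Ico.mp hj).2.le
    have hdiv : x / E j ≤ C * (x / E ℓ) * q ^ (ℓ - j) := by
      rw [← mul_div_assoc, div_mul_eq_mul_div, div_le_div_iff₀ (hE j hj) hEℓ]
      linarith [mul_le_mul_of_nonneg_left (hlin j hj) hx]
    have hEj := hE j hj
    calc (x / E j) ^ σ ≤ (C * (x / E ℓ) * q ^ (ℓ - j)) ^ σ := by gcongr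
      _ = _ := by
        rw [Real.mul_rpow (by positivity) (by positivity),
          Real.mul_rpow (by positivity) (by positivity), Real.rpow_pow_comm hq0]
  calc ∑ j ∈ Finset.Ico k ℓ, (x / E j) ^ σ
      ≤ C ^ σ * (x / E ℓ) ^ σ * ∑ j ∈ Finset.Ico k ℓ, (q ^ σ) ^ (ℓ - j) := by
        rw [Finset.mul_sum]
        exact Finset.sum_le_sum term_le
    _ ≤ C ^ σ * (x / E ℓ) ^ σ * (1 - q ^ σ)⁻¹ := by
      gcongr
      exact sum_Ico_pow_sub_le (by positivity) (Real.rpow_lt_one hq0 hq1 hσ) k ℓ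
    _ = _ := by ring

theorem le_mul_rpow_neg_of_le_mul_rpow_inv {E x c n β : ℝ} (hE : 0 < E) (hx : 0 ≤ x)
    (hc : 0 ≤ c) (hn : 0 < n) (hβ : 0 < β) (h : n ≤ c * (x / E) ^ β⁻¹) :
    E ≤ c ^ β * x * n ^ (-β) := by
  have hpow := Real.rpow_le_rpow hn.le h hβ.le
  rw [Real.mul_rpow hc (by positivity), Real.rpow_inv_rpow (by positivity) hβ.ne',
    ← mul_div_assoc, le_div_iff₀ hE] at hpow
  rw [Real.rpow_neg hn.le, ← div_eq_mul_inv, le_div_iff₀ (by positivity)]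
  linarith

section OptimalRates

variable {d : ℕ} {Ω : Set (Pt d)} {κ : Coeff d} {K : GoalOp Ω}
variable {Cmesh Cstab Clip qred Crel Cdrel θ Cmark q s t : ℝ}

namespace Data

variable {D : Data Ω} {𝒯 : ℕ → Mesh d} {ℳ : ℕ → Finset (Element d)}

/-- Optimality of Dörfler marking on the mesh `𝒯`: every refinement that reduces the combined
estimator by the factor `q` refines a set of elements satisfying the marking criterion. -/
def OptimalMarking (D : Data Ω) (κ : Coeff d) (K : GoalOp Ω) (θ q : ℝ) (𝒯 : Mesh d) : Prop :=
  ∀ 𝒯', D.Refinement 𝒯 𝒯' → √(D.est κ K 𝒯') ≤ q * √(D.est κ K 𝒯) →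
    θ * D.est κ K 𝒯 ≤ D.estOn κ K 𝒯 (𝒯 \ 𝒯')

theorem IsRun.sum_card_marked_le (h : D.IsRun κ K θ Cmark 𝒯 ℳ) (hM : D.MeshAssumptions Cmesh)
    (ℓ : ℕ) : ∑ j ∈ Finset.range ℓ, (ℳ j).card ≤ (𝒯 ℓ).card - D.mesh₀.card := by
  suffices ∑ j ∈ Finset.range ℓ, (ℳ j).card + D.mesh₀.card ≤ (𝒯 ℓ).card by omega
  induction ℓ with
  | zero => simp [h.init]
  | succ ℓ ih =>
    have hsons := hM.sons (𝒯 ℓ) (𝒯 (ℓ + 1)) (h.isMesh ℓ) (h.refinement (Nat.le_succ ℓ))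
    have hmarked : ℳ ℓ ⊆ 𝒯 ℓ \ 𝒯 (ℓ + 1) := by
      rw [h.step ℓ]
      exact hM.marked _ (h.isMesh ℓ) _ (h.subset ℓ)
    have hcard := Finset.card_le_card hmarked
    rw [Finset.sum_range_succ]
    omega

theorem IsRun.card_sub_card_le (h : D.IsRun κ K θ Cmark 𝒯 ℳ) (hM : D.MeshAssumptions Cmesh)
    (hCmesh : 0 ≤ Cmesh) {ℓ₀ ℓ : ℕ} (hℓ : ℓ₀ ≤ ℓ) :
    (((𝒯 ℓ).card - D.mesh₀.card : ℕ) : ℝ) ≤ Cmesh *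
      (((𝒯 ℓ₀).card - D.mesh₀.card : ℕ) + ∑ j ∈ Finset.Ico ℓ₀ ℓ, ((ℳ j).card : ℝ)) := by
  have hclosure := hM.closure 𝒯 ℳ h.init (fun j => ⟨h.subset j, h.step j⟩) ℓ
  rw [← Nat.cast_sub (hM.card_le isMesh_mesh₀ (h.isMesh ℓ)),
    ← Finset.sum_range_add_sum_Ico _ hℓ] at hclosure
  refine hclosure.trans ?_
  gcongr
  exact_mod_cast h.sum_card_marked_le hM ℓ₀

end Data

namespace Setting

theorem exists_card_marked_le (S : Setting κ K) (hs : 0 ≤ Cstab) (hl : 0 ≤ Clip)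
    (hq0 : 0 ≤ qred) (hq : qred < 1) (hr : 0 ≤ Crel) (hdr : 0 ≤ Cdrel) (hq' : 0 < q) :
    ∃ C : ℝ, 0 < C ∧ ∀ (D : Data Ω) (Cmesh Cmark θ s t : ℝ), 0 ≤ Cmark →
      D.MeshAssumptions Cmesh → D.Axioms κ K Cstab Clip qred Crel Cdrel → 0 < s → 0 < t →
      D.approxPrimal κ s + D.approxDual κ K t < ⊤ → ∀ 𝒯 ℳ, D.IsRun κ K θ Cmark 𝒯 ℳ →
      ∀ j, 0 < D.est κ K (𝒯 j) → D.OptimalMarking κ K θ q (𝒯 j) →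
        ((ℳ j).card : ℝ) ≤ Cmark * (2 * (C * D.approxSum κ K s t ^ 2 / D.est κ K (𝒯 j)) ^
          (min (2 * s) (2 * t))⁻¹) := by
  obtain ⟨C, hC, exists_refinement⟩ := S.exists_refinement_card_le hs hl hq0 hq hr hdr
  refine ⟨(C / q) ^ 2, by positivity,
    fun D Cmesh Cmark θ s t hCmark hM hA hs ht hfin 𝒯 ℳ hrun j hE hopt => ?_⟩
  have hsum : 0 ≤ D.approxSum κ K s t := Data.approxSum_nonneg
  have : 0 < √(D.est κ K (𝒯 j)) := Real.sqrt_pos.mpr hE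
  obtain ⟨𝒯', hT', hest, hcard⟩ := exists_refinement D Cmesh s t hM hA hs ht hfin (𝒯 j)
    (hrun.isMesh j) (q * √(D.est κ K (𝒯 j))) (by positivity)
  have hpow : (C * D.approxSum κ K s t / (q * √(D.est κ K (𝒯 j)))) ^ (min s t)⁻¹
      = ((C / q) ^ 2 * D.approxSum κ K s t ^ 2 / D.est κ K (𝒯 j)) ^ (min (2 * s) (2 * t))⁻¹ := by
    nth_rewrite 2 [← Real.sq_sqrt hE.le]
    rw [← mul_min_of_nonneg s t zero_le_two, mul_inv, ← mul_pow, ← div_pow,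
      ← Real.rpow_natCast_mul (by positivity), Nat.cast_two, mul_inv_cancel_left₀ two_ne_zero]
    congr 1
    field
  rw [← hpow]
  exact (hrun.minimal j _ Finset.sdiff_subset (hopt 𝒯' hT' hest)).trans
    (mul_le_mul_of_nonneg_left hcard hCmark)

theorem exists_sum_card_marked_le (S : Setting κ K) (hθ : 0 < θ) (hθ1 : θ ≤ 1)
    (hs : 0 ≤ Cstab) (hl : 0 ≤ Clip) (hq0 : 0 ≤ qred) (hq : qred < 1) (hr : 0 < Crel)
    (hdr : 0 ≤ Cdrel) (hCmark : 0 ≤ Cmark) (hq' : 0 < q) (hs' : 0 < s) (ht' : 0 < t) :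
    ∃ C : ℝ, 0 ≤ C ∧ ∀ (D : Data Ω) (Cmesh : ℝ), D.MeshAssumptions Cmesh →
      D.Axioms κ K Cstab Clip qred Crel Cdrel → D.approxPrimal κ s + D.approxDual κ K t < ⊤ →
      ∀ 𝒯 ℳ, D.IsRun κ K θ Cmark 𝒯 ℳ → ∀ ℓ₀ : ℕ,
        (∀ j, ℓ₀ ≤ j → D.OptimalMarking κ K θ q (𝒯 j)) → ∀ ℓ, 0 < D.est κ K (𝒯 ℓ) →
          ∑ j ∈ Finset.Ico ℓ₀ ℓ, ((ℳ j).card : ℝ) ≤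
            C * (D.approxSum κ K s t ^ 2 / D.est κ K (𝒯 ℓ)) ^ (min (2 * s) (2 * t))⁻¹ := by
  obtain ⟨Clin, qlin, hClin, hql0, hql1, hlin⟩ :=
    S.exists_linear_convergence hθ hθ1 hs hl hq0 hq hr
  obtain ⟨C, hC, card_marked_le⟩ := S.exists_card_marked_le hs hl hq0 hq hr.le hdr hq'
  set σ := (min (2 * s) (2 * t))⁻¹
  have hσ : 0 < σ := inv_pos.mpr (lt_min (by positivity) (by positivity))
  have hgeom : 0 ≤ (1 - qlin ^ σ)⁻¹ :=
    inv_nonneg.mpr (sub_nonneg.mpr (Real.rpow_lt_one hql0.le hql1 hσ).le)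
  refine ⟨Cmark * 2 * C ^ σ * (Clin ^ σ * (1 - qlin ^ σ)⁻¹), by positivity,
    fun D Cmesh hM hA hfin 𝒯 ℳ hrun ℓ₀ hopt ℓ hE => ?_⟩
  set A := D.approxSum κ K s t
  have linear : ∀ j ≤ ℓ, D.est κ K (𝒯 ℓ) ≤ Clin * qlin ^ (ℓ - j) * D.est κ K (𝒯 j) :=
    fun j hj => hlin D _ _ _ hM hA 𝒯 ℳ hrun j ℓ hj
  have hpos : ∀ j ≤ ℓ, 0 < D.est κ K (𝒯 j) := fun j hj =>
    pos_of_mul_pos_right (hE.trans_le (linear j hj)) (by positivity)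
  calc ∑ j ∈ Finset.Ico ℓ₀ ℓ, ((ℳ j).card : ℝ)
      ≤ ∑ j ∈ Finset.Ico ℓ₀ ℓ, Cmark * 2 * C ^ σ * (A ^ 2 / D.est κ K (𝒯 j)) ^ σ := by
        refine Finset.sum_le_sum fun j hj => ?_
        obtain ⟨hj₀, hjℓ⟩ := Finset.mem_Ico.mp hj
        have hEj := hpos j hjℓ.le
        refine (card_marked_le D _ _ _ s t hCmark hM hA hs' ht' hfin 𝒯 ℳ hrun j hEj
          (hopt j hj₀)).trans_eq ?_
        rw [mul_div_assoc C, Real.mul_rpow hC.le (by positivity)]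
        ring
    _ ≤ Cmark * 2 * C ^ σ *
        (Clin ^ σ * (1 - qlin ^ σ)⁻¹ * (A ^ 2 / D.est κ K (𝒯 ℓ)) ^ σ) := by
      rw [← Finset.mul_sum]
      gcongr
      exact sum_Ico_rpow_div_le (E := fun j => D.est κ K (𝒯 j)) (by positivity) hClin.le hql0.le
        hql1 hσ hpos linear ℓ₀
    _ = _ := by ring

theorem exists_rate (S : Setting κ K) (hθ : 0 < θ) (hθ1 : θ ≤ 1) (hs : 0 ≤ Cstab)
    (hl : 0 ≤ Clip) (hq0 : 0 ≤ qred) (hq : qred < 1) (hr : 0 < Crel) (hdr : 0 ≤ Cdrel)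
    (hCmesh : 0 < Cmesh) (hCmark : 0 ≤ Cmark) (hq' : 0 < q) (hs' : 0 < s) (ht' : 0 < t) :
    ∃ Copt : ℝ, 0 < Copt ∧ ∀ D : Data Ω, D.MeshAssumptions Cmesh →
      D.Axioms κ K Cstab Clip qred Crel Cdrel → D.approxPrimal κ s + D.approxDual κ K t < ⊤ →
      ∀ 𝒯 ℳ, D.IsRun κ K θ Cmark 𝒯 ℳ → ∀ ℓ₀ : ℕ,
        (∀ j, ℓ₀ ≤ j → D.OptimalMarking κ K θ q (𝒯 j)) → ∀ ℓ, ℓ₀ ≤ ℓ → D.RateBound κ K s t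
          (Copt * (((𝒯 ℓ₀).card - D.mesh₀.card : ℕ) + 1 : ℝ) ^ min (2 * s) (2 * t)) (𝒯 ℓ) := by
  obtain ⟨C₁, hC₁, sum_le⟩ :=
    S.exists_sum_card_marked_le hθ hθ1 hs hl hq0 hq hr hdr hCmark hq' hs' ht'
  obtain ⟨C₂, hC₂, sqrt_est_le⟩ := S.exists_sqrt_est_le_approxSum hs hl hq0 hq hr.le hdr
  set β := min (2 * s) (2 * t)
  have hβ : 0 < β := lt_min (by positivity) (by positivity)
  set C₃ := (C₂ ^ 2) ^ β⁻¹ with hC₃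
  refine ⟨2 * (Cmesh * (C₁ + C₃)) ^ β, by positivity,
    fun D hM hA hfin 𝒯 ℳ hrun ℓ₀ hopt ℓ hℓ => ?_⟩
  rcases (Data.est_nonneg (𝒯 ℓ)).eq_or_lt with h0 | hE
  · exact Data.RateBound.of_est_eq_zero h0.symm
  set A := D.approxSum κ K s t
  set m : ℝ := (((𝒯 ℓ₀).card - D.mesh₀.card : ℕ) : ℝ)
  have hm : 0 ≤ m := Nat.cast_nonneg _
  have hest := sqrt_est_le D Cmesh s t hM hA hfin (𝒯 ℓ) (hrun.isMesh ℓ)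
  have hA0 : 0 < A := pos_of_mul_pos_right ((Real.sqrt_pos.mpr hE).trans_le hest) hC₂.le
  set X := (A ^ 2 / D.est κ K (𝒯 ℓ)) ^ β⁻¹ with hX
  have one_le : 1 ≤ C₃ * X := by
    rw [hC₃, hX, ← Real.mul_rpow (by positivity) (by positivity)]
    refine Real.one_le_rpow ?_ (by positivity)
    rw [← mul_div_assoc, one_le_div hE, ← mul_pow]
    exact Real.sqrt_le_iff.mp hest |>.2
  rw [mul_assoc, ← Real.mul_rpow (by positivity) (by positivity)]
  refine Data.RateBound.of_approxSum (by positivity) hs' ht' hfin hA0 fun hn =>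
    le_mul_rpow_neg_of_le_mul_rpow_inv hE (by positivity) (by positivity) (Nat.cast_pos.mpr hn)
      hβ ?_
  calc (((𝒯 ℓ).card - D.mesh₀.card : ℕ) : ℝ)
      ≤ Cmesh * (m + ∑ j ∈ Finset.Ico ℓ₀ ℓ, ((ℳ j).card : ℝ)) :=
        hrun.card_sub_card_le hM hCmesh.le hℓ
    _ ≤ Cmesh * (m * (C₃ * X) + C₁ * X) := by
      gcongr
      · exact le_mul_of_one_le_right hm one_le
      · exact sum_le D Cmesh hM hA hfin 𝒯 ℳ hrun ℓ₀ hopt ℓ hE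
    _ ≤ Cmesh * ((C₁ + C₃) * (m + 1) * X) := by
      gcongr
      have : 0 ≤ (C₁ * m + C₃) * X := by positivity
      linarith
    _ = _ := by ring

end Setting

end OptimalRates

/-! ### Optimality of the marking criterion -/

section RealInequalities

variable {θ : ℝ}

theorem thetaOpt_le_one (C C' : ℝ) : thetaOpt C C' ≤ 1 :=
  inv_le_one_of_one_le₀ (le_add_of_nonneg_right (by positivity))

theorem mul_sqrt_lt_of_lt_thetaOpt {C C' : ℝ} (hθ : 0 ≤ θ) (hC : 0 ≤ C) (hC' : 0 ≤ C')
    (h : θ < thetaOpt C C') : C * C' * √θ < √(1 - θ) := by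
  rw [thetaOpt, ← one_div, lt_div_iff₀ (by positivity)] at h
  rw [Real.lt_sqrt (by positivity), mul_pow, mul_pow, Real.sq_sqrt hθ]
  linarith

theorem mul_sq_le_sq_of_sq_sub_sq_le {Λ σ e r : ℝ} (hθ : 0 ≤ θ) (hθ1 : θ ≤ 1) (hΛ : 0 ≤ Λ)
    (he : 0 ≤ e) (hr : 0 ≤ r) (hσ0 : 0 ≤ σ) (hσ : σ + Λ * √θ ≤ √(1 - θ))
    (h : e ^ 2 - r ^ 2 ≤ (σ * e + Λ * r) ^ 2) : θ * e ^ 2 ≤ r ^ 2 := by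
  by_contra! hlt
  have r_le : r ≤ √θ * e := by
    refine le_of_sq_le_sq ?_ (by positivity)
    rw [mul_pow, Real.sq_sqrt hθ]
    exact hlt.le
  have : (σ * e + Λ * r) ^ 2 ≤ (1 - θ) * e ^ 2 := by
    calc (σ * e + Λ * r) ^ 2 ≤ (σ * e + Λ * (√θ * e)) ^ 2 := by gcongr
      _ = ((σ + Λ * √θ) * e) ^ 2 := by ring
      _ ≤ (√(1 - θ) * e) ^ 2 := by gcongr
      _ = (1 - θ) * e ^ 2 := by rw [mul_pow, Real.sq_sqrt (sub_nonneg.mpr hθ1)]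
  linarith

theorem sqrt_sq_add_sq_le_of_le_add {x y x' y' x₁ y₁ c l τ : ℝ} (hx : 0 ≤ x) (hy : 0 ≤ y)
    (hx₁ : 0 ≤ x₁) (hc : 0 ≤ c) (hl : 0 ≤ l) (hτ : 0 ≤ τ) (hxx' : x ≤ x' + c * x₁)
    (hyy' : y ≤ y' + c * y₁ + (l * x₁ + τ)) :
    √(x ^ 2 + y ^ 2) ≤ √(x' ^ 2 + y' ^ 2) + (c + l) * √(x₁ ^ 2 + y₁ ^ 2) + τ := by
  have triangle := norm_add₃_le (a := (⟨x', y'⟩ : ℂ)) (b := c • (⟨x₁, y₁⟩ : ℂ))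
    (c := ⟨0, l * x₁ + τ⟩)
  have norm_le : ‖(⟨x, y⟩ : ℂ)‖ ≤ ‖(⟨x', y'⟩ + c • ⟨x₁, y₁⟩ + ⟨0, l * x₁ + τ⟩ : ℂ)‖ := by
    simp only [Complex.norm_eq_sqrt_sq_add_sq, Complex.add_re, Complex.add_im, Complex.smul_re,
      Complex.smul_im, smul_eq_mul, add_zero]
    gcongr
  have norm_last : ‖(⟨0, l * x₁ + τ⟩ : ℂ)‖ = l * x₁ + τ := by
    rw [Complex.norm_eq_sqrt_sq_add_sq, zero_pow two_ne_zero, zero_add,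
      Real.sqrt_sq (by positivity)]
  have x₁_le : l * x₁ ≤ l * ‖(⟨x₁, y₁⟩ : ℂ)‖ := by
    gcongr
    exact Complex.re_le_norm ⟨x₁, y₁⟩
  rw [norm_smul, Real.norm_of_nonneg hc, norm_last] at triangle
  simp only [← Complex.norm_eq_sqrt_sq_add_sq ⟨_, _⟩]
  linarith

end RealInequalities

section OptimalMarking

variable {d : ℕ} {Ω : Set (Pt d)} {κ : Coeff d} {K : GoalOp Ω} {D : Data Ω} {𝒯 𝒯' : Mesh d}
variable {Cmesh Cstab Clip qred Crel Cdrel θ Cmark q : ℝ}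

namespace Data

theorem est_sub_estOn_sdiff (𝒯 𝒯' : Mesh d) :
    D.est κ K 𝒯 - D.estOn κ K 𝒯 (𝒯 \ 𝒯') = D.estOn κ K 𝒯 (𝒯' ∩ 𝒯) := by
  rw [sub_eq_iff_eq_add, Finset.inter_comm]
  exact combSq_eq_inter_add_sdiff 𝒯 𝒯' 𝒯 _ _

theorem mul_est_le_estOn_sdiff {Λ σ : ℝ} (hθ : 0 ≤ θ) (hθ1 : θ ≤ 1) (hΛ : 0 ≤ Λ) (hσ0 : 0 ≤ σ)
    (hσ : σ + Λ * √θ ≤ √(1 - θ)) (h : √(D.estOn κ K 𝒯 (𝒯' ∩ 𝒯))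
      ≤ σ * √(D.est κ K 𝒯) + Λ * √(D.estOn κ K 𝒯 (𝒯 \ 𝒯'))) :
    θ * D.est κ K 𝒯 ≤ D.estOn κ K 𝒯 (𝒯 \ 𝒯') := by
  have estOn_nonneg : ∀ 𝒰, 0 ≤ D.estOn κ K 𝒯 𝒰 := fun 𝒰 => combSq_nonneg _ _ _ _
  have := mul_sq_le_sq_of_sq_sub_sq_le hθ hθ1 hΛ (Real.sqrt_nonneg (D.est κ K 𝒯))
    (Real.sqrt_nonneg (D.estOn κ K 𝒯 (𝒯 \ 𝒯'))) hσ0 hσ ?_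
  · rwa [Real.sq_sqrt (est_nonneg _), Real.sq_sqrt (estOn_nonneg _)] at this
  · rw [Real.sq_sqrt (est_nonneg _), Real.sq_sqrt (estOn_nonneg _), est_sub_estOn_sdiff,
      ← Real.sq_sqrt (estOn_nonneg (𝒯' ∩ 𝒯))]
    gcongr

theorem CombinedAxioms.optimalMarking {Cs Cd : ℝ} (hC : D.CombinedAxioms κ K Cs Cd)
    (S : Setting κ K) (hs : 0 ≤ Cs) (hd : 0 ≤ Cd) (hθ : 0 ≤ θ) (hθ1 : θ ≤ 1) (hq0 : 0 ≤ q)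
    (hq : q + Cs * Cd * √θ ≤ √(1 - θ)) (h : D.IsMesh 𝒯) : D.OptimalMarking κ K θ q 𝒯 := by
  intro 𝒯' h' hest
  refine mul_est_le_estOn_sdiff hθ hθ1 (by positivity) hq0 hq ?_
  have stability := (abs_le.mp (hC.stability 𝒯 𝒯' h h' _ (S.solH_mem D 𝒯') _
    (S.dualLinH_mem D 𝒯') _ (S.solH_mem D 𝒯) _ (S.dualLinH_mem D 𝒯) (𝒯' ∩ 𝒯)
    (fun T hT => by simpa using hT))).1
  have mono : √(D.combSq 𝒯' (𝒯' ∩ 𝒯) (D.solH κ 𝒯') (D.dualLinH κ K 𝒯')) ≤ √(D.est κ K 𝒯') :=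
    Real.sqrt_le_sqrt (combSq_mono Finset.inter_subset_left _ _ _)
  have reliability := mul_le_mul_of_nonneg_left (hC.discrete_reliability 𝒯 𝒯' h h') hs
  change √(D.combSq 𝒯 (𝒯' ∩ 𝒯) (D.solH κ 𝒯) (D.dualLinH κ K 𝒯)) ≤ _
  linarith

namespace Axioms

theorem etaOn_inter_le (hA : D.Axioms κ K Cstab Clip qred Crel Cdrel) (S : Setting κ K)
    (hs : 0 ≤ Cstab) (h : D.IsMesh 𝒯) (h' : D.Refinement 𝒯 𝒯') :
    D.etaOn 𝒯 (𝒯' ∩ 𝒯) (D.solH κ 𝒯) ≤ D.etaOn 𝒯' (𝒯' ∩ 𝒯) (D.solH κ 𝒯')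
      + Cstab * Cdrel * D.etaOn 𝒯 (𝒯 \ 𝒯') (D.solH κ 𝒯) := by
  have stability := (abs_le.mp (hA.abs_etaOn_sub_le S h h' (S.solH_mem D 𝒯) (S.solH_mem D 𝒯')
    (𝒰 := 𝒯' ∩ 𝒯) (by simp))).1
  have reliability := mul_le_mul_of_nonneg_left (hA.discrete_reliability_eta 𝒯 𝒯' h h') hs
  linarith

theorem zetaOn_inter_le (hA : D.Axioms κ K Cstab Clip qred Crel Cdrel) (S : Setting κ K)
    (hs : 0 ≤ Cstab) (hl : 0 ≤ Clip) (h : D.IsMesh 𝒯) (h' : D.Refinement 𝒯 𝒯') {C : ℝ}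
    (hC0 : 0 ≤ C) (hC : ∀ v, |goalForm K (D.solH κ 𝒯' - D.solH κ 𝒯) v| ≤ C * ‖v‖) :
    D.zetaOn 𝒯 (D.solH κ 𝒯) (𝒯' ∩ 𝒯) (D.dualLinH κ K 𝒯)
      ≤ D.zetaOn 𝒯' (D.solH κ 𝒯') (𝒯' ∩ 𝒯) (D.dualLinH κ K 𝒯')
        + Cstab * Cdrel * D.zetaOn 𝒯 (D.solH κ 𝒯) (𝒯 \ 𝒯') (D.dualLinH κ K 𝒯)
        + (Clip * Cdrel * D.etaOn 𝒯 (𝒯 \ 𝒯') (D.solH κ 𝒯) + Cstab * (S.CE * (C / S.α))) := by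
  set u := D.solH κ 𝒯
  set y := D.dualH κ K 𝒯' u
  have mesh_change := (abs_le.mp (hA.abs_zetaOn_sub_le h h' (S.dualLinH_mem D 𝒯)
    (S.dualH_mem D 𝒯' u) u u (𝒰 := 𝒯' ∩ 𝒯) (by simp))).1
  rw [sub_self u, S.energyNorm_zero, mul_zero, add_zero] at mesh_change
  have point_change := (abs_le.mp (hA.abs_zetaOn_sub_le (h.refinement h') (Refinement.refl 𝒯')
    (S.dualH_mem D 𝒯' u) (S.dualLinH_mem D 𝒯') u (D.solH κ 𝒯') (𝒰 := 𝒯' ∩ 𝒯)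
    (by simp +contextual))).1
  have dual_perturbation : energyNorm κ (D.dualLinH κ K 𝒯' - y) ≤ S.CE * (C / S.α) :=
    (S.energy_le _).trans (mul_le_mul_of_nonneg_left
      (S.norm_dualIn_sub_le (S.closed D.p 𝒯') hC0 hC) S.CE_pos.le)
  have primal := mul_le_mul_of_nonneg_left (hA.discrete_reliability_eta 𝒯 𝒯' h h') hl
  have dual := mul_le_mul_of_nonneg_left (hA.discrete_reliability_zeta 𝒯 𝒯' h h' u) hs
  have perturbation := mul_le_mul_of_nonneg_left dual_perturbation hs
  linarith!

theorem sqrt_estOn_inter_le (hA : D.Axioms κ K Cstab Clip qred Crel Cdrel) (S : Setting κ K)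
    (hs : 0 ≤ Cstab) (hl : 0 ≤ Clip) (hdr : 0 ≤ Cdrel) (h : D.IsMesh 𝒯)
    (h' : D.Refinement 𝒯 𝒯') {C : ℝ} (hC0 : 0 ≤ C)
    (hC : ∀ v, |goalForm K (D.solH κ 𝒯' - D.solH κ 𝒯) v| ≤ C * ‖v‖) :
    √(D.estOn κ K 𝒯 (𝒯' ∩ 𝒯)) ≤ √(D.est κ K 𝒯')
      + (Cstab + Clip) * Cdrel * √(D.estOn κ K 𝒯 (𝒯 \ 𝒯')) + Cstab * (S.CE * (C / S.α)) := by
  have := S.CE_pos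
  have := S.elliptic.coercivity_pos
  rw [add_mul]
  exact (sqrt_sq_add_sq_le_of_le_add (etaOn_nonneg _ _ _) (zetaOn_nonneg _ _ _ _)
    (etaOn_nonneg _ _ _) (by positivity) (by positivity) (by positivity)
    (hA.etaOn_inter_le S hs h h') (hA.zetaOn_inter_le S hs hl h h' hC0 hC)).trans
    (by gcongr; exacts [combSq_mono Finset.inter_subset_left _ _ _, le_rfl])

theorem norm_sol_sub_solH_le_sqrt_est (hA : D.Axioms κ K Cstab Clip qred Crel Cdrel)
    (S : Setting κ K) (hr : 0 ≤ Crel) (h : D.IsMesh 𝒯) :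
    ‖D.sol κ - D.solH κ 𝒯‖ ≤ S.CE * Crel * √(D.est κ K 𝒯) :=
  (hA.norm_sol_sub_solH_le S h).trans (mul_le_mul_of_nonneg_left (etaOn_le_sqrt_estOn 𝒯 𝒯)
    (mul_nonneg S.CE_pos.le hr))

theorem abs_goalForm_solH_sub_le (hA : D.Axioms κ K Cstab Clip qred Crel Cdrel) (S : Setting κ K)
    (hr : 0 ≤ Crel) {ε : ℝ} (hε : 0 ≤ ε) (h : D.IsMesh 𝒯) (h' : D.Refinement 𝒯 𝒯')
    (hsmall : ∀ v, |goalForm K (D.sol κ - D.solH κ 𝒯) v| ≤ ε * ‖D.sol κ - D.solH κ 𝒯‖ * ‖v‖)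
    (hest : √(D.est κ K 𝒯') ≤ q * √(D.est κ K 𝒯)) (v : H10 Ω) :
    |goalForm K (D.solH κ 𝒯' - D.solH κ 𝒯) v|
      ≤ (ε + S.MG * q) * (S.CE * Crel * √(D.est κ K 𝒯)) * ‖v‖ := by
  have := S.MG_pos
  have := S.CE_pos
  have err := hA.norm_sol_sub_solH_le_sqrt_est S hr h
  have err' : ‖D.sol κ - D.solH κ 𝒯'‖ ≤ S.CE * Crel * (q * √(D.est κ K 𝒯)) :=
    (hA.norm_sol_sub_solH_le_sqrt_est S hr (h.refinement h')).trans (by gcongr)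
  rw [← sub_sub_sub_cancel_left (D.solH κ 𝒯) (D.solH κ 𝒯') (D.sol κ), map_sub, sub_apply]
  calc |goalForm K (D.sol κ - D.solH κ 𝒯) v - goalForm K (D.sol κ - D.solH κ 𝒯') v|
      ≤ ε * ‖D.sol κ - D.solH κ 𝒯‖ * ‖v‖ + S.MG * ‖D.sol κ - D.solH κ 𝒯'‖ * ‖v‖ :=
        (abs_sub _ _).trans (add_le_add (hsmall v) (S.goalForm_le _ v))
    _ ≤ ε * (S.CE * Crel * √(D.est κ K 𝒯)) * ‖v‖
        + S.MG * (S.CE * Crel * (q * √(D.est κ K 𝒯))) * ‖v‖ := by gcongr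
    _ = _ := by ring

theorem optimalMarking (hA : D.Axioms κ K Cstab Clip qred Crel Cdrel) (S : Setting κ K)
    (hs : 0 ≤ Cstab) (hl : 0 ≤ Clip) (hr : 0 ≤ Crel) (hdr : 0 ≤ Cdrel) (hθ : 0 ≤ θ) (hθ1 : θ ≤ 1)
    (hq0 : 0 ≤ q) {ε : ℝ} (hε : 0 ≤ ε)
    (hq : q + Cstab * S.CE ^ 2 * Crel / S.α * (ε + S.MG * q) + (Cstab + Clip) * Cdrel * √θ
      ≤ √(1 - θ)) (h : D.IsMesh 𝒯)
    (hsmall : ∀ v, |goalForm K (D.sol κ - D.solH κ 𝒯) v| ≤ ε * ‖D.sol κ - D.solH κ 𝒯‖ * ‖v‖) :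
    D.OptimalMarking κ K θ q 𝒯 := by
  intro 𝒯' h' hest
  have := S.MG_pos
  have := S.CE_pos
  have := S.elliptic.coercivity_pos
  refine mul_est_le_estOn_sdiff hθ hθ1 (by positivity) (by positivity) hq ?_
  have := hA.sqrt_estOn_inter_le S hs hl hdr h h' (by positivity)
    (hA.abs_goalForm_solH_sub_le S hr hε h h' hsmall hest)
  calc √(D.estOn κ K 𝒯 (𝒯' ∩ 𝒯))
      ≤ q * √(D.est κ K 𝒯) + (Cstab + Clip) * Cdrel * √(D.estOn κ K 𝒯 (𝒯 \ 𝒯'))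
        + Cstab * (S.CE * ((ε + S.MG * q) * (S.CE * Crel * √(D.est κ K 𝒯)) / S.α)) := by
          linarith
    _ = _ := by ring

end Axioms

end Data

namespace Setting

variable {𝒯 : ℕ → Mesh d} {ℳ : ℕ → Finset (Element d)}

theorem tendsto_sqrt_est (S : Setting κ K) (hθ : 0 < θ) (hθ1 : θ ≤ 1) (hs : 0 ≤ Cstab)
    (hl : 0 ≤ Clip) (hq0 : 0 ≤ qred) (hq : qred < 1) (hr : 0 < Crel)
    (hM : D.MeshAssumptions Cmesh) (hA : D.Axioms κ K Cstab Clip qred Crel Cdrel)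
    (hrun : D.IsRun κ K θ Cmark 𝒯 ℳ) :
    Filter.Tendsto (fun ℓ => √(D.est κ K (𝒯 ℓ))) Filter.atTop (nhds 0) := by
  obtain ⟨Clin, qlin, _, hql0, hql1, hlin⟩ := S.exists_linear_convergence hθ hθ1 hs hl hq0 hq hr
  rw [← Real.sqrt_zero]
  refine (Real.continuous_sqrt.tendsto 0).comp (squeeze_zero (fun ℓ => Data.est_nonneg _)
    (fun ℓ => hlin D _ _ _ hM hA 𝒯 ℳ hrun 0 ℓ (Nat.zero_le ℓ)) ?_)
  simpa using ((tendsto_pow_atTop_nhds_zero_of_lt_one hql0.le hql1).const_mul Clin).mul_const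
    (D.est κ K (𝒯 0))

theorem eventually_goalForm_le (S : Setting κ K) (hK : IsCompactOperator K)
    (hM : D.MeshAssumptions Cmesh) (hrun : D.IsRun κ K θ Cmark 𝒯 ℳ)
    (hlim : Filter.Tendsto (fun ℓ => D.solH κ (𝒯 ℓ)) Filter.atTop (nhds (D.sol κ))) {ε : ℝ}
    (hε : 0 < ε) : ∀ᶠ ℓ in Filter.atTop, ∀ v,
      |goalForm K (D.sol κ - D.solH κ (𝒯 ℓ)) v| ≤ ε * ‖D.sol κ - D.solH κ (𝒯 ℓ)‖ * ‖v‖ :=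
  S.elliptic.eventually_add_flip_le hK (X := fun ℓ => D.space (𝒯 ℓ))
    (fun i _ hij => hM.space_mono (hrun.isMesh i) (hrun.refinement hij))
    (fun ℓ => ⟨S.solH_mem D (𝒯 ℓ), fun x hx => by
      rw [map_sub, sub_apply, (S.solvesOn_sol D).primal x trivial,
        (S.solvesOn_solH D (𝒯 ℓ)).primal x hx, sub_self]⟩) hlim hε

theorem exists_optimalMarking (S : Setting κ K) (hK : IsCompactOperator K)
    (hθ : 0 < θ) (hθ' : θ < thetaOpt (Cstab + Clip) Cdrel) (hs : 0 ≤ Cstab) (hl : 0 ≤ Clip)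
    (hq0 : 0 ≤ qred) (hq : qred < 1) (hr : 0 < Crel) (hdr : 0 ≤ Cdrel) :
    ∃ q : ℝ, 0 < q ∧ ∀ (D : Data Ω) (Cmesh Cmark : ℝ), D.MeshAssumptions Cmesh →
      D.Axioms κ K Cstab Clip qred Crel Cdrel → ∀ 𝒯 ℳ, D.IsRun κ K θ Cmark 𝒯 ℳ →
        ∀ᶠ j in Filter.atTop, D.OptimalMarking κ K θ q (𝒯 j) := by
  have hα := S.elliptic.coercivity_pos
  have hG := S.MG_pos
  have hCE := S.CE_pos
  have hθ1 := hθ'.le.trans (thetaOpt_le_one _ _)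
  obtain ⟨σ, hσ, hσ_eq⟩ : ∃ σ, 0 < σ ∧ σ + (Cstab + Clip) * Cdrel * √θ = √(1 - θ) :=
    ⟨_, sub_pos.mpr (mul_sqrt_lt_of_lt_thetaOpt hθ.le (add_nonneg hs hl) hdr hθ'),
      sub_add_cancel _ _⟩
  set Θ := Cstab * S.CE ^ 2 * Crel / S.α
  -- `q` and `ε` solve `q + Θ * S.MG * q = σ / 2` and `(1 + Θ) * ε = σ / 2`.
  refine ⟨σ / 2 / (1 + Θ * S.MG), by positivity, fun D Cmesh Cmark hM hA 𝒯 ℳ hrun => ?_⟩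
  have hlim : Filter.Tendsto (fun ℓ => D.solH κ (𝒯 ℓ)) Filter.atTop (nhds (D.sol κ)) := by
    rw [tendsto_iff_norm_sub_tendsto_zero]
    refine squeeze_zero (fun _ => norm_nonneg _) (fun ℓ => ?_)
      (by simpa using
        (S.tendsto_sqrt_est hθ hθ1 hs hl hq0 hq hr hM hA hrun).const_mul (S.CE * Crel))
    rw [norm_sub_rev]
    exact hA.norm_sol_sub_solH_le_sqrt_est S hr.le (hrun.isMesh ℓ)
  have hε : 0 < σ / 2 / (1 + Θ) := by positivity
  filter_upwards [S.eventually_goalForm_le hK hM hrun hlim hε] with j hj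
  refine hA.optimalMarking S hs hl hr.le hdr hθ.le hθ1 (by positivity) hε.le ?_ (hrun.isMesh j) hj
  have hq_eq : (1 + Θ * S.MG) * (σ / 2 / (1 + Θ * S.MG)) = σ / 2 :=
    mul_div_cancel₀ _ (by positivity)
  have hε_eq : (1 + Θ) * (σ / 2 / (1 + Θ)) = σ / 2 := mul_div_cancel₀ _ (by positivity)
  linarith

theorem exists_rate_of_combinedAxioms (S : Setting κ K) {Cs Cd s t : ℝ} (hθ : 0 < θ)
    (hs : 0 ≤ Cstab) (hl : 0 ≤ Clip) (hq0 : 0 ≤ qred) (hq : qred < 1) (hr : 0 < Crel)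
    (hdr : 0 ≤ Cdrel) (hCmesh : 0 < Cmesh) (hCmark : 0 ≤ Cmark) (hCs : 0 ≤ Cs) (hCd : 0 ≤ Cd)
    (hθ' : θ < thetaOpt Cs Cd) (hs' : 0 < s) (ht' : 0 < t) :
    ∃ Copt : ℝ, 0 < Copt ∧ ∀ D : Data Ω, D.MeshAssumptions Cmesh →
      D.Axioms κ K Cstab Clip qred Crel Cdrel → D.CombinedAxioms κ K Cs Cd →
      D.approxPrimal κ s + D.approxDual κ K t < ⊤ → ∀ 𝒯 ℳ, D.IsRun κ K θ Cmark 𝒯 ℳ →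
        ∀ ℓ, D.RateBound κ K s t Copt (𝒯 ℓ) := by
  have hθ1 := hθ'.le.trans (thetaOpt_le_one _ _)
  have hq' := sub_pos.mpr (mul_sqrt_lt_of_lt_thetaOpt hθ.le hCs hCd hθ')
  obtain ⟨Copt, hCopt, rate⟩ := S.exists_rate hθ hθ1 hs hl hq0 hq hr hdr hCmesh hCmark hq' hs' ht'
  refine ⟨Copt, hCopt, fun D hM hA hcomb hfin 𝒯 ℳ hrun ℓ => ?_⟩
  simpa [hrun.init] using rate D hM hA hfin 𝒯 ℳ hrun 0 (fun j _ => hcomb.optimalMarking S hCs hCd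
    hθ.le hθ1 hq'.le (sub_add_cancel _ _).le (hrun.isMesh j)) ℓ (Nat.zero_le ℓ)

theorem exists_eventual_rate (S : Setting κ K) (hK : IsCompactOperator K) (hθ : 0 < θ)
    (hθ' : θ < thetaOpt (Cstab + Clip) Cdrel) (hs : 0 ≤ Cstab) (hl : 0 ≤ Clip) (hq0 : 0 ≤ qred)
    (hq : qred < 1) (hr : 0 < Crel) (hdr : 0 ≤ Cdrel) (hCmesh : 0 < Cmesh) (hCmark : 0 ≤ Cmark) :
    ∃ Copt : ℝ → ℝ → ℝ, (∀ s t : ℝ, 0 < Copt s t) ∧ ∀ D : Data Ω, D.MeshAssumptions Cmesh →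
      D.Axioms κ K Cstab Clip qred Crel Cdrel → ∀ 𝒯 ℳ, D.IsRun κ K θ Cmark 𝒯 ℳ →
        ∃ ℓ₀ : ℕ, ∀ s t : ℝ, 0 < s → 0 < t → D.approxPrimal κ s + D.approxDual κ K t < ⊤ →
          ∀ ℓ, ℓ₀ ≤ ℓ → D.RateBound κ K s t
            (Copt s t * (((𝒯 ℓ₀).card - D.mesh₀.card : ℕ) + 1 : ℝ) ^ min (2 * s) (2 * t))
            (𝒯 ℓ) := by
  have hθ1 := hθ'.le.trans (thetaOpt_le_one _ _)
  obtain ⟨q, hq', eventually_optimal⟩ := S.exists_optimalMarking hK hθ hθ' hs hl hq0 hq hr hdr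
  have rate : ∀ s t : ℝ, ∃ Copt : ℝ, 0 < Copt ∧ (0 < s → 0 < t → _) := fun s t => by
    by_cases hst : 0 < s ∧ 0 < t
    · obtain ⟨C, hC, hrate⟩ :=
        S.exists_rate hθ hθ1 hs hl hq0 hq hr hdr hCmesh hCmark hq' hst.1 hst.2
      exact ⟨C, hC, fun _ _ => hrate⟩
    · exact ⟨1, one_pos, fun hs ht => absurd ⟨hs, ht⟩ hst⟩
  choose Copt hCopt hrate using rate
  refine ⟨Copt, hCopt, fun D hM hA 𝒯 ℳ hrun => ?_⟩
  obtain ⟨ℓ₀, hℓ₀⟩ := Filter.eventually_atTop.mp (eventually_optimal D _ _ hM hA 𝒯 ℳ hrun)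
  exact ⟨ℓ₀, fun s t hs' ht' hfin => hrate s t hs' ht' D hM hA hfin 𝒯 ℳ hrun ℓ₀ hℓ₀⟩

end Setting

end OptimalMarking

end GOAFEM

end

theorem theorem2p7_general (d : ℕ) (hd : 0 < d) (Ω : Set (GOAFEM.Pt d))
    (hΩb : Bornology.IsBounded Ω) (κ : GOAFEM.Coeff d) (hκ : κ.Admissible Ω)
    (K : GOAFEM.GoalOp Ω) :
    (∀ θ Cstab Clip qred Crel : ℝ, 0 < θ → θ ≤ 1 → 0 < Cstab → 0 ≤ Clip →
      0 < qred → qred < 1 → 0 < Crel →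
      ∃ Clin qlin : ℝ, 0 < Clin ∧ 0 < qlin ∧ qlin < 1 ∧
        (∀ (D : GOAFEM.Data Ω) (Cmesh Cdrel Cmark : ℝ), 0 < Cmesh → 0 < Cdrel → 1 ≤ Cmark →
          D.MeshAssumptions Cmesh → D.Axioms κ K Cstab Clip qred Crel Cdrel →
          ∀ 𝒯 ℳ, D.IsRun κ K θ Cmark 𝒯 ℳ → ∀ ℓ n : ℕ, ℓ ≤ n →
            D.est κ K (𝒯 n) ≤ Clin * qlin ^ (n - ℓ) * D.est κ K (𝒯 ℓ)) ∧
        (∀ Cmesh Cdrel Cmark Cs Cd s t : ℝ, 0 < Cmesh → 0 < Cdrel → 1 ≤ Cmark →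
          0 < Cs → 0 < Cd → θ < GOAFEM.thetaOpt Cs Cd → 0 < s → 0 < t →
          ∃ Copt : ℝ, 0 < Copt ∧
            ∀ D : GOAFEM.Data Ω, D.MeshAssumptions Cmesh →
              D.Axioms κ K Cstab Clip qred Crel Cdrel → D.CombinedAxioms κ K Cs Cd →
              D.approxPrimal κ s + D.approxDual κ K t < ⊤ →
              ∀ 𝒯 ℳ, D.IsRun κ K θ Cmark 𝒯 ℳ → ∀ ℓ : ℕ, D.RateBound κ K s t Copt (𝒯 ℓ))) ∧
    (∀ Cstab Clip qred Crel Cdrel : ℝ, 0 < Cstab → 0 ≤ Clip →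
      0 < qred → qred < 1 → 0 < Crel → 0 < Cdrel →
      ∃ Cs Cd : ℝ, 0 < Cs ∧ 0 < Cd ∧
        ∀ (D : GOAFEM.Data Ω) (Cmesh : ℝ), 0 < Cmesh → D.MeshAssumptions Cmesh →
          D.Axioms κ K Cstab Clip qred Crel Cdrel → D.CombinedAxioms κ K Cs Cd) ∧
    (IsCompactOperator K → ∀ θ Cstab Clip qred Crel Cdrel Cmesh Cmark : ℝ, 0 < Cstab → 0 ≤ Clip →
      0 < qred → qred < 1 → 0 < Crel → 0 < Cdrel → 0 < Cmesh → 1 ≤ Cmark →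
      0 < θ → θ < GOAFEM.thetaOpt (Cstab + Clip) Cdrel →
      ∃ Copt : ℝ → ℝ → ℝ, (∀ s t : ℝ, 0 < Copt s t) ∧
        ∀ D : GOAFEM.Data Ω, D.MeshAssumptions Cmesh →
          D.Axioms κ K Cstab Clip qred Crel Cdrel →
          ∀ 𝒯 ℳ, D.IsRun κ K θ Cmark 𝒯 ℳ → ∃ ℓ₀ : ℕ, ∀ s t : ℝ, 0 < s → 0 < t →
            D.approxPrimal κ s + D.approxDual κ K t < ⊤ → ∀ ℓ : ℕ, ℓ₀ ≤ ℓ →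
              D.RateBound κ K s t
                (Copt s t * (((𝒯 ℓ₀).card - D.mesh₀.card : ℕ) + 1 : ℝ) ^ min (2 * s) (2 * t))
                (𝒯 ℓ)) := by
  obtain ⟨S⟩ := GOAFEM.nonempty_setting hd hΩb hκ K
  refine ⟨?linear_convergence_and_rate, ?combined_axioms, ?eventual_rate⟩
  case linear_convergence_and_rate =>
    intro θ Cstab Clip qred Crel hθ hθ1 hs hl hq0 hq hr
    obtain ⟨Clin, qlin, hClin, hql0, hql1, linear⟩ :=
      S.exists_linear_convergence hθ hθ1 hs.le hl hq0.le hq hr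
    exact ⟨Clin, qlin, hClin, hql0, hql1,
      fun D Cmesh Cdrel Cmark _ _ _ => linear D Cmesh Cdrel Cmark,
      fun Cmesh Cdrel Cmark Cs Cd s t hCmesh hdr hCmark hCs hCd hθ' hs' ht' =>
        S.exists_rate_of_combinedAxioms hθ hs.le hl hq0.le hq hr hdr.le hCmesh
          (zero_le_one.trans hCmark) hCs.le hCd.le hθ' hs' ht'⟩
  case combined_axioms =>
    intro Cstab Clip qred Crel Cdrel hs hl _ _ _ hdr
    obtain ⟨Cs, Cd, hCs, hCd, combined⟩ := S.exists_combinedAxioms hs hl hdr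
    exact ⟨Cs, Cd, hCs, hCd, fun D _ _ _ => combined D qred Crel⟩
  case eventual_rate =>
    intro hK θ Cstab Clip qred Crel Cdrel Cmesh Cmark hs hl hq0 hq hr hdr hCmesh hCmark hθ hθ'
    exact S.exists_eventual_rate hK hθ hθ' hs.le hl hq0.le hq hr hdr.le hCmesh
      (zero_le_one.trans hCmark)

theorem theorem2p7 (d : ℕ) (hd : 2 ≤ d) (Ω : Set (GOAFEM.Pt d)) (hΩ : IsOpen Ω)
    (hΩb : Bornology.IsBounded Ω) (κ : GOAFEM.Coeff d) (hκ : κ.Admissible Ω)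
    (K : GOAFEM.GoalOp Ω) (hK : IsCompactOperator K) :
    -- (i), and (ii) for `θ_opt` built from constants of the combined estimator
    (∀ θ Cstab Clip qred Crel : ℝ, 0 < θ → θ ≤ 1 → 0 < Cstab → 0 ≤ Clip →
      0 < qred → qred < 1 → 0 < Crel →
      ∃ (ℓ₀ : ℕ) (Clin qlin : ℝ), 0 < Clin ∧ 0 < qlin ∧ qlin < 1 ∧
        (∀ (D : GOAFEM.Data Ω) (Cmesh Cdrel Cmark : ℝ), 0 < Cmesh → 0 < Cdrel → 1 ≤ Cmark →
          D.MeshAssumptions Cmesh → D.Axioms κ K Cstab Clip qred Crel Cdrel →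
          ∀ 𝒯 ℳ, D.IsRun κ K θ Cmark 𝒯 ℳ → ∀ ℓ n : ℕ, ℓ₀ ≤ ℓ → ℓ ≤ n →
            D.est κ K (𝒯 n) ≤ Clin * qlin ^ (n - ℓ) * D.est κ K (𝒯 ℓ)) ∧
        (∀ Cmesh Cdrel Cmark Cs Cd s t : ℝ, 0 < Cmesh → 0 < Cdrel → 1 ≤ Cmark →
          0 < Cs → 0 < Cd → θ < GOAFEM.thetaOpt Cs Cd → 0 < s → 0 < t →
          ∃ Copt : ℝ, 0 < Copt ∧
            ∀ D : GOAFEM.Data Ω, D.MeshAssumptions Cmesh →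
              D.Axioms κ K Cstab Clip qred Crel Cdrel → D.CombinedAxioms κ K Cs Cd →
              D.approxPrimal κ s + D.approxDual κ K t < ⊤ →
              ∀ 𝒯 ℳ, D.IsRun κ K θ Cmark 𝒯 ℳ → ∀ ℓ : ℕ, ℓ₀ ≤ ℓ →
                D.RateBound κ K s t Copt (𝒯 ℓ))) ∧
    -- the combined estimator has such constants
    (∀ Cstab Clip qred Crel Cdrel : ℝ, 0 < Cstab → 0 ≤ Clip →
      0 < qred → qred < 1 → 0 < Crel → 0 < Cdrel →
      ∃ Cs Cd : ℝ, 0 < Cs ∧ 0 < Cd ∧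
        ∀ (D : GOAFEM.Data Ω) (Cmesh : ℝ), 0 < Cmesh → D.MeshAssumptions Cmesh →
          D.Axioms κ K Cstab Clip qred Crel Cdrel → D.CombinedAxioms κ K Cs Cd) ∧
    -- (ii) for `θ_opt` built from the constants of the two individual estimators
    (∀ θ Cstab Clip qred Crel Cdrel Cmesh Cmark : ℝ, 0 < Cstab → 0 ≤ Clip →
      0 < qred → qred < 1 → 0 < Crel → 0 < Cdrel → 0 < Cmesh → 1 ≤ Cmark →
      0 < θ → θ < GOAFEM.thetaOpt (Cstab + Clip) Cdrel →
      ∃ Copt : ℝ → ℝ → ℝ, (∀ s t : ℝ, 0 < Copt s t) ∧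
        ∀ D : GOAFEM.Data Ω, D.MeshAssumptions Cmesh →
          D.Axioms κ K Cstab Clip qred Crel Cdrel →
          ∀ 𝒯 ℳ, D.IsRun κ K θ Cmark 𝒯 ℳ → ∃ ℓ₀ : ℕ, ∀ s t : ℝ, 0 < s → 0 < t →
            D.approxPrimal κ s + D.approxDual κ K t < ⊤ → ∀ ℓ : ℕ, ℓ₀ ≤ ℓ →
              D.RateBound κ K s t
                (Copt s t * (((𝒯 ℓ₀).card - D.mesh₀.card : ℕ) + 1 : ℝ) ^ min (2 * s) (2 * t))
                (𝒯 ℓ)) := by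
  obtain ⟨linear_and_rate, combined, eventual_rate⟩ :=
    theorem2p7_general d (zero_lt_two.trans_le hd) Ω hΩb κ hκ K
  exact ⟨fun θ Cstab Clip qred Crel hθ hθ1 hs hl hq0 hq hr =>
    ⟨0, by simpa only [Nat.zero_le, true_imp_iff] using
      linear_and_rate θ Cstab Clip qred Crel hθ hθ1 hs hl hq0 hq hr⟩, combined, eventual_rate hK⟩
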